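/- Setting. Let $\mathcal G=(V,E)$ be a connected simple graph drawn in the plane $\mathbb R^2$ (edges are simple arcs joining their two endpoints, containing no other vertex, two distinct edges meeting only at vertices) which is locally finite (finite degrees, finitely many vertices in every bounded region) and invariant, as a drawing, under the translations by $(1,0)$ and $(0,1)$, the reflection with respect to the line $\{0\}\times\mathbb R$ and the rotation by $\pi/2$ around $0$. Let $S$ be a finite connected graph and let $\mathcal S=\mathcal G\times S$ be the slab: its vertex set is $V\times V_S$, and $(u,v)$, $(u',v')$ are adjacent if $u=u'$ and $vv'\in E_S$, or $uu'\in E$ and $v=v'$. Fix $q\ge 1$. For $p\in[0,1]$, the random-cluster measure on a finite graph gives a configuration $\omega$ of open and closed edges a probability proportional to $p^{o(\omega)}(1-p)^{c(\omega)}q^{k(\omega)}$, where $o$, $c$ and $k$ are the numbers of open edges, closed edges and clusters (clusters being counted after the identification of boundary vertices that are wired together by the boundary condition). An infinite-volume measure on $\mathcal S$ with parameters $p,q$ is a probability measure on $\{0,1\}^{E(\mathcal S)}$ that is a weak limit of random-cluster measures on finite induced subgraphs increasing to $\mathcal S$, with arbitrary boundary conditions. When there is exactly one such measure it is denoted by $\phi_p$.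 For $b,d>0$, let $\mathcal C_h(b,d)$ be the event that some vertex of $(\{0\}\times[0,d])\times S$ is connected to some vertex of $(\{b\}\times[0,d])\times S$ by an open path contained in the subgraph of $\mathcal S$ induced by the vertices lying in $([0,b]\times[0,d])\times S$. Lemma. There exists $\beta>0$ (depending only on $q$, $\mathcal G$ and $S$) such that, for all $0\le p<p'\le 1$ for which the infinite-volume measure with parameters $p,q$ and the one with parameters $p',q$ are unique, and for all integers $N>n\ge 1$, $$\frac{1-\phi_{p'}(\mathcal C_h(2N,N))}{1-\phi_{p}(\mathcal C_h(2N,N))}\le \exp\left(-2(p'-p)\frac Nn\left[\phi_p(\mathcal C_h(2n,n))^{2N/n}-2\left\lceil\frac Nn\right\rceil\big(1-\phi_p(\mathcal C_h(2n,n))\big)^{\beta}\right]\right).$$ -/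

import Mathlib

open MeasureTheory Filter Topology

/-! ### Plane graphs and their symmetries -/

/-- A simple graph drawn in the plane: `verts` is the set of vertices and `arcs` the set of edges,
every edge being a simple arc joining two distinct vertices and containing no other vertex. Two
different edges meet at most at vertices, and no two edges have the same endpoints. -/
structure PlaneGraph where
  verts : Set (ℝ × ℝ)
  arcs : Set (Set (ℝ × ℝ))
  arc_spec : ∀ e ∈ arcs, ∃ u ∈ verts, ∃ v ∈ verts, ∃ γ : Path u v,
    Function.Injective γ ∧ Set.range γ = e ∧ e ∩ verts = {u, v}
  inter_subset : ∀ e ∈ arcs, ∀ f ∈ arcs, e ≠ f → e ∩ f ⊆ verts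
  no_parallel : ∀ e ∈ arcs, ∀ f ∈ arcs, e ∩ verts = f ∩ verts → e = f

namespace PlaneGraph

/-- The abstract graph underlying a plane graph. -/
def graph (G : PlaneGraph) : SimpleGraph G.verts where
  Adj u v := u ≠ v ∧ ∃ e ∈ G.arcs, e ∩ G.verts = {u.1, v.1}
  symm := ⟨fun u v h => ⟨h.1.symm, by
    obtain ⟨e, he, h2⟩ := h.2
    exact ⟨e, he, by rw [h2, Set.pair_comm]⟩⟩⟩
  loopless := ⟨fun _ h => h.1 rfl⟩

/-- Finitely many vertices in every bounded region, and finitely many edges at every vertex. -/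
def IsLocallyFinite (G : PlaneGraph) : Prop :=
  (∀ B : Set (ℝ × ℝ), Bornology.IsBounded B → (B ∩ G.verts).Finite) ∧
    ∀ v : G.verts, (G.graph.neighborSet v).Finite

/-- The drawing (vertices and edges) is invariant under the map `T` of the plane. -/
def InvariantUnder (G : PlaneGraph) (T : ℝ × ℝ → ℝ × ℝ) : Prop :=
  T '' G.verts = G.verts ∧ (fun e : Set (ℝ × ℝ) => T '' e) '' G.arcs = G.arcs

/-- Invariance under the translations by `(1,0)` and `(0,1)`, the reflection in the vertical axis
and the rotation by a right angle around the origin. -/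
structure IsSymmetric (G : PlaneGraph) : Prop where
  translate_right : G.InvariantUnder fun z => (z.1 + 1, z.2)
  translate_up : G.InvariantUnder fun z => (z.1, z.2 + 1)
  reflect : G.InvariantUnder fun z => (-z.1, z.2)
  rotate : G.InvariantUnder fun z => (-z.2, z.1)

/-- The slab `G × S`: two vertices are adjacent if they agree in one coordinate and are adjacent
in the other one. -/
abbrev slab (G : PlaneGraph) {VS : Type*} (S : SimpleGraph VS) : SimpleGraph (G.verts × VS) :=
  G.graph □ S

end PlaneGraph

/-! ### The random-cluster model on a finite graph -/

/-- Percolation configurations on a graph: `true` means open, `false` means closed. -/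
abbrev Config {V : Type*} (H : SimpleGraph V) : Type _ := H.edgeSet → Bool

/-- The subgraph of open edges. -/
def openGraph {V : Type*} {H : SimpleGraph V} (ω : Config H) : SimpleGraph V where
  Adj x y := ∃ h : H.Adj x y, ω ⟨s(x, y), h⟩ = true
  symm := ⟨fun x y hxy => by
    obtain ⟨h, hω⟩ := hxy
    refine ⟨h.symm, ?_⟩
    have he : (⟨s(y, x), h.symm⟩ : H.edgeSet) = ⟨s(x, y), h⟩ := Subtype.ext Sym2.eq_swap
    rw [he]
    exact hω⟩
  loopless := ⟨fun _ hx => hx.1.ne rfl⟩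

/-- The weight `p ^ o(ω) * (1 - p) ^ c(ω) * q ^ k(ω)`, where `o`, `c` are the numbers of open and
closed edges and `k` is the number of clusters, counted after identifying the vertices that are
wired together by the boundary condition `ξ` (no vertices are wired if `ξ = ⊥`). -/
noncomputable def rcWeight {V : Type*} {H : SimpleGraph V} (p q : ℝ) (ξ : Setoid V)
    (ω : Config H) : ℝ :=
  p ^ Nat.card {e : H.edgeSet // ω e = true} *
    (1 - p) ^ Nat.card {e : H.edgeSet // ω e = false} *
    q ^ Nat.card (Quotient ((openGraph ω).reachableSetoid ⊔ ξ))

open Classical in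
/-- The probability of the event `A` under the random-cluster measure on the finite graph `H` with
parameters `p`, `q` and boundary condition `ξ`. -/
noncomputable def rcProb {V : Type*} [Fintype V] {H : SimpleGraph V} (p q : ℝ) (ξ : Setoid V)
    (A : Set (Config H)) : ℝ :=
  (∑ ω : Config H, if ω ∈ A then rcWeight p q ξ ω else 0) / ∑ ω : Config H, rcWeight p q ξ ω

/-! ### Infinite-volume measures -/

/-- A boundary condition on the finite vertex set `Λ` of `H`: a partition that wires together only
vertices of `Λ` having a neighbour outside `Λ`. -/
def IsBoundaryCondition {W : Type*} (H : SimpleGraph W) (Λ : Finset W)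
    (ξ : Setoid (Λ : Set W)) : Prop :=
  ∀ x y, ξ x y → x = y ∨ ((∃ z ∉ Λ, H.Adj x z) ∧ ∃ z ∉ Λ, H.Adj y z)

open Classical in
/-- A configuration on the subgraph induced by `Λ`, extended by closed edges. -/
noncomputable def extendClosed {W : Type*} (H : SimpleGraph W) (Λ : Finset W)
    (ω : Config (H.induce (Λ : Set W))) : Config H :=
  fun e => decide (∃ f : (H.induce (Λ : Set W)).edgeSet, f.1.map Subtype.val = e.1 ∧ ω f = true)

/-- `μ` is an infinite-volume random-cluster measure on `H`: a weak limit (convergence of the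
probabilities of cylinder events) of random-cluster measures on finite induced subgraphs increasing
to `H`, with arbitrary boundary conditions. -/
def IsInfiniteVolume {W : Type*} (H : SimpleGraph W) (p q : ℝ) (μ : Measure (Config H)) : Prop :=
  IsProbabilityMeasure μ ∧
    ∃ (Λ : ℕ → Finset W) (ξ : ∀ k, Setoid (Λ k : Set W)),
      Monotone Λ ∧ (∀ x, ∃ k, x ∈ Λ k) ∧ (∀ k, IsBoundaryCondition H (Λ k) (ξ k)) ∧
      ∀ (F : Finset H.edgeSet) (η : Config H),
        Tendsto
          (fun k => rcProb (H := H.induce (Λ k : Set W)) p q (ξ k)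
            {ω | ∀ e ∈ F, extendClosed H (Λ k) ω e = η e})
          atTop (𝓝 (μ.real {ω | ∀ e ∈ F, ω e = η e}))

/-- `μ` is the unique infinite-volume random-cluster measure on `H` with parameters `p`, `q`. -/
def IsUniqueInfiniteVolume {W : Type*} (H : SimpleGraph W) (p q : ℝ)
    (μ : Measure (Config H)) : Prop :=
  IsInfiniteVolume H p q μ ∧ ∀ ν : Measure (Config H), IsInfiniteVolume H p q ν → ν = μ

/-! ### Crossings -/

/-- The event that the rectangle `[0,b] × [0,d]`, thickened by `S`, is crossed horizontally: some
vertex over `{0} × [0,d]` is connected to some vertex over `{b} × [0,d]` by an open path that stays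
in the subgraph induced by the vertices over `[0,b] × [0,d]`. -/
def crossH (G : PlaneGraph) {VS : Type*} (S : SimpleGraph VS) (b d : ℝ) :
    Set (Config (G.slab S)) :=
  {ω | ∃ x y : {v : G.verts × VS | v.1.1 ∈ Set.Icc 0 b ×ˢ Set.Icc 0 d},
    x.1.1.1.1 = 0 ∧ y.1.1.1.1 = b ∧
      ((openGraph ω).induce {v | v.1.1 ∈ Set.Icc 0 b ×ˢ Set.Icc 0 d}).Reachable x y}

/-! Write ε for the probability that the 2n × n rectangle is not crossed at parameter p. Two
separate inequalities are combined.

Comparison of parameters (`rcProb_compl_le`, `PlaneGraph.one_sub_crossX_le_exp`). The rectangle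
[0,2N] × [0,N] contains at least N/(2n) strips of size 2N × n with disjoint vertex sets, and a
crossing of one strip crosses the rectangle. Let f count the crossed strips and o the open edges.
Both f and o − f are increasing, and f vanishes if the rectangle is not crossed. In finite volume
the measure at p' is the measure at p tilted by exp(L o), where L ≥ 4(p' − p) is the logarithm of
the odds ratio. Splitting o into (o − f) + f, FKG and Jensen bound the failure probability at p' by
the one at p times exp(−L E[f]). This gives the factor exp(−2(p' − p)(N/n) φ_p(C_h(2N,n))).

Long strips (`PlaneGraph.exists_strip_bound`). It remains to bound φ_p(C_h(2N,n)) from below.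
Crossing paths of the slab meet after projection to the plane, but they need not be connected, so
planarity is replaced by a gluing inequality (`Gluing.sum_indicator_le`). Suppose that every path
from A to A' and every path from B to B' have a common column. Then the probability that A is
connected to A' but not to B is at most K^s δ + ρ^s for every s, where δ is the probability that B
is not connected to B'; optimising in s gives C δ^b. For the proof, take a minimal path γ from A to
A' and the sites where it comes close to the cluster of B. If there are few sites, closing them
separates B from B' at bounded cost. If there are many, branches from γ to the cluster can be opened
at any subset of the sites, and the subset can be read off from the result, which yields an
exponential gain. The decoding requires that γ remain minimal after the surgery. This is achieved by
auxiliary marks, one preferred neighbour for each vertex, which are modified together with the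
edges.

By gluing, symmetry and the square-root trick, a crossing is widened by up to n/2 at cost C ε^b
(`PlaneGraph.exists_extension_bound`), and this is iterated O(N/n) times. The constants degenerate
as p approaches 0 or 1, so these regimes are treated separately. For small p one has ε ≥ 1/2 and the
error term alone exceeds 1. For p near 1 the measure dominates independent percolation in one planar
layer, where a renormalisation recursion makes the failure probability exponentially small in n with
a base that is a power of 1 − p; this is compared with the lower bound ε ≥ (1 − p)^(cn).

Uniqueness of the infinite-volume measures enters twice: it makes φ_p invariant under the
symmetries, and it provides one sequence of finite volumes and boundary conditions along which both
parameters converge. -/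

/-! ### Connections inside a set of vertices -/

/-- `x` and `y` are joined by a path of `K` all of whose vertices lie in `D`. -/
def ConnIn {V : Type*} (K : SimpleGraph V) (D : Set V) (x y : V) : Prop :=
  x ∈ D ∧ Relation.ReflTransGen (fun a b => K.Adj a b ∧ b ∈ D) x y

/-- Some vertex of `A` and some vertex of `B` are joined inside `D`. -/
def ConnSets {V : Type*} (K : SimpleGraph V) (D A B : Set V) : Prop :=
  ∃ a ∈ A, ∃ b ∈ B, ConnIn K D a b

namespace ConnIn

variable {V : Type*} {K K' : SimpleGraph V} {D D' : Set V} {x y z : V}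

theorem refl (h : x ∈ D) : ConnIn K D x x := ⟨h, .refl⟩

theorem left_mem (h : ConnIn K D x y) : x ∈ D := h.1

theorem right_mem (h : ConnIn K D x y) : y ∈ D := by
  obtain ⟨h1, h2⟩ := h
  induction h2 with
  | refl => exact h1
  | tail _ h _ => exact h.2

theorem trans (h : ConnIn K D x y) (h' : ConnIn K D y z) : ConnIn K D x z :=
  ⟨h.1, h.2.trans h'.2⟩

theorem tail (h : ConnIn K D x y) (h' : K.Adj y z) (hz : z ∈ D) : ConnIn K D x z :=
  ⟨h.1, h.2.tail ⟨h', hz⟩⟩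

theorem symm (h : ConnIn K D x y) : ConnIn K D y x := by
  obtain ⟨h1, h2⟩ := h
  induction h2 with
  | refl => exact .refl h1
  | @tail b c hb hbc ih =>
    have hb' : b ∈ D := right_mem ⟨h1, hb⟩
    exact ((refl hbc.2).tail hbc.1.symm hb').trans ih

theorem mono (h : ConnIn K D x y) (hK : ∀ u v, u ∈ D → v ∈ D → K.Adj u v → K'.Adj u v)
    (hD : D ⊆ D') : ConnIn K' D' x y := by
  obtain ⟨h1, h2⟩ := h
  induction h2 with
  | refl => exact .refl (hD h1)
  | tail hb hbc ih => exact ih.tail (hK _ _ (right_mem ⟨h1, hb⟩) hbc.2 hbc.1) (hD hbc.2)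

theorem adj (hx : x ∈ D) (hy : y ∈ D) (h : K.Adj x y) : ConnIn K D x y := (refl hx).tail h hy

theorem of_isChain {l : List V} (hc : l.IsChain K.Adj) (hD : ∀ v ∈ l, v ∈ D)
    (hx : l.head? = some x) (hy : y ∈ l) : ConnIn K D x y := by
  induction l generalizing x with
  | nil => simp at hx
  | cons a t ih =>
    obtain rfl : a = x := by simpa using hx
    rcases List.mem_cons.1 hy with rfl | hy
    · exact refl (hD _ (by simp))
    · cases t with
      | nil => simp at hy
      | cons b t =>
        rw [List.isChain_cons_cons] at hc
        refine (adj (hD _ (by simp)) (hD _ (by simp)) hc.1).trans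
          (ih hc.2 (fun v hv => hD v (by simp [hv])) (by simp) hy)

theorem exists_list (h : ConnIn K D x y) : ∃ l : List V, l.Nodup ∧ l.IsChain K.Adj ∧
    (∀ v ∈ l, v ∈ D) ∧ l.head? = some x ∧ l.getLast? = some y := by
  obtain ⟨h1, h2⟩ := h
  induction h2 using Relation.ReflTransGen.head_induction_on with
  | refl => exact ⟨[y], by simp, by simp, by simpa using h1, by simp, by simp⟩
  | @head a c hac _ ih =>
    obtain ⟨l, hn, hc, hD, hh, hl⟩ := ih hac.2
    by_cases ha : a ∈ l
    · obtain ⟨p, q, rfl⟩ := List.append_of_mem ha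
      rw [List.isChain_append] at hc
      rw [List.nodup_append] at hn
      exact ⟨a :: q, hn.2.1, hc.2.1, fun v hv => hD v (by simp [List.mem_cons.1 hv]), by simp,
        by simpa using hl⟩
    · cases l with
      | nil => simp at hh
      | cons b t =>
        obtain rfl : b = c := by simpa using hh
        refine ⟨a :: b :: t, by simp only [List.nodup_cons]; exact ⟨ha, List.nodup_cons.1 hn⟩,
          by rw [List.isChain_cons_cons]; exact ⟨hac.1, hc⟩, ?_, by simp, by simpa using hl⟩
        intro v hv
        rcases List.mem_cons.1 hv with rfl | hv
        exacts [h1, hD _ hv]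

theorem reachable_iff {hx : x ∈ D} {hy : y ∈ D} :
    (K.induce D).Reachable ⟨x, hx⟩ ⟨y, hy⟩ ↔ ConnIn K D x y := by
  constructor
  · rintro ⟨w⟩
    generalize hx' : (⟨x, hx⟩ : D) = x' at w
    generalize hy' : (⟨y, hy⟩ : D) = y' at w
    induction w generalizing x with
    | nil =>
      subst hx'
      obtain rfl : y = x := by simpa using hy'
      exact refl hx
    | @cons u v w h _ ih =>
      subst hx'
      exact (adj hx v.2 (by simpa using h)).trans (ih (hx := v.2) rfl hy')
  · rintro ⟨h1, h2⟩
    induction h2 with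
    | refl => exact .refl _
    | @tail b c hb hbc ih =>
      have hb' : b ∈ D := right_mem ⟨h1, hb⟩
      exact (ih (hy := hb')).trans
        (SimpleGraph.Adj.reachable (by simpa using hbc.1))

/-- The first vertex of a path that lies in `B`. -/
theorem exists_first {B : Set V} (h : ConnIn K D x y) (hy : y ∈ B) :
    ∃ w ∈ B, w ∈ D ∧ (w = x ∨ ∃ u, ConnIn K (D \ B) x u ∧ K.Adj u w) := by
  obtain ⟨h1, h2⟩ := h
  induction h2 using Relation.ReflTransGen.head_induction_on with
  | refl => exact ⟨y, hy, h1, .inl rfl⟩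
  | @head a c hac hcw ih =>
    by_cases ha : a ∈ B
    · exact ⟨a, ha, h1, .inl rfl⟩
    · obtain ⟨w', hw', hwD, rfl | ⟨u, hu, huw⟩⟩ := ih hac.2
      · exact ⟨w', hw', hwD, .inr ⟨a, refl ⟨h1, ha⟩, hac.1⟩⟩
      · exact ⟨w', hw', hwD, .inr ⟨u, (adj (D := D \ B) ⟨h1, ha⟩ hu.1 hac.1).trans hu, huw⟩⟩

end ConnIn

theorem ConnSets.mono {V : Type*} {K K' : SimpleGraph V} {D D' A A' B B' : Set V}
    (h : ConnSets K D A B) (hK : ∀ u v, u ∈ D → v ∈ D → K.Adj u v → K'.Adj u v) (hD : D ⊆ D')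
    (hA : A ∩ D ⊆ A') (hB : B ∩ D ⊆ B') : ConnSets K' D' A' B' := by
  obtain ⟨a, ha, b, hb, h⟩ := h
  exact ⟨a, hA ⟨ha, h.left_mem⟩, b, hB ⟨hb, h.right_mem⟩, h.mono hK hD⟩

theorem ConnSets.symm {V : Type*} {K : SimpleGraph V} {D A B : Set V}
    (h : ConnSets K D A B) : ConnSets K D B A := by
  obtain ⟨a, ha, b, hb, h⟩ := h
  exact ⟨b, hb, a, ha, h.symm⟩

theorem crossH_iff (G : PlaneGraph) {VS : Type*} (S : SimpleGraph VS) (b d : ℝ)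
    (ω : Config (G.slab S)) :
    ω ∈ crossH G S b d ↔ ConnSets (openGraph ω) {v | v.1.1 ∈ Set.Icc 0 b ×ˢ Set.Icc 0 d}
      {v | v.1.1.1 = 0} {v | v.1.1.1 = b} := by
  constructor
  · rintro ⟨x, y, hx, hy, h⟩
    exact ⟨x, hx, y, hy, ConnIn.reachable_iff.1 h⟩
  · rintro ⟨x, hx, y, hy, h⟩
    exact ⟨⟨x, h.left_mem⟩, ⟨y, h.right_mem⟩, hx, hy, ConnIn.reachable_iff.2 h⟩

/-! ### Edges of a list of vertices -/

/-- The edges between consecutive entries of a list of vertices. -/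
def listEdges {V : Type*} : List V → List (Sym2 V)
  | a :: b :: t => s(a, b) :: listEdges (b :: t)
  | _ => []

theorem mem_listEdges {V : Type*} {l : List V} {e : Sym2 V} :
    e ∈ listEdges l ↔ ∃ p q a b, l = p ++ a :: b :: q ∧ e = s(a, b) := by
  induction l with
  | nil => simp [listEdges]
  | cons a t ih =>
    cases t with
    | nil =>
      simp only [listEdges, List.not_mem_nil, false_iff]
      rintro ⟨p, q, a, b, h, -⟩
      have := congrArg List.length h
      simp at this
      omega
    | cons b t =>
      simp only [listEdges, List.mem_cons, ih]
      constructor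
      · rintro (rfl | ⟨p, q, c, d, h, rfl⟩)
        · exact ⟨[], t, a, b, rfl, rfl⟩
        · exact ⟨a :: p, q, c, d, by rw [h]; rfl, rfl⟩
      · rintro ⟨p, q, c, d, h, rfl⟩
        cases p with
        | nil =>
          simp only [List.nil_append, List.cons.injEq] at h
          obtain ⟨rfl, rfl, -⟩ := h
          exact .inl rfl
        | cons _ p =>
          simp only [List.cons_append, List.cons.injEq] at h
          exact .inr ⟨p, q, c, d, h.2, rfl⟩

theorem mem_of_mem_listEdges {V : Type*} {l : List V} {e : Sym2 V} (h : e ∈ listEdges l)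
    {x : V} (hx : x ∈ e) : x ∈ l := by
  obtain ⟨p, q, a, b, rfl, rfl⟩ := mem_listEdges.1 h
  rcases Sym2.mem_iff.1 hx with rfl | rfl <;> simp

theorem isChain_iff_listEdges {V : Type*} {K : SimpleGraph V} {l : List V} :
    l.IsChain K.Adj ↔ ∀ e ∈ listEdges l, e ∈ K.edgeSet := by
  induction l with
  | nil => simp [listEdges]
  | cons a t ih =>
    cases t with
    | nil => simp [listEdges]
    | cons b t => simp [listEdges, ih]

theorem openGraph_le {V : Type*} {H : SimpleGraph V} (ω : Config H) : openGraph ω ≤ H :=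
  fun _ _ h => h.1

theorem mem_edgeSet_openGraph {V : Type*} {H : SimpleGraph V} {ω : Config H} {e : Sym2 V} :
    e ∈ (openGraph ω).edgeSet ↔ ∃ h : e ∈ H.edgeSet, ω ⟨e, h⟩ = true := by
  induction e with | _ x y => rfl

theorem openGraph_mono {V : Type*} {H : SimpleGraph V} {ω ω' : Config H} (h : ω ≤ ω') :
    openGraph ω ≤ openGraph ω' := by
  rintro x y ⟨hxy, ho⟩
  have := h ⟨s(x, y), hxy⟩
  rw [ho] at this
  exact ⟨hxy, Bool.eq_true_of_true_le this⟩

/-! ### Minimal paths with marked vertices -/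

namespace Gluing

variable {V : Type*}

/-- `l` is a self-avoiding path of `K` in `D` from `A` to `B` that visits `A` only at its start. -/
structure IsPath (K : SimpleGraph V) (D A B : Set V) (l : List V) : Prop where
  nodup : l.Nodup
  chain : l.IsChain K.Adj
  mem : ∀ v ∈ l, v ∈ D
  head : ∃ a ∈ A, l.head? = some a
  tail : ∀ v ∈ l.tail, v ∉ A
  last : ∃ b ∈ B, l.getLast? = some b

/-- A path that returns to `A` is replaced by its part from the return on. Its length drops, so the
procedure ends with a path that meets `A` only at its start. -/
theorem exists_isPath {K : SimpleGraph V} {D A B : Set V} (h : ConnSets K D A B) :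
    ∃ l, IsPath K D A B l := by
  obtain ⟨a, ha, b, hb, h⟩ := h
  obtain ⟨l, hn, hc, hD, hh, hl⟩ := h.exists_list
  clear h
  induction hk : l.length using Nat.strong_induction_on generalizing l a with
  | _ k ih =>
    by_cases ht : ∀ v ∈ l.tail, v ∉ A
    · exact ⟨l, hn, hc, hD, ⟨a, ha, hh⟩, ht, ⟨b, hb, hl⟩⟩
    · push Not at ht
      obtain ⟨v, hv, hvA⟩ := ht
      cases l with
      | nil => simp at hv
      | cons x t =>
        obtain ⟨p, q, hpq⟩ := List.append_of_mem hv
        simp only [List.tail_cons] at hpq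
        subst hpq
        have hs : v :: q <:+ x :: (p ++ v :: q) := ⟨x :: p, by simp⟩
        refine ih (v :: q).length (by simp at hk ⊢; omega) v hvA (v :: q) (hn.sublist hs.sublist)
          (hc.suffix hs) (fun u hu => hD u (hs.subset hu)) rfl ?_ rfl
        rw [← hl, ← List.cons_append, List.getLast?_append]
        simp [List.getLast?_cons]

/-- The cost of stepping to `v` (from `u`, if there is a previous vertex `u`): the neighbour of `u`
with the marked label comes first. -/
def stepKey {L : ℕ} (nb : V → V → Fin L) (idx : V → ℕ) (M : ℕ) (m : V → Fin L) :
    Option V → V → ℕ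
  | none, v => idx v
  | some u, v => if nb u v = m u then idx v else M + idx v

/-- The costs of the successive steps of a path. -/
def pathKey {L : ℕ} (nb : V → V → Fin L) (idx : V → ℕ) (M : ℕ) (m : V → Fin L) :
    Option V → List V → List ℕ
  | _, [] => []
  | o, v :: t => stepKey nb idx M m o v :: pathKey nb idx M m (some v) t

section Key

variable {L : ℕ} {nb : V → V → Fin L} {idx : V → ℕ} {M : ℕ} {m m' : V → Fin L}

/-- All indices are below `M`, so marked steps cost less than `M` and unmarked ones at least `M`;
the two ranges cannot collide. -/
theorem stepKey_injective (hidx : Function.Injective idx) (hM : ∀ v, idx v < M) (o : Option V) :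
    Function.Injective (stepKey nb idx M m o) := by
  intro v w h
  cases o with
  | none => exact hidx h
  | some u =>
    have := hM v
    have := hM w
    simp only [stepKey] at h
    apply hidx
    split_ifs at h <;> omega

/-- Keys are compared lexicographically, and equal step costs mean equal vertices. Hence the
comparison is decided at the first vertex where the paths differ, unless the cheaper path is a
proper initial segment of the other. -/
theorem exists_of_pathKey_lt (hidx : Function.Injective idx) (hM : ∀ v, idx v < M)
    {l₁ l₂ : List V} {o : Option V} (h : pathKey nb idx M m o l₁ < pathKey nb idx M m o l₂) :
    (∃ s, l₂ = l₁ ++ s ∧ s ≠ []) ∨ ∃ p a b s₁ s₂, l₁ = p ++ a :: s₁ ∧ l₂ = p ++ b :: s₂ ∧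
      stepKey nb idx M m (p.getLast?.or o) a < stepKey nb idx M m (p.getLast?.or o) b := by
  induction l₁ generalizing l₂ o with
  | nil =>
    left
    refine ⟨l₂, rfl, ?_⟩
    rintro rfl
    simp [pathKey] at h
  | cons a t ih =>
    cases l₂ with
    | nil => simp [pathKey] at h
    | cons b t₂ =>
      rw [pathKey, pathKey, List.cons_lt_cons_iff] at h
      rcases h with h | ⟨h, h'⟩
      · exact .inr ⟨[], a, b, t, t₂, rfl, rfl, by simpa using h⟩
      · obtain rfl := stepKey_injective hidx hM _ h
        rcases ih h' with ⟨s, rfl, hs⟩ | ⟨p, c, d, s₁, s₂, rfl, rfl, hlt⟩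
        · exact .inl ⟨s, rfl, hs⟩
        · refine .inr ⟨a :: p, c, d, s₁, s₂, rfl, rfl, ?_⟩
          convert hlt using 1 <;> cases p <;> simp [List.getLast?_cons]

theorem pathKey_lt_append {l s : List V} {o : Option V} (hs : s ≠ []) :
    pathKey nb idx M m o l < pathKey nb idx M m o (l ++ s) := by
  induction l generalizing o with
  | nil =>
    cases s with
    | nil => exact absurd rfl hs
    | cons a s => simp [pathKey]
  | cons a t ih =>
    rw [List.cons_append, pathKey, pathKey, List.cons_lt_cons_iff]
    exact .inr ⟨rfl, ih⟩

theorem pathKey_lt_of_step {p s₁ s₂ : List V} {a b : V} {o : Option V}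
    (h : stepKey nb idx M m (p.getLast?.or o) a < stepKey nb idx M m (p.getLast?.or o) b) :
    pathKey nb idx M m o (p ++ a :: s₁) < pathKey nb idx M m o (p ++ b :: s₂) := by
  induction p generalizing o with
  | nil => rw [List.nil_append, List.nil_append, pathKey, pathKey, List.cons_lt_cons_iff]
           exact .inl (by simpa using h)
  | cons c p ih =>
    rw [List.cons_append, List.cons_append, pathKey, pathKey, List.cons_lt_cons_iff]
    refine .inr ⟨rfl, ih ?_⟩
    convert h using 1 <;> cases p <;> simp [List.getLast?_cons]

theorem pathKey_injective (hidx : Function.Injective idx) (hM : ∀ v, idx v < M) (o : Option V) :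
    Function.Injective (pathKey nb idx M m o) := by
  intro l₁ l₂ h
  induction l₁ generalizing l₂ o with
  | nil => cases l₂ <;> simp_all [pathKey]
  | cons a t ih =>
    cases l₂ with
    | nil => simp [pathKey] at h
    | cons b t₂ =>
      simp only [pathKey, List.cons.injEq] at h
      obtain rfl := stepKey_injective hidx hM _ h.1
      rw [ih _ h.2]

/-- Extending an initial segment that has left the minimal path `γ` to a path of `K`, along a path
of `K'` as long as it does not return to `γ`, and along `γ` afterwards. -/
theorem exists_splice {K K' : SimpleGraph V} {D A B Bad vs : Set V} {γ p s₂ : List V} {b : V}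
    (hγ : IsPath K D A B γ) (hγp : γ = p ++ b :: s₂)
    (hvs : ∀ v ∈ vs, v ∈ γ)
    (h1 : ∀ u v, u ∉ Bad → u ∉ vs → K'.Adj u v → K.Adj u v)
    (h2 : ∀ u v, u ∉ Bad → u ∉ vs → (∃ a ∈ A, ConnIn K D a u) → v ∈ D → K'.Adj u v → v ∉ γ →
      v ∉ Bad)
    (h3 : Disjoint A Bad) (s : List V) :
    ∀ r : List V, (∀ v ∈ r, v ∉ γ) → (p ++ r).IsChain K.Adj →
      (∀ v ∈ (p ++ r).getLast?, v ∉ Bad ∧ v ∉ vs) → IsPath K' D A B (p ++ r ++ s) →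
      ∃ s', IsPath K D A B (p ++ r ++ s') ∧ s'.head? = s.head? := by
  induction s with
  | nil =>
    intro r hr hc hlast hP
    exact ⟨[], ⟨hP.nodup, by simpa using hc, hP.mem, hP.head, hP.tail, hP.last⟩, rfl⟩
  | cons a s ih =>
    intro r hr hc hlast hP
    have hc' := hP.chain
    rw [List.isChain_split] at hc'
    have hca : (p ++ r ++ [a]).IsChain K.Adj := by
      rw [List.isChain_append]
      refine ⟨hc, by simp, fun x hx y hy => ?_⟩
      obtain rfl : a = y := by simpa using hy
      refine h1 x a (hlast x hx).1 (hlast x hx).2 ?_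
      rw [List.isChain_append] at hc'
      exact hc'.1.2.2 x hx a (by simp)
    -- On returning to `γ` at `a`, the path follows `γ` to its end. The return lies beyond the
    -- common part `p`, so the result is self-avoiding.
    by_cases haγ : a ∈ γ
    · have hn := hP.nodup
      rw [List.append_assoc, List.nodup_append] at hn
      have hap : a ∉ p := fun h => hn.2.2 a h a (by simp) rfl
      have hab : a ∈ b :: s₂ := by
        rw [hγp] at haγ
        exact (List.mem_append.1 haγ).resolve_left hap
      obtain ⟨g₁, g₂, hg⟩ := List.append_of_mem hab
      have hsuf : a :: g₂ <:+ γ := ⟨p ++ g₁, by rw [hγp, hg, List.append_assoc]⟩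
      refine ⟨a :: g₂, ⟨?_, ?_, ?_, ?_, ?_, ?_⟩, rfl⟩
      · have hγn := hγ.nodup
        rw [hγp, List.nodup_append] at hγn
        rw [List.nodup_append]
        have hn' := hP.nodup
        rw [List.nodup_append] at hn'
        refine ⟨hn'.1, hγ.nodup.sublist hsuf.sublist, fun x hx y hy => ?_⟩
        rcases List.mem_append.1 hx with hx | hx
        · exact hγn.2.2 x hx y (by rw [hg]; exact List.mem_append_right _ hy)
        · rintro rfl
          exact hr x hx (hsuf.subset hy)
      · rw [List.isChain_split]
        exact ⟨hca, hγ.chain.suffix hsuf⟩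
      · intro v hv
        rcases List.mem_append.1 hv with hv | hv
        · exact hP.mem v (List.mem_append_left _ hv)
        · exact hγ.mem v (hsuf.subset hv)
      · obtain ⟨x, hx, h⟩ := hP.head
        refine ⟨x, hx, ?_⟩
        rw [← h]
        cases p ++ r <;> simp
      · have htail := hP.tail
        have hγt := hγ.tail
        intro v hv
        cases hpr : p ++ r with
        | nil =>
          rw [hpr] at hv
          obtain ⟨rfl, rfl⟩ := List.append_eq_nil_iff.1 hpr
          refine hγt v ?_
          rw [hγp, List.nil_append, hg]
          cases g₁ with
          | nil => exact hv
          | cons => exact List.mem_append_right _ (List.mem_cons_of_mem _ hv)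
        | cons x t =>
          rw [hpr] at hv htail
          rcases List.mem_append.1 hv with hv | hv
          · exact htail v (List.mem_append_left _ hv)
          · rcases List.mem_cons.1 hv with rfl | hv
            · exact htail v (by simp)
            · refine hγt v ?_
              obtain ⟨g, hg'⟩ := hsuf
              rw [← hg']
              cases g with
              | nil => exact hv
              | cons => exact List.mem_append_right _ (List.mem_cons_of_mem _ hv)
      · obtain ⟨x, hx, h⟩ := hγ.last
        refine ⟨x, hx, ?_⟩
        rw [← h]
        obtain ⟨g, hg'⟩ := hsuf
        simp [← hg', List.getLast?_append, List.getLast?_cons]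
    -- Otherwise the excursion continues. The edge to `a` leaves a vertex that is neither in `Bad`
    -- nor in `vs`, so it is already an edge of `K`, and `a` is again such a vertex.
    · have hD : a ∈ D := hP.mem a (by simp)
      have hconn : ∀ u ∈ (p ++ r).getLast?, ∃ x ∈ A, ConnIn K D x u := by
        intro u hu
        obtain ⟨x, hx, h⟩ := hP.head
        refine ⟨x, hx, ConnIn.of_isChain (l := p ++ r) hc
          (fun v hv => hP.mem v (List.mem_append_left _ hv)) ?_ (List.mem_of_getLast? hu)⟩
        rw [← h]
        cases hpr : p ++ r
        · rw [hpr] at hu; simp at hu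
        · simp
      have haBad : a ∉ Bad := by
        cases hpr : p ++ r with
        | nil =>
          obtain ⟨x, hx, h⟩ := hP.head
          rw [hpr] at h
          obtain rfl : a = x := by simpa using h
          exact Set.disjoint_left.1 h3 hx
        | cons x t =>
          obtain ⟨u, hu⟩ : ∃ u, u ∈ (p ++ r).getLast? := by
            rw [hpr]; exact ⟨_, List.getLast?_eq_some_getLast (by simp)⟩
          refine h2 u a (hlast u hu).1 (hlast u hu).2 (hconn u hu) hD ?_ haγ
          rw [List.isChain_append] at hc'
          exact hc'.1.2.2 u hu a (by simp)
      obtain ⟨s', hs', -⟩ := ih (r ++ [a]) (by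
          intro v hv
          rcases List.mem_append.1 hv with hv | hv
          · exact hr v hv
          · obtain rfl : v = a := by simpa using hv
            exact haγ) (by rw [← List.append_assoc]; exact hca) (by
          intro v hv
          obtain rfl : a = v := by simpa [← List.append_assoc] using hv
          exact ⟨haBad, fun h => haγ (hvs _ h)⟩) (by simpa using hP)
      exact ⟨a :: s', by simpa using hs', rfl⟩

/-- The minimal path is not affected by opening further edges, provided that the new edges form
branches that can be entered from the minimal path only against the marks. -/
theorem isPath_min_of_surgery (hidx : Function.Injective idx) (hM : ∀ v, idx v < M)
    {H K K' : SimpleGraph V} (hK' : K' ≤ H)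
    (hnb : ∀ u v w, H.Adj u v → H.Adj u w → nb u v = nb u w → v = w)
    {D A B Bad vs : Set V} {γ : List V} (hγ : IsPath K D A B γ)
    (hmin : ∀ π, IsPath K D A B π → pathKey nb idx M m none γ ≤ pathKey nb idx M m none π)
    (hγ' : γ.IsChain K'.Adj)
    (hvs : ∀ v ∈ vs, v ∈ γ) (hBad : ∀ v ∈ Bad, v ∉ γ)
    (h1 : ∀ u v, u ∉ Bad → u ∉ vs → K'.Adj u v → K.Adj u v)
    (h2 : ∀ u v, u ∉ Bad → u ∉ vs → (∃ a ∈ A, ConnIn K D a u) → v ∈ D → K'.Adj u v → v ∉ γ →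
      v ∉ Bad)
    (h3 : Disjoint A Bad)
    (hm : ∀ v ∉ vs, m' v = m v)
    (hm' : ∀ v ∈ vs, ∀ p w q, γ = p ++ v :: w :: q → nb v w = m' v) :
    IsPath K' D A B γ ∧
      ∀ π, IsPath K' D A B π → pathKey nb idx M m' none γ ≤ pathKey nb idx M m' none π := by
  refine ⟨⟨hγ.nodup, hγ', hγ.mem, hγ.head, hγ.tail, hγ.last⟩, fun π hπ => ?_⟩
  by_contra hlt
  rw [not_le] at hlt
  -- A cheaper path `π` either is a proper initial part of `γ`, hence a path of `K` contradicting
  -- minimality, or leaves `γ` by a cheaper step after a common part `p`.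
  rcases exists_of_pathKey_lt hidx hM hlt with ⟨s, hs, hne⟩ | ⟨p, a, b, s₁, s₂, hp, hp₂, hstep⟩
  · have hch : π.IsChain K.Adj := hγ.chain.prefix ⟨s, hs.symm⟩
    refine absurd (hmin π ⟨hπ.nodup, hch, hπ.mem, hπ.head, hπ.tail, hπ.last⟩) (not_le.2 ?_)
    rw [hs]
    exact pathKey_lt_append hne
  · have hpγ : ∀ v ∈ p.getLast?, v ∈ γ := fun v hv => by
      rw [hp₂]; exact List.mem_append_left _ (List.mem_of_getLast? hv)
    -- The departure cannot take place at a vertex of `vs`: there the new mark singles out the next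
    -- vertex of `γ`, and any other neighbour costs at least `M`.
    have hlast : ∀ v ∈ p.getLast?, v ∉ vs := by
      intro v hv hvvs
      have hv' : p.getLast? = some v := hv
      obtain ⟨p', rfl⟩ := List.getLast?_eq_some_iff.1 hv'
      have hmb : nb v b = m' v := hm' v hvvs p' b s₂ (by rw [hp₂]; simp)
      rw [hv'] at hstep
      simp only [stepKey, Option.some_or, hmb, if_true] at hstep
      have hb := hM b
      by_cases hma : nb v a = m' v
      · rw [if_pos hma] at hstep
        have hva : H.Adj v a := hK' (by
          have := hπ.chain
          rw [hp, List.isChain_append] at this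
          exact this.2.2 v (by simp) a (by simp))
        have hvb : H.Adj v b := hK' (by
          have := hγ'
          rw [hp₂, List.isChain_append] at this
          exact this.2.2 v (by simp) b (by simp))
        rw [hnb v a b hva hvb (hma.trans hmb.symm)] at hstep
        exact lt_irrefl _ hstep
      · rw [if_neg hma] at hstep
        omega
    have hstep' : stepKey nb idx M m (p.getLast?.or none) a
        < stepKey nb idx M m (p.getLast?.or none) b := by
      cases hpl : p.getLast? with
      | none => simpa [hpl, stepKey] using hstep
      | some v => simpa [hpl, stepKey, hm v (hlast v hpl)] using hstep
    -- At the departure vertex the old and the new marks agree. The spliced path lies in `K` and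
    -- starts with the same cheaper step, which contradicts the minimality of `γ` in `K`.
    obtain ⟨s', hs', hh⟩ := exists_splice hγ hp₂ hvs h1 h2 h3 (a :: s₁) [] (by simp)
      (by have := hγ.chain; rw [hp₂, List.isChain_append] at this; simpa using this.1)
      (by
        intro v hv
        rw [List.append_nil] at hv
        exact ⟨fun h => hBad v h (hpγ v hv), hlast v hv⟩)
      (by simpa [← hp] using hπ)
    cases s' with
    | nil => simp at hh
    | cons c s' =>
      obtain rfl : c = a := by simpa using hh
      refine absurd (hmin _ hs') (not_le.2 ?_)
      rw [List.append_nil, hp₂]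
      exact pathKey_lt_of_step hstep'

end Key

end Gluing

/-! ### Counting by multi-valued maps -/

/-- The multi-valued map principle. Each `x` sends mass to the images `Φ x W`, with `W` ranging over
the subsets of `U x`, each image being weighted by (1/(rc))^|W|; by the binomial formula the total
is the factor on the left. An image `y` determines `W` and has at most c^|W| preimages, so it
receives at most its own weight. -/
theorem sum_mul_pow_card_le {X σ : Type*} [Fintype X] [DecidableEq X] [DecidableEq σ] (w : X → ℝ)
    (hw : ∀ x, 0 ≤ w x) (E : Finset X) (U : X → Finset σ) (Φ : X → Finset σ → X) {c r : ℝ}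
    (hc : 0 < c) (hr : 0 < r)
    (hdec : ∀ x ∈ E, ∀ x' ∈ E, ∀ W ⊆ U x, ∀ W' ⊆ U x', Φ x W = Φ x' W' → W = W')
    (hfib : ∀ y W, ((E.filter fun x => W ⊆ U x ∧ Φ x W = y).card : ℝ) ≤ c ^ W.card)
    (hrat : ∀ x ∈ E, ∀ W ⊆ U x, w x ≤ r ^ W.card * w (Φ x W)) :
    ∑ x ∈ E, w x * (1 + 1 / (r * c)) ^ (U x).card ≤ ∑ x, w x := by
  have hκ : 0 ≤ 1 / (r * c) := by positivity
  calc ∑ x ∈ E, w x * (1 + 1 / (r * c)) ^ (U x).card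
      = ∑ x ∈ E, ∑ W ∈ (U x).powerset, w x * (1 / (r * c)) ^ W.card := by
        refine Finset.sum_congr rfl fun x _ => ?_
        rw [← Finset.mul_sum, add_comm, ← Finset.sum_pow_mul_eq_add_pow]
        simp
    _ ≤ ∑ x ∈ E, ∑ W ∈ (U x).powerset, w (Φ x W) * (1 / c) ^ W.card := by
        refine Finset.sum_le_sum fun x hx => Finset.sum_le_sum fun W hW => ?_
        have h := hrat x hx W (Finset.mem_powerset.1 hW)
        calc w x * (1 / (r * c)) ^ W.card
            ≤ (r ^ W.card * w (Φ x W)) * (1 / (r * c)) ^ W.card :=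
              mul_le_mul_of_nonneg_right h (pow_nonneg hκ _)
          _ = w (Φ x W) * (1 / c) ^ W.card := by
              rw [mul_comm (r ^ _), mul_assoc, ← mul_pow]
              congr 2
              field_simp
    _ = ∑ p ∈ E.sigma fun x => (U x).powerset, w (Φ p.1 p.2) * (1 / c) ^ p.2.card := by
        rw [Finset.sum_sigma]
    _ = ∑ y, ∑ p ∈ (E.sigma fun x => (U x).powerset).filter (fun p => Φ p.1 p.2 = y),
          w (Φ p.1 p.2) * (1 / c) ^ p.2.card := (Finset.sum_fiberwise _ _ _).symm
    _ ≤ ∑ y, w y := by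
        refine Finset.sum_le_sum fun y _ => ?_
        rcases Finset.eq_empty_or_nonempty
          ((E.sigma fun x => (U x).powerset).filter (fun p => Φ p.1 p.2 = y)) with h | ⟨⟨x₀, W₀⟩, h₀⟩
        · rw [h]; simpa using hw y
        · simp only [Finset.mem_filter, Finset.mem_sigma, Finset.mem_powerset] at h₀
          have hle : ∀ p ∈ (E.sigma fun x => (U x).powerset).filter (fun p => Φ p.1 p.2 = y),
              w (Φ p.1 p.2) * (1 / c) ^ p.2.card = w y * (1 / c) ^ W₀.card := by
            rintro ⟨x, W⟩ hp
            simp only [Finset.mem_filter, Finset.mem_sigma, Finset.mem_powerset] at hp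
            obtain rfl := hdec x hp.1.1 x₀ h₀.1.1 W hp.1.2 W₀ h₀.1.2 (hp.2.trans h₀.2.symm)
            rw [hp.2]
          rw [Finset.sum_congr rfl hle, Finset.sum_const, nsmul_eq_mul]
          have hcard : (((E.sigma fun x => (U x).powerset).filter
              (fun p => Φ p.1 p.2 = y)).card : ℝ) ≤ c ^ W₀.card := by
            refine le_trans ?_ (hfib y W₀)
            exact_mod_cast Finset.card_le_card_of_injOn
              (fun p : (_ : X) × Finset σ => p.1) (by
              rintro ⟨x, W⟩ hp
              simp only [Finset.coe_filter, Finset.mem_sigma, Finset.mem_powerset,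
                Set.mem_ofPred_eq] at hp ⊢
              obtain rfl := hdec x hp.1.1 x₀ h₀.1.1 W hp.1.2 W₀ h₀.1.2 (hp.2.trans h₀.2.symm)
              exact ⟨hp.1.1, hp.1.2, hp.2⟩) (by
              rintro ⟨x, W⟩ hp ⟨x', W'⟩ hp' (rfl : x = x')
              simp only [Finset.coe_filter, Finset.mem_sigma, Finset.mem_powerset,
                Set.mem_ofPred_eq] at hp hp'
              rw [hdec x hp.1.1 x hp'.1.1 W hp.1.2 W' hp'.1.2 (hp.2.trans hp'.2.symm)])
          calc _ ≤ c ^ W₀.card * (w y * (1 / c) ^ W₀.card) :=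
                mul_le_mul_of_nonneg_right hcard (mul_nonneg (hw y) (by positivity))
            _ = w y := by
                rw [mul_left_comm, ← mul_pow, mul_one_div_cancel hc.ne', one_pow, mul_one]

/-- The single-valued counterpart: the factor `r` pays for the change of weight and `c` for the
number of preimages. -/
theorem sum_le_of_fiber_card_le {X : Type*} [DecidableEq X] (w : X → ℝ)
    (hw : ∀ x, 0 ≤ w x) (E F : Finset X) (Φ : X → X) {c r : ℝ} (hr : 0 ≤ r)
    (hΦ : ∀ x ∈ E, Φ x ∈ F) (hfib : ∀ y, ((E.filter fun x => Φ x = y).card : ℝ) ≤ c)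
    (hrat : ∀ x ∈ E, w x ≤ r * w (Φ x)) :
    ∑ x ∈ E, w x ≤ r * c * ∑ y ∈ F, w y := by
  calc ∑ x ∈ E, w x ≤ ∑ x ∈ E, r * w (Φ x) := Finset.sum_le_sum hrat
    _ = ∑ y ∈ F, ∑ x ∈ E.filter (fun x => Φ x = y), r * w (Φ x) :=
        (Finset.sum_fiberwise_of_maps_to hΦ _).symm
    _ ≤ ∑ y ∈ F, r * c * w y := by
        refine Finset.sum_le_sum fun y _ => ?_
        rw [Finset.sum_congr rfl (g := fun _ => r * w y)
          (fun x hx => by rw [(Finset.mem_filter.1 hx).2]), Finset.sum_const, nsmul_eq_mul]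
        have := mul_le_mul_of_nonneg_right (hfib y) (mul_nonneg hr (hw y))
        linarith
    _ = _ := by rw [Finset.mul_sum]

theorem card_filter_eqOn_compl_le {ι α : Type*} [Fintype ι] [DecidableEq ι] [Fintype α]
    [DecidableEq α] (s : Finset ι) (g : ι → α) :
    (Finset.univ.filter fun f : ι → α => ∀ i ∉ s, f i = g i).card ≤ Fintype.card α ^ s.card := by
  classical
  calc _ ≤ (Finset.univ : Finset (s → α)).card := by
        refine Finset.card_le_card_of_injOn (fun f i => f i) (fun _ _ => Finset.mem_coe.2
          (Finset.mem_univ _)) ?_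
        intro f hf f' hf' h
        simp only [Finset.coe_filter, Finset.mem_univ, true_and, Set.mem_ofPred_eq] at hf hf'
        funext i
        by_cases hi : i ∈ s
        · exact congrFun h ⟨i, hi⟩
        · rw [hf i hi, hf' i hi]
    _ = _ := by simp

/-! ### Gluing -/

namespace Gluing

variable {V C : Type*}

/-- The vertices that can be reached from `B` inside `D` without entering a column visited
by `γ`. -/
def freeCluster (K : SimpleGraph V) (col : V → C) (D B : Set V) (γ : List V) : Set V :=
  {v | ∃ u ∈ B, ConnIn K (D \ {x | ∃ g ∈ γ, col x = col g}) u v}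

/-- The columns where the path `γ` comes close to the cluster `Q` of `B`. -/
def contactSites (H : SimpleGraph V) (col : V → C) (D B : Set V) (γ : List V) (Q : Set V) : Set C :=
  {z | (∃ g ∈ γ, col g = z) ∧ ∃ u ∈ D, col u = z ∧ (u ∈ B ∨ ∃ y ∈ Q, H.Adj y u)}

/-- `l ++ [v]` is a branch joining the cluster `Q` of `B` to the vertex `v` of `γ` in the
column `z`. -/
structure IsBranch (H : SimpleGraph V) (col : V → C) (D B : Set V) (γ : List V) (Q : Set V)
    (z : C) (p : List V × V) : Prop where
  chain : (p.1 ++ [p.2]).IsChain H.Adj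
  mem : p.2 ∈ γ
  col_eq : col p.2 = z
  not_mem : ∀ x ∈ p.1, x ∉ γ
  memD : ∀ x ∈ p.1, x ∈ D
  col_or : ∀ x ∈ p.1, col x = z ∨ x ∈ Q
  head : ∃ h, (p.1 ++ [p.2]).head? = some h ∧ (h ∈ Q ∨ h ∈ B)
  touch : ∀ e ∈ listEdges (p.1 ++ [p.2]), ∃ x ∈ e, col x = z

theorem freeCluster_subset {K : SimpleGraph V} {col : V → C} {D B : Set V} {γ : List V} {x : V}
    (hx : x ∈ freeCluster K col D B γ) : x ∈ D ∧ ∀ g ∈ γ, col x ≠ col g := by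
  obtain ⟨u, -, h⟩ := hx
  have := h.right_mem
  exact ⟨this.1, fun g hg h => this.2 ⟨g, hg, h⟩⟩

/-- The column of a contact site is connected inside `D`. Walk in it from the contact vertex `u`
until `γ` is met for the first time; if `u` is only adjacent to the cluster `Q`, prepend its
neighbour in `Q`. -/
theorem exists_isBranch {H : SimpleGraph V} {col : V → C} {D B : Set V} {γ : List V} {Q : Set V}
    (hcol : ∀ u ∈ D, ∀ v ∈ D, col u = col v → ConnIn H {x | x ∈ D ∧ col x = col u} u v)
    (hγD : ∀ g ∈ γ, g ∈ D) (hQ : ∀ x ∈ Q, x ∈ D ∧ ∀ g ∈ γ, col x ≠ col g) {z : C}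
    (hz : z ∈ contactSites H col D B γ Q) : ∃ p, IsBranch H col D B γ Q z p := by
  obtain ⟨⟨g, hg, rfl⟩, u, huD, huz, hu⟩ := hz
  have hcg := hcol u huD g (hγD g hg) huz
  -- a list from `u` to its only vertex on `γ`, inside the column
  obtain ⟨l, v, hlc, hv, hvcol, hlγ, hlD, hhead⟩ : ∃ (l : List V) (v : V),
      (l ++ [v]).IsChain H.Adj ∧ v ∈ γ ∧ col v = col g ∧ (∀ x ∈ l, x ∉ γ) ∧
      (∀ x ∈ l, x ∈ D ∧ col x = col g) ∧ (l ++ [v]).head? = some u := by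
    obtain ⟨w, hw, hwD, rfl | ⟨y, hy, hyw⟩⟩ := hcg.exists_first (B := {x | x ∈ γ}) hg
    · exact ⟨[], w, by simp, hw, huz, by simp, by simp, by simp⟩
    · obtain ⟨l, -, hlc, hlD, hlh, hll⟩ := hy.exists_list
      refine ⟨l, w, ?_, hw, hwD.2.trans huz, fun x hx => (hlD x hx).2,
        fun x hx => ⟨(hlD x hx).1.1, (hlD x hx).1.2.trans huz⟩, ?_⟩
      · rw [List.isChain_append]
        refine ⟨hlc, by simp, fun a ha b hb => ?_⟩
        obtain rfl : y = a := by simpa [hll] using ha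
        obtain rfl : w = b := by simpa using hb
        exact hyw
      · cases l with
        | nil => simp at hlh
        | cons => simpa using hlh
  have hin : ∀ x ∈ l ++ [v], col x = col g := by
    intro x hx
    rcases List.mem_append.1 hx with hx | hx
    · exact (hlD x hx).2
    · obtain rfl : x = v := by simpa using hx
      exact hvcol
  have htouch : ∀ e ∈ listEdges (l ++ [v]), ∃ x ∈ e, col x = col g := by
    intro e he
    induction e with
    | _ a b => exact ⟨a, by simp, hin a (mem_of_mem_listEdges he (by simp))⟩
  rcases hu with hu | ⟨y, hyQ, hyu⟩
  · exact ⟨(l, v), hlc, hv, hvcol, hlγ, fun x hx => (hlD x hx).1, fun x hx => .inl (hlD x hx).2,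
      ⟨u, hhead, .inr hu⟩, htouch⟩
  · refine ⟨(y :: l, v), ?_, hv, hvcol, ?_, ?_, ?_, ⟨y, rfl, .inl hyQ⟩, ?_⟩
    · cases hl : l ++ [v] with
      | nil => simp at hl
      | cons a t =>
        rw [hl] at hhead hlc
        obtain rfl : a = u := by simpa using hhead
        rw [List.cons_append, hl, List.isChain_cons_cons]
        exact ⟨hyu, hlc⟩
    · intro x hx
      rcases List.mem_cons.1 hx with rfl | hx
      · exact fun h => (hQ _ hyQ).2 _ h rfl
      · exact hlγ x hx
    · intro x hx
      rcases List.mem_cons.1 hx with rfl | hx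
      exacts [(hQ _ hyQ).1, (hlD x hx).1]
    · intro x hx
      rcases List.mem_cons.1 hx with rfl | hx
      exacts [.inr hyQ, .inl (hlD x hx).2]
    · intro e he
      cases hl : l ++ [v] with
      | nil => simp at hl
      | cons a t =>
        rw [List.cons_append, hl, listEdges] at he
        rcases List.mem_cons.1 he with rfl | he
        · exact ⟨a, by simp, hin a (by simp [hl])⟩
        · exact htouch e (by rw [hl]; exact he)

open Classical in
/-- Resampling the edges that touch the columns in `W`: exactly the edges of `γ` and the edges of
the branches are open. -/
noncomputable def surgery {H : SimpleGraph V} (col : V → C) (γ : List V) (br : C → List V × V)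
    (W : Finset C) (ω : Config H) : Config H := fun e =>
  if ∃ x ∈ e.1, col x ∈ W then
    decide (e.1 ∈ listEdges γ ∨ ∃ z ∈ W, e.1 ∈ listEdges ((br z).1 ++ [(br z).2]))
  else ω e

open Classical in
/-- Marking the edges of `γ` that leave the end vertices of the branches. -/
noncomputable def remark {L : ℕ} (nb : V → V → Fin L) (γ : List V) (br : C → List V × V)
    (W : Finset C) (m : V → Fin L) : V → Fin L := fun v =>
  if h : (∃ z ∈ W, v = (br z).2) ∧ ∃ w p q, γ = p ++ v :: w :: q then nb v h.2.choose else m v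

/-- The cluster is explored outside the columns of `γ`. A surgery supported on such columns
therefore leaves it unchanged, so that it can be recovered from the result. -/
theorem freeCluster_congr {H : SimpleGraph V} {col : V → C} {D B : Set V} {γ : List V}
    {ω ω' : Config H} (h : ∀ e : H.edgeSet, (∀ x ∈ e.1, ∀ g ∈ γ, col x ≠ col g) → ω e = ω' e) :
    freeCluster (openGraph ω) col D B γ = freeCluster (openGraph ω') col D B γ := by
  have key : ∀ ω ω' : Config H,
      (∀ e : H.edgeSet, (∀ x ∈ e.1, ∀ g ∈ γ, col x ≠ col g) → ω e = ω' e) →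
      freeCluster (openGraph ω) col D B γ ⊆ freeCluster (openGraph ω') col D B γ := by
    rintro ω ω' h v ⟨u, hu, hc⟩
    refine ⟨u, hu, hc.mono ?_ le_rfl⟩
    rintro x y hx hy ⟨hxy, ho⟩
    refine ⟨hxy, ?_⟩
    rw [← h _ ?_]
    · exact ho
    · intro a ha g hg hag
      rcases Sym2.mem_iff.1 ha with rfl | rfl
      exacts [hx.2 ⟨g, hg, hag⟩, hy.2 ⟨g, hg, hag⟩]
  exact (key ω ω' h).antisymm (key ω' ω fun e he => (h e he).symm)

theorem surgery_le {H : SimpleGraph V} {col : V → C} {γ : List V} {br : C → List V × V}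
    {W : Finset C} {ω : Config H} (hγ : γ.IsChain (openGraph ω).Adj) {e : H.edgeSet}
    (h : surgery col γ br W ω e = true) :
    ω e = true ∨ ∃ z ∈ W, e.1 ∈ listEdges ((br z).1 ++ [(br z).2]) := by
  classical
  unfold surgery at h
  split_ifs at h with h1
  · rcases of_decide_eq_true h with h | h
    · left
      obtain ⟨h', ho⟩ := mem_edgeSet_openGraph.1 (isChain_iff_listEdges.1 hγ _ h)
      exact ho
    · exact .inr h
  · exact .inl h

theorem isChain_surgery {H : SimpleGraph V} {col : V → C} {γ : List V} {br : C → List V × V}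
    {W : Finset C} {ω : Config H} (hγ : γ.IsChain (openGraph ω).Adj) :
    γ.IsChain (openGraph (surgery col γ br W ω)).Adj := by
  classical
  rw [isChain_iff_listEdges] at hγ ⊢
  intro e he
  obtain ⟨h', ho⟩ := mem_edgeSet_openGraph.1 (hγ e he)
  refine mem_edgeSet_openGraph.2 ⟨h', ?_⟩
  unfold surgery
  split_ifs with h1
  · simp [he]
  · exact ho

/-- The surgery fits `isPath_min_of_surgery`: the forbidden vertices are the interiors of the
branches, and the remarked ones are their end vertices on `γ`. -/
theorem surgery_spec {L : ℕ} {nb : V → V → Fin L} {idx : V → ℕ} {M : ℕ} {m : V → Fin L}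
    (hidx : Function.Injective idx) (hM : ∀ v, idx v < M) {H : SimpleGraph V}
    (hnb : ∀ u v w, H.Adj u v → H.Adj u w → nb u v = nb u w → v = w)
    {col : V → C} {D A A' B : Set V} {ω : Config H} {γ : List V}
    (hγ : IsPath (openGraph ω) D A A' γ)
    (hmin : ∀ π, IsPath (openGraph ω) D A A' π →
      pathKey nb idx M m none γ ≤ pathKey nb idx M m none π)
    (hAB : ¬ ConnSets (openGraph ω) D A B) {W : Finset C} (hWA : ∀ z ∈ W, ∀ a ∈ A, col a ≠ z)
    {br : C → List V × V}
    (hbr : ∀ z ∈ W, IsBranch H col D B γ (freeCluster (openGraph ω) col D B γ) z (br z)) :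
    IsPath (openGraph (surgery col γ br W ω)) D A A' γ ∧
      ∀ π, IsPath (openGraph (surgery col γ br W ω)) D A A' π →
        pathKey nb idx M (remark nb γ br W m) none γ ≤
          pathKey nb idx M (remark nb γ br W m) none π := by
  classical
  set Q := freeCluster (openGraph ω) col D B γ with hQ
  -- The cluster `Q` is connected to `B`, so reaching it from `A` would connect `A` to `B`.
  have hQA : ∀ x ∈ Q, ∀ a ∈ A, ¬ ConnIn (openGraph ω) D a x := by
    rintro x ⟨u, hu, hc⟩ a ha hax
    exact hAB ⟨a, ha, u, hu, hax.trans (hc.mono (fun _ _ _ _ h => h) Set.sdiff_subset).symm⟩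
  have hbranch : ∀ z ∈ W, ∀ u v, s(u, v) ∈ listEdges ((br z).1 ++ [(br z).2]) →
      (∃ z ∈ W, u ∈ (br z).1) ∨ ∃ z ∈ W, u = (br z).2 := by
    intro z hz u v h
    rcases List.mem_append.1 (mem_of_mem_listEdges h (Sym2.mem_mk_left u v)) with h | h
    · exact .inl ⟨z, hz, h⟩
    · exact .inr ⟨z, hz, by simpa using h⟩
  refine isPath_min_of_surgery (K := openGraph ω) (Bad := {x | ∃ z ∈ W, x ∈ (br z).1})
    (vs := {v | ∃ z ∈ W, v = (br z).2}) hidx hM (openGraph_le _) hnb hγ hmin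
    (isChain_surgery hγ.chain) ?_ ?_ ?_ ?_ ?_ ?_ ?_
  · rintro v ⟨z, hz, rfl⟩
    exact (hbr z hz).mem
  · rintro v ⟨z, hz, hv⟩
    exact (hbr z hz).not_mem v hv
  · rintro u v huB huv ⟨h, ho⟩
    rcases surgery_le hγ.chain ho with ho | ⟨z, hz, h'⟩
    · exact ⟨h, ho⟩
    · exact ((hbranch z hz u v h').elim huB huv).elim
  · rintro u v huB huv ⟨a, ha, hau⟩ hvD ⟨h, ho⟩ hvγ ⟨z, hz, hv⟩
    -- A branch vertex in the column `z` only has open edges of `γ` and of branches after the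
    -- surgery, and neither kind starts at `u` and ends off `γ`. A branch vertex in `Q` cannot be
    -- reached from `A` by an old edge.
    rcases (hbr z hz).col_or v hv with hcol | hvQ
    · have ht : ∃ x ∈ s(u, v), col x ∈ W := ⟨v, by simp, by rw [hcol]; exact hz⟩
      have ho' := ho
      unfold surgery at ho'
      rw [if_pos ht] at ho'
      rcases of_decide_eq_true ho' with h1 | ⟨z', hz', h'⟩
      · exact hvγ (mem_of_mem_listEdges h1 (by simp))
      · exact (hbranch z' hz' u v h').elim huB huv
    · rcases surgery_le hγ.chain ho with ho | ⟨z', hz', h'⟩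
      · exact hQA v hvQ a ha (hau.tail ⟨h, ho⟩ hvD)
      · exact (hbranch z' hz' u v h').elim huB huv
  · rw [Set.disjoint_left]
    rintro a ha ⟨z, hz, haz⟩
    rcases (hbr z hz).col_or a haz with h | h
    · exact hWA z hz a ha h
    · exact hQA a h a ha (.refl ((hbr z hz).memD a haz))
  · intro v hv
    unfold remark
    rw [dif_neg (fun h => hv h.1)]
  -- Since `γ` has no repeated vertex, the successor of `v` selected by the choice in `remark` is
  -- the vertex `w`.
  · rintro v hv p w q hpq
    have h : (∃ z ∈ W, v = (br z).2) ∧ ∃ w p q, γ = p ++ v :: w :: q := ⟨hv, w, p, q, hpq⟩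
    unfold remark
    rw [dif_pos h]
    obtain ⟨p', q', hpq'⟩ := h.2.choose_spec
    have hn' := hγ.nodup
    rw [hpq', List.nodup_append] at hn'
    have := (List.append_cons_inj_of_notMem (fun h => hn'.2.2 v h v (by simp) rfl)
      (List.nodup_cons.1 hn'.2.1).1).1 (hpq'.symm.trans hpq)
    rw [(List.cons.inj this.2.2).1]

end Gluing

/-! ### Uniqueness of the minimal path and decoding of the surgery. -/

namespace Gluing

variable {V C : Type*}

/-- `γ` is the minimal path for the configuration and the marks. -/
def IsMinPath {L : ℕ} (nb : V → V → Fin L) (idx : V → ℕ) (M : ℕ) (K : SimpleGraph V)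
    (D A A' : Set V) (m : V → Fin L) (γ : List V) : Prop :=
  IsPath K D A A' γ ∧ ∀ π, IsPath K D A A' π → pathKey nb idx M m none γ ≤ pathKey nb idx M m none π

theorem IsMinPath.unique {L : ℕ} {nb : V → V → Fin L} {idx : V → ℕ} {M : ℕ}
    (hidx : Function.Injective idx) (hM : ∀ v, idx v < M) {K : SimpleGraph V} {D A A' : Set V}
    {m : V → Fin L} {γ γ' : List V} (h : IsMinPath nb idx M K D A A' m γ)
    (h' : IsMinPath nb idx M K D A A' m γ') : γ = γ' :=
  pathKey_injective hidx hM none ((h.2 _ h'.1).antisymm (h'.2 _ h.1))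

theorem exists_isMinPath [Finite V] {L : ℕ} (nb : V → V → Fin L) (idx : V → ℕ) (M : ℕ)
    {K : SimpleGraph V} {D A A' : Set V} (m : V → Fin L) (h : ConnSets K D A A') :
    ∃ γ, IsMinPath nb idx M K D A A' m γ := by
  have := Fintype.ofFinite V
  obtain ⟨γ, hγ, hmin⟩ := Set.exists_min_image {l | IsPath K D A A' l} (pathKey nb idx M m none)
    ((List.finite_length_le V (Fintype.card V)).subset fun l hl => hl.nodup.length_le_card)
    (exists_isPath h)
  exact ⟨γ, hγ, hmin⟩

theorem IsPath.mono {K K' : SimpleGraph V} {D A B : Set V} {l : List V} (h : IsPath K D A B l)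
    (hK : K ≤ K') : IsPath K' D A B l :=
  ⟨h.nodup, h.chain.imp fun _ _ h => hK h, h.mem, h.head, h.tail, h.last⟩

theorem IsPath.connSets {K : SimpleGraph V} {D A B : Set V} {l : List V} (h : IsPath K D A B l) :
    ConnSets K {x | x ∈ l} A B := by
  obtain ⟨a, ha, hh⟩ := h.head
  obtain ⟨b, hb, hl⟩ := h.last
  exact ⟨a, ha, b, hb, .of_isChain h.chain (fun _ h => h) hh (List.mem_of_getLast? hl)⟩

/-- The vertices of a branch lie in its own column or in `Q`, and `Q` avoids all columns of `γ`. So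
a surgery at other sites leaves the branch untouched, which is what makes the decoding possible. -/
theorem branch_edge_not_touch {H : SimpleGraph V} {col : V → C} {D B : Set V} {γ : List V}
    {Q : Set V} {z z' : C} {p : List V × V} (h : IsBranch H col D B γ Q z p)
    (hQ : ∀ x ∈ Q, ∀ g ∈ γ, col x ≠ col g) (hz' : ∃ g ∈ γ, col g = z') (hzz' : z ≠ z')
    {e : Sym2 V} (he : e ∈ listEdges (p.1 ++ [p.2])) : ∀ x ∈ e, col x ≠ z' := by
  intro x hx hxz
  rcases List.mem_append.1 (mem_of_mem_listEdges he hx) with hx | hx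
  · rcases h.col_or x hx with h1 | h1
    · exact hzz' (h1.symm.trans hxz)
    · obtain ⟨g, hg, rfl⟩ := hz'
      exact hQ x h1 g hg hxz
  · obtain rfl : x = p.2 := by simpa using hx
    exact hzz' (h.col_eq.symm.trans hxz)

/-- A branch that is entirely open joins the path to the cluster. -/
theorem connSets_of_branch {H : SimpleGraph V} {col : V → C} {D A A' B : Set V} {ω : Config H}
    {γ : List V} (hγ : IsPath (openGraph ω) D A A' γ) {z : C} {p : List V × V}
    (hp : IsBranch H col D B γ (freeCluster (openGraph ω) col D B γ) z p)
    (ho : ∀ e ∈ listEdges (p.1 ++ [p.2]), e ∈ (openGraph ω).edgeSet) :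
    ConnSets (openGraph ω) D A B := by
  obtain ⟨a, ha, hh⟩ := hγ.head
  have h1 : ConnIn (openGraph ω) D a p.2 := .of_isChain hγ.chain hγ.mem hh hp.mem
  obtain ⟨x, hx, hxQ⟩ := hp.head
  have h2 : ConnIn (openGraph ω) D x p.2 := by
    refine .of_isChain (isChain_iff_listEdges.2 ho) ?_ hx (by simp)
    intro v hv
    rcases List.mem_append.1 hv with hv | hv
    · exact hp.memD v hv
    · obtain rfl : v = p.2 := by simpa using hv
      exact hγ.mem _ hp.mem
  rcases hxQ with ⟨u, hu, hc⟩ | hxB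
  · exact ⟨a, ha, u, hu, h1.trans (h2.symm.trans
      (hc.mono (fun _ _ _ _ h => h) Set.sdiff_subset).symm)⟩
  · exact ⟨a, ha, x, hxB, h1.trans h2.symm⟩

theorem surgery_eq_of_not_touch {H : SimpleGraph V} {col : V → C} {γ : List V}
    {br : C → List V × V} {W : Finset C} {ω : Config H} {e : H.edgeSet}
    (h : ∀ x ∈ e.1, col x ∉ W) : surgery col γ br W ω e = ω e := by
  unfold surgery
  rw [if_neg]
  rintro ⟨x, hx, hxW⟩
  exact h x hx hxW

/-- The set of branches used in a surgery can be read off from the result. -/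
theorem surgery_decode {H : SimpleGraph V} {col : V → C} {D A A' B : Set V} {ω : Config H}
    {γ : List V} (hγ : IsPath (openGraph ω) D A A' γ) (hAB : ¬ ConnSets (openGraph ω) D A B)
    {br : C → List V × V} {U W : Finset C} (hW : W ⊆ U) (hU : ∀ z ∈ U, ∃ g ∈ γ, col g = z)
    (hbr : ∀ z ∈ U, IsBranch H col D B γ (freeCluster (openGraph ω) col D B γ) z (br z)) {z : C}
    (hz : z ∈ U) :
    z ∈ W ↔ ∀ e ∈ listEdges ((br z).1 ++ [(br z).2]),
      e ∈ (openGraph (surgery col γ br W ω)).edgeSet := by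
  classical
  constructor
  · intro hzW e he
    refine mem_edgeSet_openGraph.2 ⟨isChain_iff_listEdges.1 (hbr z hz).chain e he, ?_⟩
    obtain ⟨x, hx, hxz⟩ := (hbr z hz).touch e he
    unfold surgery
    rw [if_pos ⟨x, hx, by rw [hxz]; exact hzW⟩]
    exact decide_eq_true (.inr ⟨z, hzW, he⟩)
  · intro h
    by_contra hzW
    -- If `z` was not used, the edges of its branch have their original state. Were they all open,
    -- `A` would be connected to `B` from the start.
    refine hAB (connSets_of_branch hγ (hbr z hz) fun e he => ?_)
    obtain ⟨h1, h2⟩ := mem_edgeSet_openGraph.1 (h e he)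
    refine mem_edgeSet_openGraph.2 ⟨h1, ?_⟩
    rwa [surgery_eq_of_not_touch] at h2
    intro x hx hxW
    exact branch_edge_not_touch (hbr z hz) (fun x hx => (freeCluster_subset hx).2)
      (hU _ (hW hxW)) (fun h => hzW (by rw [h]; exact hxW)) he x hx rfl

theorem remark_eq {L : ℕ} {nb : V → V → Fin L} {γ : List V} {br : C → List V × V} {W : Finset C}
    {m : V → Fin L} {v : V} (h : ∀ z ∈ W, v ≠ (br z).2) : remark nb γ br W m v = m v := by
  unfold remark
  rw [dif_neg]
  rintro ⟨⟨z, hz, hv⟩, -⟩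
  exact h z hz hv

/-- Closing all edges that touch the contact sites, except those of `γ`, separates `B` from every
set `B'` such that all paths from `B` to `B'` cross `γ`. -/
theorem not_connSets_closing {H : SimpleGraph V} {col : V → C} {D A A' B B' : Set V}
    {ω : Config H} {γ : List V} (hγ : IsPath (openGraph ω) D A A' γ)
    (hAB : ¬ ConnSets (openGraph ω) D A B) (hBB : Disjoint B B')
    (hlink : ∀ P Q : Set V, P ⊆ D → Q ⊆ D → ConnSets H P A A' → ConnSets H Q B B' →
      ∃ x ∈ P, ∃ y ∈ Q, col x = col y) {W : Finset C}
    (hW : ∀ z ∈ contactSites H col D B γ (freeCluster (openGraph ω) col D B γ), z ∈ W) (v₀ : V) :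
    ¬ ConnSets (openGraph (surgery col γ (fun _ => ([], v₀)) W ω)) D B B' := by
  classical
  set ω' := surgery col γ (fun _ => ([], v₀)) W ω with hω'
  have hle : ∀ u v, (openGraph ω').Adj u v → (openGraph ω).Adj u v := by
    rintro u v ⟨h, ho⟩
    rcases surgery_le hγ.chain ho with h' | ⟨z, -, h'⟩
    · exact ⟨h, h'⟩
    · simp [listEdges] at h'
  have hclosed : ∀ u v, (openGraph ω').Adj u v → (col u ∈ W ∨ col v ∈ W) →
      s(u, v) ∈ listEdges γ := by
    rintro u v ⟨h, ho⟩ huv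
    rw [hω', surgery, if_pos (by rcases huv with h | h; exacts [⟨u, by simp, h⟩, ⟨v, by simp, h⟩])]
      at ho
    simpa [listEdges] using ho
  rintro ⟨b, hb, b', hb', hc⟩
  set T : Set V := {x | ∃ g ∈ γ, col x = col g} with hT
  have hbγ : b ∉ γ := by
    intro h
    obtain ⟨a, ha, hh⟩ := hγ.head
    exact hAB ⟨a, ha, b, hb, .of_isChain hγ.chain hγ.mem hh h⟩
  -- A path from `b` to `b'` may start in a column of `γ`, enter such a column later, or avoid them
  -- all. In the first two cases it uses an edge touching a contact site, which must belong to `γ`,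
  -- although an end point of this edge is off `γ`. The last case is excluded by `hlink`.
  by_cases hbT : b ∈ T
  · have hbW : col b ∈ W := by
      obtain ⟨g, hg, hbg⟩ := hbT
      exact hW _ ⟨⟨g, hg, hbg.symm⟩, b, hc.left_mem, rfl, .inl hb⟩
    rcases hc.2.cases_head with h | ⟨c, hbc, -⟩
    · exact Set.disjoint_left.1 hBB hb (h ▸ hb')
    · exact hbγ (mem_of_mem_listEdges (hclosed b c hbc.1 (.inl hbW)) (by simp))
  · by_cases hcross : ∃ y ∈ T, ConnIn (openGraph ω') D b y
    · obtain ⟨y, hyT, hy⟩ := hcross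
      obtain ⟨w, hwT, hwD, rfl | ⟨u, hu, huw⟩⟩ := hy.exists_first hyT
      · exact hbT hwT
      · have huQ : u ∈ freeCluster (openGraph ω) col D B γ :=
          ⟨b, hb, hu.mono (fun _ _ _ _ h => hle _ _ h) le_rfl⟩
        obtain ⟨g, hg, hwg⟩ := id hwT
        have hwW : col w ∈ W :=
          hW _ ⟨⟨g, hg, hwg.symm⟩, w, hwD, rfl, .inr ⟨u, huQ, openGraph_le _ huw⟩⟩
        have := hclosed u w huw (.inr hwW)
        exact (freeCluster_subset huQ).2 u (mem_of_mem_listEdges this (by simp)) rfl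
    · push Not at hcross
      obtain ⟨l, -, hlc, hlD, hlh, hll⟩ := hc.exists_list
      obtain ⟨x, hx, y, hy, hxy⟩ := hlink {x | x ∈ γ} {x | x ∈ l} hγ.mem hlD
        (by
          obtain ⟨a, ha, c, hc, h⟩ := hγ.connSets
          exact ⟨a, ha, c, hc, h.mono (fun _ _ _ _ h => openGraph_le _ h) le_rfl⟩)
        ⟨b, hb, b', hb', .of_isChain (hlc.imp fun _ _ h => openGraph_le _ h) (fun _ h => h) hlh
          (List.mem_of_getLast? hll)⟩
      exact hcross y ⟨x, hx, hxy.symm⟩ (.of_isChain hlc hlD hlh hy)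

end Gluing

/-! ### The counting argument for few and for many contact sites. -/

namespace Gluing

variable {V C : Type*}

theorem card_biUnion_filter_le {ι : Type*} [Fintype ι] [DecidableEq ι] (N : C → Set ι) {d : ℕ}
    (hd : ∀ z, (N z).ncard ≤ d) (W : Finset C) :
    {i | ∃ z ∈ W, i ∈ N z}.ncard ≤ d * W.card := by
  classical
  have : {i | ∃ z ∈ W, i ∈ N z} = ⋃ z ∈ W, N z := by ext; simp
  rw [this]
  induction W using Finset.induction_on with
  | empty => simp
  | insert a s ha ih =>
    rw [Finset.set_biUnion_insert, Finset.card_insert_of_notMem ha, mul_add, mul_one, add_comm]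
    exact (Set.ncard_union_le _ _).trans (add_le_add (hd a) (ih (by ext; simp)))

set_option maxHeartbeats 1000000 in
/-- Gluing of paths in a finite graph, for weights with the finite-energy property: if all paths
from `A` to `A'` and from `B` to `B'` come close to each other, then it is unlikely that `A` is
connected to `A'`, but not to `B`, unless it is likely that `B` is not connected to `B'`. -/
theorem sum_indicator_le [Fintype V] {H : SimpleGraph V} [Fintype (Config H)]
    (w : Config H → ℝ) (hw : ∀ ω, 0 ≤ w ω) {R : ℝ} (hR : 1 ≤ R)
    (hratio : ∀ ω ω', w ω ≤ R ^ {e | ω e ≠ ω' e}.ncard * w ω') (col : V → C) {d L : ℕ} (hL : 1 ≤ L)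
    (hd : ∀ z, {e : H.edgeSet | ∃ x ∈ e.1, col x = z}.ncard ≤ d)
    (hd' : ∀ z, {v | col v = z}.ncard ≤ d) (hdeg : ∀ u, {v | H.Adj u v}.ncard ≤ L)
    {D A A' B B' : Set V}
    (hcol : ∀ u ∈ D, ∀ v ∈ D, col u = col v → ConnIn H {x | x ∈ D ∧ col x = col u} u v)
    (hA : ∀ a ∈ A, ∀ v ∈ D, col v = col a → v ∈ A) (hBB : Disjoint B B')
    (hlink : ∀ P Q : Set V, P ⊆ D → Q ⊆ D → ConnSets H P A A' → ConnSets H Q B B' →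
      ∃ x ∈ P, ∃ y ∈ Q, col x = col y) (s : ℕ) :
    ∑ ω, Set.indicator {ω | ConnSets (openGraph ω) D A A' ∧ ¬ ConnSets (openGraph ω) D A B} w ω ≤
      ((2 * R) ^ d) ^ s * ∑ ω, Set.indicator {ω | ¬ ConnSets (openGraph ω) D B B'} w ω +
        (1 + 1 / (2 * L * R) ^ d)⁻¹ ^ s * ∑ ω, w ω := by
  classical
  have hR0 : 0 < R := by linarith
  set E₀ : Set (Config H) :=
    {ω | ConnSets (openGraph ω) D A A' ∧ ¬ ConnSets (openGraph ω) D A B} with hE₀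
  have hκ0 : (0 : ℝ) ≤ 1 / (2 * L * R) ^ d := by positivity
  rcases isEmpty_or_nonempty V with hV | ⟨⟨v₀⟩⟩
  · have : ∀ ω, Set.indicator E₀ w ω = 0 := by
      intro ω
      rw [Set.indicator_of_notMem]
      rintro ⟨⟨a, -⟩, -⟩
      exact hV.elim a
    simp only [this, Finset.sum_const_zero]
    refine add_nonneg (mul_nonneg (by positivity) (Finset.sum_nonneg fun ω _ =>
      Set.indicator_nonneg (fun _ _ => hw _) _)) (mul_nonneg (by positivity)
      (Finset.sum_nonneg fun ω _ => hw ω))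
  -- labels and indices
  obtain ⟨nb, hnb⟩ : ∃ nb : V → V → Fin L,
      ∀ u v w, H.Adj u v → H.Adj u w → nb u v = nb u w → v = w := by
    have : ∀ u, ∃ f : V → Fin L, ∀ v w, H.Adj u v → H.Adj u w → f v = f w → v = w := by
      intro u
      have hfin : {v | H.Adj u v}.Finite := Set.toFinite _
      have hc : Fintype.card {v | H.Adj u v} ≤ Fintype.card (Fin L) := by
        rw [Fintype.card_fin, ← Nat.card_eq_fintype_card]
        exact hdeg u
      obtain ⟨g⟩ := Function.Embedding.nonempty_of_card_le hc
      refine ⟨fun v => if h : H.Adj u v then g ⟨v, h⟩ else ⟨0, hL⟩, fun v w hv hw h => ?_⟩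
      simp only [hv, hw, dif_pos] at h
      simpa using g.injective h
    choose nb hnb using this
    exact ⟨nb, hnb⟩
  set idx : V → ℕ := fun v => (Fintype.equivFin V v : ℕ) with hidx'
  have hidx : Function.Injective idx := Fin.val_injective.comp (Fintype.equivFin V).injective
  have hM : ∀ v, idx v < Fintype.card V := fun v => (Fintype.equivFin V v).2
  set M := Fintype.card V
  -- minimal paths, contact sites and branches
  obtain ⟨gam, hgam⟩ : ∃ gam : Config H × (V → Fin L) → List V, ∀ x, x.1 ∈ E₀ →
      IsMinPath nb idx M (openGraph x.1) D A A' x.2 (gam x) := by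
    have : ∀ x : Config H × (V → Fin L), ∃ γ, x.1 ∈ E₀ →
        IsMinPath nb idx M (openGraph x.1) D A A' x.2 γ := by
      intro x
      by_cases hx : x.1 ∈ E₀
      · obtain ⟨γ, hγ⟩ := exists_isMinPath nb idx M x.2 hx.1
        exact ⟨γ, fun _ => hγ⟩
      · exact ⟨[], fun h => absurd h hx⟩
    choose gam hgam using this
    exact ⟨gam, hgam⟩
  obtain ⟨br, hbr⟩ : ∃ br : List V → Set V → C → List V × V, ∀ γ Q z, (∃ p,
      IsBranch H col D B γ Q z p) → IsBranch H col D B γ Q z (br γ Q z) := by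
    refine ⟨fun γ Q z => if h : ∃ p, IsBranch H col D B γ Q z p then h.choose else ([], v₀),
      fun γ Q z h => ?_⟩
    simp only [dif_pos h]
    exact h.choose_spec
  have hfin : ∀ γ Q, (contactSites H col D B γ Q).Finite := fun γ Q =>
    (Set.finite_range col).subset (by rintro z ⟨⟨g, -, rfl⟩, -⟩; exact ⟨g, rfl⟩)
  set Qf : Config H → List V → Set V := fun ω γ => freeCluster (openGraph ω) col D B γ with hQf
  set U₁ : Config H × (V → Fin L) → Finset C := fun x => (hfin (gam x) (Qf x.1 (gam x))).toFinset
    with hU₁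
  set U : Config H × (V → Fin L) → Finset C := fun x => (U₁ x).filter fun z => ∀ a ∈ A, col a ≠ z
    with hU
  have hU₁γ : ∀ x, ∀ z ∈ U₁ x, ∃ g ∈ gam x, col g = z := by
    intro x z hz
    exact ((Set.Finite.mem_toFinset _).1 hz).1
  have hUbr : ∀ x, x.1 ∈ E₀ → ∀ z ∈ U x, IsBranch H col D B (gam x) (Qf x.1 (gam x)) z
      (br (gam x) (Qf x.1 (gam x)) z) := by
    intro x hx z hz
    refine hbr _ _ _ (exists_isBranch hcol (hgam x hx).1.mem (fun y hy => freeCluster_subset hy) ?_)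
    exact (Set.Finite.mem_toFinset _).1 (Finset.mem_filter.1 hz).1
  -- At most one contact site meets `A`. Within `D` the set `A` is a union of columns, so `γ` visits
  -- such a site at a vertex of `A`, which can only be its starting point.
  have hUcard : ∀ x, x.1 ∈ E₀ → (U₁ x).card ≤ (U x).card + 1 := by
    intro x hx
    obtain ⟨a, ha, hh⟩ := (hgam x hx).1.head
    have hsub : U₁ x ⊆ insert (col a) (U x) := by
      intro z hz
      rw [Finset.mem_insert]
      by_cases hzA : ∀ a ∈ A, col a ≠ z
      · exact .inr (Finset.mem_filter.2 ⟨hz, hzA⟩)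
      · left
        push Not at hzA
        obtain ⟨a', ha', rfl⟩ := hzA
        obtain ⟨g, hg, hgz⟩ := hU₁γ x _ hz
        have hgA : g ∈ A := hA a' ha' g ((hgam x hx).1.mem g hg) hgz
        have htail := (hgam x hx).1.tail
        rw [← hgz]
        cases hl : gam x with
        | nil => rw [hl] at hh; simp at hh
        | cons y t =>
          rw [hl] at hg hh htail
          obtain rfl : y = a := by simpa using hh
          rcases List.mem_cons.1 hg with rfl | hg
          · rfl
          · exact absurd hgA (htail g hg)
    exact (Finset.card_le_card hsub).trans (Finset.card_insert_le _ _)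
  -- the two maps
  set Φ : Config H × (V → Fin L) → Finset C → Config H × (V → Fin L) := fun x W =>
    (surgery col (gam x) (br (gam x) (Qf x.1 (gam x))) W x.1,
      remark nb (gam x) (br (gam x) (Qf x.1 (gam x))) W x.2) with hΦ
  set Ψ : Config H × (V → Fin L) → Config H × (V → Fin L) := fun x =>
    (surgery col (gam x) (fun _ => ([], v₀)) (U₁ x) x.1, x.2) with hΨ
  have hQinv : ∀ x, ∀ br' W, (∀ z ∈ W, ∃ g ∈ gam x, col g = z) →
      Qf (surgery col (gam x) br' W x.1) (gam x) = Qf x.1 (gam x) := by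
    intro x br' W hW
    refine (freeCluster_congr fun e he => ?_)
    refine surgery_eq_of_not_touch fun y hy hyW => ?_
    obtain ⟨g, hg, hgz⟩ := hW _ hyW
    exact he y hy g hg hgz.symm
  have hΦmin : ∀ x, x.1 ∈ E₀ → ∀ W ⊆ U x,
      IsMinPath nb idx M (openGraph (Φ x W).1) D A A' (Φ x W).2 (gam x) := by
    intro x hx W hW
    exact surgery_spec hidx hM hnb (hgam x hx).1 (hgam x hx).2 hx.2
      (fun z hz => (Finset.mem_filter.1 (hW hz)).2) (fun z hz => hUbr x hx z (hW hz))
  have hΨle : ∀ x, x.1 ∈ E₀ → openGraph (Ψ x).1 ≤ openGraph x.1 := by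
    rintro x hx u v ⟨h, ho⟩
    rcases surgery_le (hgam x hx).1.chain ho with h' | ⟨z, -, h'⟩
    · exact ⟨h, h'⟩
    · simp [listEdges] at h'
  -- `Ψ` opens no edge and keeps `γ` open, so it only removes competitors.
  have hΨmin : ∀ x, x.1 ∈ E₀ →
      IsMinPath nb idx M (openGraph (Ψ x).1) D A A' (Ψ x).2 (gam x) := by
    intro x hx
    have h := (hgam x hx).1
    exact ⟨⟨h.nodup, isChain_surgery h.chain, h.mem, h.head, h.tail, h.last⟩,
      fun π hπ => (hgam x hx).2 π (hπ.mono (hΨle x hx))⟩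
  -- the size of the modifications
  have hcardE : ∀ W : Finset C, {e : H.edgeSet | ∃ x ∈ e.1, col x ∈ W}.ncard ≤ d * W.card := by
    intro W
    refine le_trans (le_of_eq ?_)
      (card_biUnion_filter_le (fun z => {e : H.edgeSet | ∃ x ∈ e.1, col x = z}) hd W)
    congr 1
    ext e
    constructor
    · rintro ⟨x, hx, hxW⟩; exact ⟨_, hxW, x, hx, rfl⟩
    · rintro ⟨z, hz, x, hx, rfl⟩; exact ⟨x, hx, hz⟩
  have hcardV : ∀ W : Finset C, {v : V | col v ∈ W}.ncard ≤ d * W.card := by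
    intro W
    refine le_trans (le_of_eq ?_) (card_biUnion_filter_le (fun z => {v : V | col v = z}) hd' W)
    congr 1
    ext e
    simp
  have hrat : ∀ (x : Config H × (V → Fin L)) γ br' (W : Finset C),
      w x.1 ≤ (R ^ d) ^ W.card * w (surgery col γ br' W x.1) := by
    intro x γ br' W
    refine (hratio x.1 (surgery col γ br' W x.1)).trans ?_
    refine mul_le_mul_of_nonneg_right ?_ (hw _)
    rw [← pow_mul]
    refine pow_le_pow_right₀ hR (le_trans (Set.ncard_le_ncard ?_ (Set.toFinite _)) (hcardE W))
    intro e he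
    by_contra hcon
    refine he (surgery_eq_of_not_touch fun x hx hxW => hcon ⟨x, hx, hxW⟩).symm
  -- At most `d` edges touch a column, so each column in `W` allows at most 2^d local
  -- configurations.
  have hagreeE : ∀ (W : Finset C) (g : Config H), ((Finset.univ.filter fun ω : Config H =>
      ∀ e : H.edgeSet, (∀ x ∈ e.1, col x ∉ W) → ω e = g e).card : ℝ) ≤ (2 ^ d) ^ W.card := by
    intro W g
    have h1 := card_filter_eqOn_compl_le
      (Finset.univ.filter fun e : H.edgeSet => ∃ x ∈ e.1, col x ∈ W) g
    have h2 := hcardE W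
    rw [Set.ncard_eq_toFinset_card'] at h2
    simp only [Set.toFinset_ofPred] at h2
    have h3 : (Finset.univ.filter fun ω : Config H =>
      ∀ e : H.edgeSet, (∀ x ∈ e.1, col x ∉ W) → ω e = g e).card ≤ (2 ^ d) ^ W.card := by
      calc _ ≤ 2 ^ (Finset.univ.filter fun e : H.edgeSet => ∃ x ∈ e.1, col x ∈ W).card := by
            convert h1 using 3
            · ext ω; simp
            · ext ω; simp
            · simp
        _ ≤ _ := by
          rw [← pow_mul]
          exact Nat.pow_le_pow_right (by norm_num) h2
    exact_mod_cast h3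
  have hagreeV : ∀ (W : Finset C) (g : V → Fin L), ((Finset.univ.filter fun m : V → Fin L =>
      ∀ v, col v ∉ W → m v = g v).card : ℝ) ≤ ((L : ℝ) ^ d) ^ W.card := by
    intro W g
    have h1 := card_filter_eqOn_compl_le (Finset.univ.filter fun v => col v ∈ W) g
    have h2 := hcardV W
    rw [Set.ncard_eq_toFinset_card'] at h2
    simp only [Set.toFinset_ofPred] at h2
    have h3 : (Finset.univ.filter fun m : V → Fin L =>
      ∀ v, col v ∉ W → m v = g v).card ≤ (L ^ d) ^ W.card := by
      calc _ ≤ L ^ (Finset.univ.filter fun v => col v ∈ W).card := by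
            convert h1 using 3
            · simp
            · simp
        _ ≤ _ := by
          rw [← pow_mul]
          exact Nat.pow_le_pow_right hL h2
    exact_mod_cast h3
  set EX : Finset (Config H × (V → Fin L)) := Finset.univ.filter fun x => x.1 ∈ E₀ with hEX
  -- many contact sites
  have hmany := sum_mul_pow_card_le (fun x : Config H × (V → Fin L) => w x.1) (fun x => hw x.1)
    EX U Φ (c := ((2 : ℝ) * L) ^ d) (r := R ^ d) (by positivity) (by positivity)
    (by
      -- The image determines `W`: `γ` is its minimal path, the free cluster is unchanged, hence the
      -- contact sites and the branches are known, and `W` consists of the sites whose branch is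
      -- fully open.
      intro x hx x' hx' W hW W' hW' h
      have hxE := (Finset.mem_filter.1 hx).2
      have hxE' := (Finset.mem_filter.1 hx').2
      have hm := hΦmin x hxE W hW
      have hm' := hΦmin x' hxE' W' hW'
      rw [h] at hm
      have hγ := hm.unique hidx hM hm'
      have hq := hQinv x (br (gam x) (Qf x.1 (gam x))) W
        (fun z hz => hU₁γ x z (Finset.mem_filter.1 (hW hz)).1)
      have hq' := hQinv x' (br (gam x') (Qf x'.1 (gam x'))) W'
        (fun z hz => hU₁γ x' z (Finset.mem_filter.1 (hW' hz)).1)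
      have h1 := congrArg Prod.fst h
      simp only [hΦ] at h1
      have hQ : Qf x.1 (gam x) = Qf x'.1 (gam x') := by
        rw [← hq, ← hq', h1, hγ]
      have hUU : U x = U x' := by
        have : U₁ x = U₁ x' := by
          ext z
          simp only [hU₁, Set.Finite.mem_toFinset]
          rw [hQ, hγ]
        simp only [hU, this]
      ext z
      by_cases hz : z ∈ U x
      · have hz' : z ∈ U x' := hUU ▸ hz
        rw [surgery_decode (hgam x hxE).1 hxE.2 hW
            (fun z hz => hU₁γ x z (Finset.mem_filter.1 hz).1) (hUbr x hxE) hz,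
          surgery_decode (hgam x' hxE').1 hxE'.2 hW'
            (fun z hz => hU₁γ x' z (Finset.mem_filter.1 hz).1) (hUbr x' hxE') hz', h1]
        rw [hγ] at hQ
        rw [hγ, hQ]
      · exact ⟨fun h => absurd (hW h) hz, fun h => absurd (hUU ▸ hW' h) hz⟩)
    (by
      -- A preimage agrees with `y` off the columns of `W`, both in its edges and in its marks.
      intro y W
      calc _ ≤ (((Finset.univ.filter fun ω : Config H =>
              ∀ e : H.edgeSet, (∀ x ∈ e.1, col x ∉ W) → ω e = y.1 e) ×ˢ
              (Finset.univ.filter fun m : V → Fin L => ∀ v, col v ∉ W → m v = y.2 v)).card : ℝ) := by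
            refine Nat.cast_le.2 (Finset.card_le_card ?_)
            intro x hx
            simp only [hEX, Finset.mem_filter, Finset.mem_univ, true_and] at hx
            obtain ⟨hxE, hW, rfl⟩ := hx
            simp only [Finset.mem_product, Finset.mem_filter, Finset.mem_univ, true_and]
            refine ⟨fun e he => (surgery_eq_of_not_touch he).symm, fun v hv => ?_⟩
            refine (remark_eq ?_).symm
            rintro z hz rfl
            exact hv (by rw [(hUbr x hxE z (hW hz)).col_eq]; exact hz)
        _ ≤ (2 ^ d) ^ W.card * ((L : ℝ) ^ d) ^ W.card := by
            rw [Finset.card_product, Nat.cast_mul]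
            exact mul_le_mul (hagreeE W y.1) (hagreeV W y.2) (by positivity) (by positivity)
        _ = _ := by rw [← mul_pow, ← mul_pow])
    (fun x hx W hW => hrat x (gam x) _ W)
  -- few contact sites
  have hfew := sum_le_of_fiber_card_le (fun x : Config H × (V → Fin L) => w x.1) (fun x => hw x.1)
    (EX.filter fun x => (U₁ x).card ≤ s)
    (Finset.univ.filter fun x => ¬ ConnSets (openGraph x.1) D B B') Ψ (c := (2 ^ d) ^ s)
    (r := (R ^ d) ^ s) (by positivity)
    (by
      intro x hx
      have hxE := (Finset.mem_filter.1 (Finset.mem_filter.1 hx).1).2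
      refine Finset.mem_filter.2 ⟨Finset.mem_univ _, ?_⟩
      exact not_connSets_closing (hgam x hxE).1 hxE.2 hBB hlink
        (fun z hz => (Set.Finite.mem_toFinset _).2 hz) v₀)
    (by
      -- The image determines `γ`, the free cluster and the contact sites, while the marks are
      -- unchanged. So the preimages differ only at the edges touching at most `s` known columns.
      intro y
      rcases Finset.eq_empty_or_nonempty
        ((EX.filter fun x => (U₁ x).card ≤ s).filter fun x => Ψ x = y) with h | ⟨x₀, hx₀⟩
      · rw [h]; simp
      have hsub : ((EX.filter fun x => (U₁ x).card ≤ s).filter fun x => Ψ x = y) ⊆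
          (Finset.univ.filter fun ω : Config H =>
              ∀ e : H.edgeSet, (∀ x ∈ e.1, col x ∉ U₁ x₀) → ω e = y.1 e) ×ˢ {y.2} := by
        intro x hx
        simp only [hEX, Finset.mem_filter, Finset.mem_univ, true_and] at hx hx₀
        obtain ⟨⟨hxE, -⟩, hxy⟩ := hx
        obtain ⟨⟨hxE₀, -⟩, hxy₀⟩ := hx₀
        have hγ : gam x = gam x₀ := by
          have h1 := hΨmin x hxE
          have h2 := hΨmin x₀ hxE₀
          rw [hxy] at h1
          rw [hxy₀] at h2
          exact h1.unique hidx hM h2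
        have hQ : Qf x.1 (gam x) = Qf x₀.1 (gam x₀) := by
          rw [← hQinv x (fun _ => ([], v₀)) (U₁ x) (hU₁γ x),
            ← hQinv x₀ (fun _ => ([], v₀)) (U₁ x₀) (hU₁γ x₀)]
          have h1 := congrArg Prod.fst (hxy.trans hxy₀.symm)
          simp only [hΨ] at h1
          rw [h1, hγ]
        have hUU : U₁ x = U₁ x₀ := by
          ext z
          simp only [hU₁, Set.Finite.mem_toFinset]
          rw [hQ, hγ]
        subst hxy
        simp only [Finset.mem_product, Finset.mem_filter, Finset.mem_univ, true_and,
          Finset.mem_singleton]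
        refine ⟨fun e he => (surgery_eq_of_not_touch ?_).symm, rfl⟩
        rw [hUU]
        exact he
      have hs : (U₁ x₀).card ≤ s := (Finset.mem_filter.1 (Finset.mem_filter.1 hx₀).1).2
      calc _ ≤ _ := Nat.cast_le.2 (Finset.card_le_card hsub)
        _ ≤ ((2 : ℝ) ^ d) ^ (U₁ x₀).card := by
          rw [Finset.card_product, Finset.card_singleton, mul_one]
          exact hagreeE _ _
        _ ≤ _ := pow_le_pow_right₀ (one_le_pow₀ (by norm_num)) hs)
    (by
      intro x hx
      refine (hrat x (gam x) (fun _ => ([], v₀)) (U₁ x)).trans ?_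
      exact mul_le_mul_of_nonneg_right (pow_le_pow_right₀ (one_le_pow₀ hR)
        (Finset.mem_filter.1 hx).2) (hw _))
  -- conclusion
  have hmarks : ∀ (A : Set (Config H)), ∑ x ∈ Finset.univ.filter
      (fun x : Config H × (V → Fin L) => x.1 ∈ A), w x.1 =
      Fintype.card (V → Fin L) * ∑ ω, A.indicator w ω := by
    intro A
    rw [Finset.sum_filter, Fintype.sum_prod_type, Finset.mul_sum]
    refine Finset.sum_congr rfl fun ω _ => ?_
    simp [Set.indicator_apply]
  have hpos : (0 : ℝ) < Fintype.card (V → Fin L) := by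
    have : Nonempty (V → Fin L) := ⟨fun _ => ⟨0, hL⟩⟩
    exact_mod_cast Fintype.card_pos
  set κ : ℝ := 1 / (2 * L * R) ^ d with hκ
  have hκ' : 1 / (R ^ d * (2 * (L : ℝ)) ^ d) = κ := by rw [hκ, ← mul_pow, mul_comm R]
  rw [hκ'] at hmany
  have h1κ : 1 ≤ 1 + κ := by linarith
  have hbig : ∑ x ∈ EX.filter (fun x => ¬ (U₁ x).card ≤ s), w x.1 ≤
      (1 + κ)⁻¹ ^ s * (Fintype.card (V → Fin L) * ∑ ω, w ω) := by
    have htot : ∑ x : Config H × (V → Fin L), w x.1 = Fintype.card (V → Fin L) * ∑ ω, w ω := by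
      simpa using hmarks Set.univ
    rw [inv_pow, inv_mul_eq_div, le_div_iff₀ (by positivity), ← htot, Finset.sum_mul]
    refine le_trans ?_ hmany
    calc _ ≤ ∑ x ∈ EX.filter (fun x => ¬ (U₁ x).card ≤ s), w x.1 * (1 + κ) ^ (U x).card := by
          refine Finset.sum_le_sum fun x hx => mul_le_mul_of_nonneg_left ?_ (hw _)
          -- More than `s` contact sites leave at least `s` sites away from `A`, so the exponential
          -- gain is at least (1 + κ)^s.
          refine pow_le_pow_right₀ h1κ ?_
          have h2 := hUcard x (Finset.mem_filter.1 (Finset.mem_filter.1 hx).1).2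
          have h3 := (Finset.mem_filter.1 hx).2
          omega
      _ ≤ _ := Finset.sum_le_sum_of_subset_of_nonneg (Finset.filter_subset _ _)
          fun x _ _ => mul_nonneg (hw _) (by positivity)
  have hsplit := Finset.sum_filter_add_sum_filter_not EX (fun x => (U₁ x).card ≤ s)
    (fun x => w x.1)
  have hE : ∑ x ∈ EX, w x.1 = Fintype.card (V → Fin L) * ∑ ω, E₀.indicator w ω := by
    rw [← hmarks E₀, hEX]
    congr!
  have hF := hmarks {ω | ¬ ConnSets (openGraph ω) D B B'}
  simp only [Set.mem_ofPred_eq] at hF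
  rw [hF] at hfew
  refine le_of_mul_le_mul_left ?_ hpos
  rw [← hE, ← hsplit]
  refine (add_le_add hfew hbig).trans (le_of_eq ?_)
  rw [mul_pow 2 R d, mul_pow (2 ^ d)]
  ring

end Gluing

/-! ### Crossing curves in a rectangle -/

/-- The sine is negative on (−π, 0) and on (π, 2π). By the intermediate value theorem a continuous
angle with nonnegative sine cannot leave [0, π]. -/
theorem mem_Icc_of_sin_nonneg {f : ℝ → ℝ} (hf : Continuous f) {a b : ℝ} (hab : a ≤ b)
    (hs : ∀ t ∈ Set.Icc a b, 0 ≤ Real.sin (f t)) (h : f a ∈ Set.Icc 0 Real.pi) :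
    f b ∈ Set.Icc 0 Real.pi := by
  have hpi := Real.pi_pos
  have hivt := intermediate_value_uIcc (a := a) (b := b) hf.continuousOn
  rw [Set.uIcc_of_le hab] at hivt
  constructor
  · by_contra hlt
    push Not at hlt
    obtain ⟨t, ht, htv⟩ := hivt (show max (f b) (-(Real.pi / 2)) ∈ Set.uIcc (f a) (f b) by
      rw [Set.uIcc_of_ge (hlt.le.trans h.1)]
      exact ⟨le_max_left _ _, max_le (hlt.le.trans h.1) (by linarith [h.1])⟩)
    have := hs t ht
    rw [htv] at this
    have h1 : max (f b) (-(Real.pi / 2)) < 0 := max_lt hlt (by linarith)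
    have h2 : -Real.pi < max (f b) (-(Real.pi / 2)) := lt_max_of_lt_right (by linarith)
    exact absurd (Real.sin_neg_of_neg_of_neg_pi_lt h1 h2) (not_lt.2 this)
  · by_contra hlt
    push Not at hlt
    obtain ⟨t, ht, htv⟩ := hivt (show min (f b) (3 * Real.pi / 2) ∈ Set.uIcc (f a) (f b) by
      rw [Set.uIcc_of_le (h.2.trans hlt.le)]
      exact ⟨le_min (h.2.trans hlt.le) (by linarith [h.2]), min_le_left _ _⟩)
    have h0 := hs t ht
    rw [htv] at h0
    have h1 : Real.pi < min (f b) (3 * Real.pi / 2) := lt_min hlt (by linarith)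
    have h2 : min (f b) (3 * Real.pi / 2) < 2 * Real.pi := min_lt_of_right_lt (by linarith)
    have h3 := Real.sin_pos_of_pos_of_lt_pi (x := min (f b) (3 * Real.pi / 2) - Real.pi)
      (by linarith) (by linarith)
    rw [Real.sin_sub_pi] at h3
    linarith

/-- Used at a corner, where the conditions of two adjacent sides hold at once and confine the angle
to a quarter turn. -/
theorem sub_pi_div_two_mem {y : ℝ} (hy : y ∈ Set.Icc 0 Real.pi)
    (hs : 0 ≤ Real.sin (y - Real.pi / 2)) :
    y - Real.pi / 2 ∈ Set.Icc 0 (Real.pi / 2) := by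
  have hpi := Real.pi_pos
  rw [Real.sin_sub_pi_div_two] at hs
  refine ⟨?_, by linarith [hy.2]⟩
  by_contra h
  have := Real.cos_pos_of_mem_Ioo (x := y) ⟨by linarith [hy.1], by linarith⟩
  linarith

/-- A continuous planar vector field on a square that points to the left on the left side,
to the right on the right side, up on the lower side and down on the upper side has a zero. -/
theorem exists_zero_of_sides {F : ℝ × ℝ → ℂ} (hF : Continuous F)
    (h0 : ∀ t ∈ Set.Icc (0 : ℝ) 1, (F (0, t)).re ≤ 0) (h1 : ∀ t ∈ Set.Icc (0 : ℝ) 1, 0 ≤ (F (1, t)).re)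
    (h2 : ∀ s ∈ Set.Icc (0 : ℝ) 1, 0 ≤ (F (s, 0)).im) (h3 : ∀ s ∈ Set.Icc (0 : ℝ) 1, (F (s, 1)).im ≤ 0) :
    ∃ z, F z = 0 := by
  by_contra! hne
  have hpi := Real.pi_pos
  -- A field without zeros on the simply connected plane has a continuous logarithm, hence a
  -- continuous angle θ.
  obtain ⟨g, hg, hgF⟩ := Complex.exists_continuousOn_eqOn_exp_comp (U := Set.univ) (g := F)
    (by
      have := (convex_univ (𝕜 := ℝ) (E := ℝ × ℝ)).contractibleSpace Set.univ_nonempty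
      exact (inferInstance : SimplyConnectedSpace (Set.univ : Set (ℝ × ℝ)))) isOpen_univ
    hF.continuousOn (by rintro ⟨z, -, hz⟩; exact hne z hz)
  rw [continuousOn_univ] at hg
  set θ : ℝ × ℝ → ℝ := fun z => (g z).im with hθ
  have hθc : Continuous θ := Complex.continuous_im.comp hg
  have hre : ∀ z, (F z).re = Real.exp (g z).re * Real.cos (θ z) := by
    intro z
    rw [← hgF (Set.mem_univ z), Function.comp_apply, Complex.exp_re]
  have him : ∀ z, (F z).im = Real.exp (g z).re * Real.sin (θ z) := by
    intro z
    rw [← hgF (Set.mem_univ z), Function.comp_apply, Complex.exp_im]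
  have hcos0 : ∀ z, (F z).re ≤ 0 → Real.cos (θ z) ≤ 0 := fun z hz => by
    rw [hre] at hz; exact nonpos_of_mul_nonpos_right hz (Real.exp_pos _)
  have hcos1 : ∀ z, 0 ≤ (F z).re → 0 ≤ Real.cos (θ z) := fun z hz => by
    rw [hre] at hz; exact nonneg_of_mul_nonneg_right hz (Real.exp_pos _)
  have hsin1 : ∀ z, 0 ≤ (F z).im → 0 ≤ Real.sin (θ z) := fun z hz => by
    rw [him] at hz; exact nonneg_of_mul_nonneg_right hz (Real.exp_pos _)
  have hsin0 : ∀ z, (F z).im ≤ 0 → Real.sin (θ z) ≤ 0 := fun z hz => by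
    rw [him] at hz; exact nonpos_of_mul_nonpos_right hz (Real.exp_pos _)
  have m0 : (0 : ℝ) ∈ Set.Icc (0 : ℝ) 1 := by simp
  have m1 : (1 : ℝ) ∈ Set.Icc (0 : ℝ) 1 := by simp
  obtain ⟨k, hk, -⟩ := existsUnique_add_zsmul_mem_Ioc (show 0 < 2 * Real.pi by positivity)
    (θ (0, 0)) (-Real.pi)
  set c : ℝ := k • (2 * Real.pi) with hc
  have hsinc : ∀ x, Real.sin (x + c) = Real.sin x := fun x => by
    rw [hc, zsmul_eq_mul]; exact Real.sin_add_int_mul_two_pi x k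
  have hcosc : ∀ x, Real.cos (x + c) = Real.cos x := fun x => by
    rw [hc, zsmul_eq_mul]; exact Real.cos_add_int_mul_two_pi x k
  -- the lower left corner
  have hc0 : θ (0, 0) + c ∈ Set.Icc 0 Real.pi := by
    refine ⟨?_, by linarith [hk.2]⟩
    by_contra hlt
    push Not at hlt
    have := Real.sin_neg_of_neg_of_neg_pi_lt hlt (by linarith [hk.1])
    rw [hsinc] at this
    linarith [hsin1 _ (h2 0 m0)]
  have e0 : ∀ t ∈ Set.Icc (0 : ℝ) 1, 0 ≤ Real.sin (θ (0, t) + c - Real.pi / 2) := fun t ht => by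
    rw [Real.sin_sub_pi_div_two, hcosc]; linarith [hcos0 _ (h0 t ht)]
  have e1 : ∀ s ∈ Set.Icc (0 : ℝ) 1, 0 ≤ Real.sin (θ (s, 1) + c - Real.pi / 2 - Real.pi / 2) :=
    fun s hs => by
      rw [Real.sin_sub_pi_div_two, Real.cos_sub_pi_div_two, hsinc]; linarith [hsin0 _ (h3 s hs)]
  have e2 : ∀ t ∈ Set.Icc (0 : ℝ) 1,
      0 ≤ Real.sin (θ (1, 1 - t) + c - Real.pi / 2 - Real.pi / 2 - Real.pi / 2) := fun t ht => by
    rw [Real.sin_sub_pi_div_two, Real.cos_sub_pi_div_two, Real.sin_sub_pi_div_two, hcosc, neg_neg]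
    exact hcos1 _ (h1 (1 - t) ⟨by linarith [ht.2], by linarith [ht.1]⟩)
  have e3 : ∀ s ∈ Set.Icc (0 : ℝ) 1, 0 ≤ Real.sin
      (θ (1 - s, 0) + c - Real.pi / 2 - Real.pi / 2 - Real.pi / 2 - Real.pi / 2) := fun s hs => by
    rw [Real.sin_sub_pi_div_two, Real.cos_sub_pi_div_two, Real.sin_sub_pi_div_two,
      Real.cos_sub_pi_div_two, hsinc, neg_neg]
    exact hsin1 _ (h2 (1 - s) ⟨by linarith [hs.2], by linarith [hs.1]⟩)
  -- Follow θ around the square, starting at the lower left corner and going up the left side. Each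
  -- side keeps the shifted angle in [0, π], and each corner advances the shift by π/2.
  have i0 := sub_pi_div_two_mem hc0 (e0 0 m0)
  have i1 := mem_Icc_of_sin_nonneg (f := fun t => θ (0, t) + c - Real.pi / 2) (by fun_prop)
    zero_le_one e0 ⟨i0.1, by linarith [i0.2]⟩
  have i2 := sub_pi_div_two_mem i1 (e1 0 m0)
  have i3 := mem_Icc_of_sin_nonneg (f := fun s => θ (s, 1) + c - Real.pi / 2 - Real.pi / 2)
    (by fun_prop) zero_le_one e1 ⟨i2.1, by linarith [i2.2]⟩
  have i4 := sub_pi_div_two_mem i3 (by simpa using e2 0 m0)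
  have i5 := mem_Icc_of_sin_nonneg
    (f := fun t => θ (1, 1 - t) + c - Real.pi / 2 - Real.pi / 2 - Real.pi / 2)
    (by fun_prop) zero_le_one e2 ⟨by simpa using i4.1, by simp; linarith [i4.2]⟩
  simp only [sub_self] at i5
  have i6 := sub_pi_div_two_mem i5 (by simpa using e3 0 m0)
  have i7 := mem_Icc_of_sin_nonneg
    (f := fun s => θ (1 - s, 0) + c - Real.pi / 2 - Real.pi / 2 - Real.pi / 2 - Real.pi / 2)
    (by fun_prop) zero_le_one e3 ⟨by simpa using i6.1, by simp; linarith [i6.2]⟩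
  simp only [sub_self] at i7
  -- After the full circuit the same value θ(0,0) + c would be at least 2π, although it was at most
  -- π.
  linarith [i7.1, hc0.2]

/-- A curve from the left side to the right side of a rectangle meets every curve from the lower
side to the upper side. -/
theorem JoinedIn.inter_nonempty {K₁ K₂ : Set (ℝ × ℝ)} {a b c d : ℝ} {z₁ z₂ w₁ w₂ : ℝ × ℝ}
    (h₁ : JoinedIn K₁ z₁ z₂) (h₂ : JoinedIn K₂ w₁ w₂) (hK₁ : K₁ ⊆ Set.Icc a b ×ˢ Set.Icc c d)
    (hK₂ : K₂ ⊆ Set.Icc a b ×ˢ Set.Icc c d) (hz₁ : z₁.1 = a) (hz₂ : z₂.1 = b) (hw₁ : w₁.2 = c)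
    (hw₂ : w₂.2 = d) : (K₁ ∩ K₂).Nonempty := by
  obtain ⟨σ, hσ⟩ := h₁
  obtain ⟨κ, hκ⟩ := h₂
  have hσ' : ∀ s, σ.extend s ∈ K₁ := fun s => by
    obtain ⟨t, ht⟩ : σ.extend s ∈ Set.range σ := by rw [← σ.extend_range]; exact ⟨s, rfl⟩
    rw [← ht]; exact hσ t
  have hκ' : ∀ s, κ.extend s ∈ K₂ := fun s => by
    obtain ⟨t, ht⟩ : κ.extend s ∈ Set.range κ := by rw [← κ.extend_range]; exact ⟨s, rfl⟩
    rw [← ht]; exact hκ t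
  have hcσ : Continuous σ.extend := σ.continuous_extend
  have hcκ : Continuous κ.extend := κ.continuous_extend
  -- A zero of (s,t) ↦ σ(s) − κ(t) is a common point of the curves; the four side conditions say on
  -- which sides the curves begin and end.
  obtain ⟨z, hz⟩ := exists_zero_of_sides (F := fun z : ℝ × ℝ =>
      (((σ.extend z.1).1 - (κ.extend z.2).1 : ℝ) : ℂ) +
        (((σ.extend z.1).2 - (κ.extend z.2).2 : ℝ) : ℂ) * Complex.I) (by fun_prop)
    (fun t _ => by
      have := (hK₂ (hκ' t)).1.1
      simp [hz₁]; linarith)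
    (fun t _ => by
      have := (hK₂ (hκ' t)).1.2
      simp [hz₂]; linarith)
    (fun t _ => by
      have := (hK₁ (hσ' t)).2.1
      simp [hw₁]; linarith)
    (fun t _ => by
      have := (hK₁ (hσ' t)).2.2
      simp [hw₂]; linarith)
  have hre := congrArg Complex.re hz
  have him := congrArg Complex.im hz
  simp at hre him
  refine ⟨σ.extend z.1, hσ' _, ?_⟩
  have : σ.extend z.1 = κ.extend z.2 := Prod.ext (by linarith) (by linarith)
  rw [this]
  exact hκ' _

theorem joinedIn_segment_fst {x₁ x₂ y : ℝ} (h : x₁ ≤ x₂) :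
    JoinedIn (Set.Icc x₁ x₂ ×ˢ {y}) (x₁, y) (x₂, y) :=
  (((convex_Icc x₁ x₂).prod (convex_singleton y)).isPathConnected
    ⟨(x₁, y), by simpa using h⟩).joinedIn _ (by simpa using h) _ (by simpa using h)

theorem joinedIn_segment_snd {x y₁ y₂ : ℝ} (h : y₁ ≤ y₂) :
    JoinedIn ({x} ×ˢ Set.Icc y₁ y₂) (x, y₁) (x, y₂) :=
  (((convex_singleton x).prod (convex_Icc y₁ y₂)).isPathConnected
    ⟨(x, y₁), by simpa using h⟩).joinedIn _ (by simpa using h) _ (by simpa using h)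

/-- Two curves in a rectangle from the left and from the right side, respectively, to the upper side
meet if their end points on the upper side are in the wrong order. -/
theorem JoinedIn.inter_nonempty_of_corner {K₁ K₂ : Set (ℝ × ℝ)} {a b c d p p' : ℝ} {z w : ℝ × ℝ}
    (h₁ : JoinedIn K₁ z (p, d)) (h₂ : JoinedIn K₂ w (p', d))
    (hK₁ : K₁ ⊆ Set.Icc a b ×ˢ Set.Icc c d) (hK₂ : K₂ ⊆ Set.Icc a b ×ˢ Set.Icc c d)
    (hz : z.1 = a) (hw : w.1 = b) (hp : p' ≤ p) : (K₁ ∩ K₂).Nonempty := by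
  have hz' := hK₁ h₁.source_mem
  have hw' := hK₂ h₂.source_mem
  have hpm := hK₁ h₁.target_mem
  have hpm' := hK₂ h₂.target_mem
  simp only [Set.mem_prod, Set.mem_Icc] at hz' hw' hpm hpm'
  obtain ⟨w1, w2⟩ := w
  simp only at hw hw'
  subst hw
  -- Both curves are prolonged so as to cross the larger rectangle [a, b + 2] × [c − 1, d + 2],
  -- where b = `w1`. The first goes up to height d + 1 and then right to the new right side. The
  -- second comes from the new lower side along x = b + 1, turns left to its starting point, and
  -- finally rises from (p', d) to height d + 2.
  set L₁ : Set (ℝ × ℝ) := {p} ×ˢ Set.Icc d (d + 1)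
  set L₂ : Set (ℝ × ℝ) := Set.Icc p (w1 + 2) ×ˢ {d + 1}
  set M₀ : Set (ℝ × ℝ) := {w1 + 1} ×ˢ Set.Icc (c - 1) w2
  set M₁ : Set (ℝ × ℝ) := Set.Icc w1 (w1 + 1) ×ˢ {w2}
  set M₂ : Set (ℝ × ℝ) := {p'} ×ˢ Set.Icc d (d + 2)
  have j₁ : JoinedIn (K₁ ∪ L₁ ∪ L₂) z (w1 + 2, d + 1) :=
    ((h₁.mono (by intro x hx; exact .inl (.inl hx))).trans
      ((joinedIn_segment_snd (by linarith)).mono (by intro x hx; exact .inl (.inr hx)))).trans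
      ((joinedIn_segment_fst (by linarith)).mono (by intro x hx; exact .inr hx))
  have j₂ : JoinedIn (K₂ ∪ M₀ ∪ M₁ ∪ M₂) (w1 + 1, c - 1) (p', d + 2) :=
    (((joinedIn_segment_snd (by linarith)).mono
        (by intro x hx; exact .inl (.inl (.inr hx)))).trans
      (((joinedIn_segment_fst (by linarith)).mono (by intro x hx; exact .inl (.inr hx))).symm.trans
        (h₂.mono (by intro x hx; exact .inl (.inl (.inl hx)))))).trans
      ((joinedIn_segment_snd (by linarith)).mono (by intro x hx; exact .inr hx))
  obtain ⟨⟨x, y⟩, hx, hy⟩ := j₁.inter_nonempty j₂ (a := a) (b := w1 + 2) (c := c - 1) (d := d + 2)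
    (by
      rintro ⟨x, y⟩ ((h | h) | h)
      · have := hK₁ h
        simp only [Set.mem_prod, Set.mem_Icc] at this ⊢
        exact ⟨⟨by linarith, by linarith⟩, by linarith, by linarith⟩
      · simp only [L₁, Set.mem_prod, Set.mem_Icc, Set.mem_singleton_iff] at h ⊢
        exact ⟨⟨by linarith, by linarith⟩, by linarith, by linarith⟩
      · simp only [L₂, Set.mem_prod, Set.mem_Icc, Set.mem_singleton_iff] at h ⊢
        exact ⟨⟨by linarith, by linarith⟩, by linarith, by linarith⟩)
    (by
      rintro ⟨x, y⟩ (((h | h) | h) | h)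
      · have := hK₂ h
        simp only [Set.mem_prod, Set.mem_Icc] at this ⊢
        exact ⟨⟨by linarith, by linarith⟩, by linarith, by linarith⟩
      · simp only [M₀, Set.mem_prod, Set.mem_Icc, Set.mem_singleton_iff] at h ⊢
        exact ⟨⟨by linarith, by linarith⟩, by linarith, by linarith⟩
      · simp only [M₁, Set.mem_prod, Set.mem_Icc, Set.mem_singleton_iff] at h ⊢
        exact ⟨⟨by linarith, by linarith⟩, by linarith, by linarith⟩
      · simp only [M₂, Set.mem_prod, Set.mem_Icc, Set.mem_singleton_iff] at h ⊢
        exact ⟨⟨by linarith, by linarith⟩, by linarith, by linarith⟩)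
    hz rfl rfl rfl
  have hK₁' : (x, y) ∈ K₁ → a ≤ x ∧ x ≤ w1 ∧ c ≤ y ∧ y ≤ d := fun h => by
    have := hK₁ h
    simp only [Set.mem_prod, Set.mem_Icc] at this
    exact ⟨this.1.1, this.1.2, this.2.1, this.2.2⟩
  have hK₂' : (x, y) ∈ K₂ → a ≤ x ∧ x ≤ w1 ∧ c ≤ y ∧ y ≤ d := fun h => by
    have := hK₂ h
    simp only [Set.mem_prod, Set.mem_Icc] at this
    exact ⟨this.1.1, this.1.2, this.2.1, this.2.2⟩
  have hpp : p = p' → (K₁ ∩ K₂).Nonempty := by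
    rintro rfl
    exact ⟨_, h₁.target_mem, h₂.target_mem⟩
  -- The added pieces create no essential new meeting: each case is impossible, or forces a common
  -- end point. The order p' ≤ p rules out a genuine crossing of the horizontal piece `L₂` by the
  -- vertical piece `M₂`.
  rcases hx with (hx | hx) | hx
  · rcases hy with ((hy | hy) | hy) | hy
    · exact ⟨_, hx, hy⟩
    · simp only [M₀, Set.mem_prod, Set.mem_Icc, Set.mem_singleton_iff] at hy
      linarith [hK₁' hx]
    · simp only [M₁, Set.mem_prod, Set.mem_Icc, Set.mem_singleton_iff] at hy
      obtain rfl : x = w1 := le_antisymm (hK₁' hx).2.1 hy.1.1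
      obtain rfl := hy.2
      exact ⟨_, hx, h₂.source_mem⟩
    · simp only [M₂, Set.mem_prod, Set.mem_Icc, Set.mem_singleton_iff] at hy
      obtain rfl : y = d := le_antisymm (hK₁' hx).2.2.2 hy.2.1
      obtain rfl := hy.1
      exact ⟨_, hx, h₂.target_mem⟩
  · simp only [L₁, Set.mem_prod, Set.mem_Icc, Set.mem_singleton_iff] at hx
    rcases hy with ((hy | hy) | hy) | hy
    · obtain rfl : y = d := le_antisymm (hK₂' hy).2.2.2 hx.2.1
      obtain rfl := hx.1
      exact ⟨_, h₁.target_mem, hy⟩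
    · simp only [M₀, Set.mem_prod, Set.mem_Icc, Set.mem_singleton_iff] at hy
      linarith
    · simp only [M₁, Set.mem_prod, Set.mem_Icc, Set.mem_singleton_iff] at hy
      have h1 : x = w1 := by linarith
      have h2 : w2 = d := by linarith
      subst h1
      have h3 : p = x := hx.1.symm
      refine ⟨_, h₁.target_mem, ?_⟩
      rw [h3, ← h2]
      exact h₂.source_mem
    · simp only [M₂, Set.mem_prod, Set.mem_Icc, Set.mem_singleton_iff] at hy
      exact hpp (hx.1.symm.trans hy.1)
  · simp only [L₂, Set.mem_prod, Set.mem_Icc, Set.mem_singleton_iff] at hx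
    rcases hy with ((hy | hy) | hy) | hy
    · linarith [hK₂' hy]
    · simp only [M₀, Set.mem_prod, Set.mem_Icc, Set.mem_singleton_iff] at hy
      linarith
    · simp only [M₁, Set.mem_prod, Set.mem_Icc, Set.mem_singleton_iff] at hy
      linarith
    · simp only [M₂, Set.mem_prod, Set.mem_Icc, Set.mem_singleton_iff] at hy
      exact hpp (by linarith)

namespace PlaneGraph

variable {G : PlaneGraph}

/-! ### Reflections -/

theorem InvariantUnder.comp {T T' : ℝ × ℝ → ℝ × ℝ} (h : G.InvariantUnder T)
    (h' : G.InvariantUnder T') : G.InvariantUnder fun z => T' (T z) := by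
  constructor
  · conv_rhs => rw [← h'.1, ← h.1]
    rw [Set.image_image]
  · conv_rhs => rw [← h'.2, ← h.2]
    rw [Set.image_image]
    simp only [Set.image_image]

theorem InvariantUnder.mem_verts {T : ℝ × ℝ → ℝ × ℝ} (h : G.InvariantUnder T) {z : ℝ × ℝ}
    (hz : z ∈ G.verts) : T z ∈ G.verts := by
  rw [← h.1]; exact ⟨z, hz, rfl⟩

theorem InvariantUnder.mem_arcs {T : ℝ × ℝ → ℝ × ℝ} (h : G.InvariantUnder T) {e : Set (ℝ × ℝ)}
    (he : e ∈ G.arcs) : T '' e ∈ G.arcs := by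
  rw [← h.2]; exact ⟨e, he, rfl⟩

theorem InvariantUnder.image_inter_verts {T : ℝ × ℝ → ℝ × ℝ} (h : G.InvariantUnder T)
    (hT : Function.Injective T) (e : Set (ℝ × ℝ)) : T '' e ∩ G.verts = T '' (e ∩ G.verts) := by
  rw [Set.image_inter hT, h.1]

/-- `ρ` is a reflection that leaves `G` invariant, and `ℓ` is an affine function that vanishes on its
axis. -/
structure IsReflection (G : PlaneGraph) (ρ : ℝ × ℝ → ℝ × ℝ) (ℓ : ℝ × ℝ → ℝ) : Prop where
  invol : ∀ z, ρ (ρ z) = z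
  cont : Continuous ρ
  cont' : Continuous ℓ
  neg : ∀ z, ℓ (ρ z) = -ℓ z
  fixed : ∀ z, ℓ z = 0 → ρ z = z
  invariant : G.InvariantUnder ρ

theorem IsReflection.inj {ρ : ℝ × ℝ → ℝ × ℝ} {ℓ : ℝ × ℝ → ℝ} (h : IsReflection G ρ ℓ) :
    Function.Injective ρ := fun x y hxy => by rw [← h.invol x, hxy, h.invol]

/-- An edge that crosses the axis of a reflection at a point that is not a vertex is invariant. -/
theorem IsReflection.image_eq {ρ : ℝ × ℝ → ℝ × ℝ} {ℓ : ℝ × ℝ → ℝ} (h : IsReflection G ρ ℓ)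
    {e : Set (ℝ × ℝ)} (he : e ∈ G.arcs) {z : ℝ × ℝ} (hz : z ∈ e) (hzv : z ∉ G.verts)
    (hℓ : ℓ z = 0) : ρ '' e = e := by
  by_contra hne
  exact hzv (G.inter_subset _ (h.invariant.mem_arcs he) e he hne ⟨⟨z, hz, h.fixed z hℓ⟩, hz⟩)

/-- An edge whose end points lie in a half-plane bounded by a symmetry axis lies in that
half-plane. -/
theorem IsReflection.nonneg_of_arc {ρ : ℝ × ℝ → ℝ × ℝ} {ℓ : ℝ × ℝ → ℝ} (h : IsReflection G ρ ℓ)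
    {e : Set (ℝ × ℝ)} (he : e ∈ G.arcs) (hv : ∀ v ∈ e ∩ G.verts, 0 ≤ ℓ v) {z : ℝ × ℝ}
    (hz : z ∈ e) : 0 ≤ ℓ z := by
  by_contra! hneg
  obtain ⟨u, hu, v, hv', γ, hinj, hγ, huv⟩ := G.arc_spec e he
  have hu0 : 0 ≤ ℓ u := hv u (by rw [huv]; simp)
  have hv0 : 0 ≤ ℓ v := hv v (by rw [huv]; simp)
  obtain ⟨τ, rfl⟩ : z ∈ Set.range γ := by rw [hγ]; exact hz
  have hne : u ≠ v := by
    intro huv'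
    have := hinj (a₁ := 0) (a₂ := 1) (by simpa using huv')
    exact zero_ne_one this
  have hcont : Continuous fun t => ℓ (γ t) := h.cont'.comp γ.continuous
  -- An arc different from its mirror image meets the axis only at vertices. If it enters the open
  -- negative side, both its end points lie on the axis, and then it and its mirror image are
  -- parallel edges.
  have hfix : ρ '' e = e := by
    by_contra hcon
    have haxis : ∀ t, ℓ (γ t) = 0 → γ t ∈ e ∩ G.verts := by
      intro t ht
      have hte : γ t ∈ e := by rw [← hγ]; exact ⟨t, rfl⟩
      by_contra hnv
      exact hcon (h.image_eq he hte (fun hv => hnv ⟨hte, hv⟩) ht)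
    have hℓu : ℓ u = 0 := by
      obtain ⟨t, ht, ht0⟩ := intermediate_value_Icc' (a := (0 : unitInterval)) (b := τ)
        (unitInterval.nonneg _) hcont.continuousOn
        (show (0 : ℝ) ∈ Set.Icc _ _ from ⟨hneg.le, by simpa using hu0⟩)
      have hm := haxis t ht0
      rw [huv] at hm
      rcases hm with hm | hm
      · rw [← hm]; exact ht0
      · have h1 : t = 1 := hinj (by rw [hm]; simp)
        have h2 : τ = 1 := le_antisymm (unitInterval.le_one _) (h1 ▸ ht.2)
        rw [h2] at hneg
        simp at hneg
        linarith
    have hℓv : ℓ v = 0 := by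
      obtain ⟨t, ht, ht0⟩ := intermediate_value_Icc (a := τ) (b := (1 : unitInterval))
        (unitInterval.le_one _) hcont.continuousOn
        (show (0 : ℝ) ∈ Set.Icc _ _ from ⟨hneg.le, by simpa using hv0⟩)
      have hm := haxis t ht0
      rw [huv] at hm
      rcases hm with hm | hm
      · have h1 : t = 0 := hinj (by rw [hm]; simp)
        have h2 : τ = 0 := le_antisymm (h1 ▸ ht.1) (unitInterval.nonneg _)
        rw [h2] at hneg
        simp at hneg
        linarith
      · rw [← hm]; exact ht0
    refine hcon (G.no_parallel _ (h.invariant.mem_arcs he) e he ?_)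
    rw [h.invariant.image_inter_verts h.inj, huv, Set.image_pair, h.fixed u hℓu, h.fixed v hℓv]
  have hpair : ρ '' {u, v} = {u, v} := by
    rw [← huv, ← h.invariant.image_inter_verts h.inj, hfix]
  have hρu : ρ u = u := by
    have : ρ u ∈ ({u, v} : Set (ℝ × ℝ)) := by rw [← hpair]; exact ⟨u, by simp, rfl⟩
    rcases this with h1 | h1
    · exact h1
    · have h2 := h.neg u
      rw [h1] at h2
      exact h.fixed u (by linarith)
  have hρv : ρ v = v := by
    have : ρ v ∈ ({u, v} : Set (ℝ × ℝ)) := by rw [← hpair]; exact ⟨v, by simp, rfl⟩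
    rcases this with h1 | h1
    · have h2 := h.neg v
      rw [h1] at h2
      exact h.fixed v (by linarith)
    · exact h1
  have hemb := (γ.continuous.isClosedEmbedding hinj).isEmbedding
  have hmem : ∀ t, ρ (γ t) ∈ Set.range γ := by
    intro t
    rw [hγ, ← hfix, ← hγ]
    exact ⟨γ t, ⟨t, rfl⟩, rfl⟩
  set f : unitInterval → unitInterval := fun t => hemb.toHomeomorph.symm ⟨ρ (γ t), hmem t⟩ with hf
  have hγf : ∀ t, γ (f t) = ρ (γ t) := by
    intro t
    have := hemb.toHomeomorph.apply_symm_apply ⟨ρ (γ t), hmem t⟩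
    exact congrArg Subtype.val this
  have hfc : Continuous f := hemb.toHomeomorph.symm.continuous.comp
    (Continuous.subtype_mk (h.cont.comp γ.continuous) _)
  have hfi : Function.Injective f := by
    intro s t hst
    have := hγf s
    rw [hst, hγf t] at this
    exact hinj (h.inj this.symm)
  have hff : ∀ t, f (f t) = t := fun t => hinj (by rw [hγf, hγf, h.invol])
  have hf0 : f 0 = 0 := hinj (by rw [hγf]; simpa using hρu)
  -- The reflection read in the parameter is an injective continuous involution of [0,1] fixing 0.
  -- It is therefore increasing, hence the identity, so the whole arc would lie on the axis.
  have hmono : StrictMono f := hfc.strictMono_of_inj_boundedOrder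
    (by change f 0 ≤ f 1; rw [hf0]; exact unitInterval.nonneg _) hfi
  have hfτ : f τ = τ := by
    rcases lt_trichotomy (f τ) τ with hlt | heq | hgt
    · have := hmono hlt
      rw [hff] at this
      exact absurd hlt this.not_gt
    · exact heq
    · have := hmono hgt
      rw [hff] at this
      exact absurd hgt this.not_gt
  have h1 := hγf τ
  rw [hfτ] at h1
  have h2 := h.neg (γ τ)
  rw [← h1] at h2
  linarith

theorem invariant_translate (hG : G.IsSymmetric) (k : ℕ) :
    G.InvariantUnder fun z => (z.1 + k, z.2) := by
  induction k with
  | zero =>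
    have : (fun z : ℝ × ℝ => (z.1 + ((0 : ℕ) : ℝ), z.2)) = id := by ext z <;> simp
    rw [this]
    exact ⟨by simp, by simp⟩
  | succ k ih =>
    convert ih.comp hG.translate_right using 2
    push_cast
    simp [add_assoc]

theorem invariant_translate_up (hG : G.IsSymmetric) (k : ℕ) :
    G.InvariantUnder fun z => (z.1, z.2 + k) := by
  induction k with
  | zero =>
    have : (fun z : ℝ × ℝ => (z.1, z.2 + ((0 : ℕ) : ℝ))) = id := by ext z <;> simp
    rw [this]
    exact ⟨by simp, by simp⟩
  | succ k ih =>
    convert ih.comp hG.translate_up using 2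
    push_cast
    simp [add_assoc]

theorem invariant_reflect (hG : G.IsSymmetric) (k : ℕ) :
    G.InvariantUnder fun z => (k - z.1, z.2) := by
  convert hG.reflect.comp (invariant_translate hG k) using 2
  ext <;> simp; ring

theorem invariant_reflect_up (hG : G.IsSymmetric) (k : ℕ) :
    G.InvariantUnder fun z => (z.1, k - z.2) := by
  convert ((hG.rotate.comp hG.rotate).comp hG.reflect).comp (invariant_translate_up hG k) using 2
  ext <;> simp; ring

theorem invariant_swap (hG : G.IsSymmetric) : G.InvariantUnder fun z => (z.2, z.1) := by
  convert hG.rotate.comp hG.reflect using 2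
  ext <;> simp

theorem isReflection_fst (hG : G.IsSymmetric) (k : ℕ) :
    IsReflection G (fun z => (k - z.1, z.2)) (fun z => z.1 - k / 2) where
  invol z := by simp
  cont := by fun_prop
  cont' := by fun_prop
  neg z := by ring
  fixed z hz := by ext <;> simp; linarith
  invariant := invariant_reflect hG k

theorem isReflection_fst' (hG : G.IsSymmetric) (k : ℕ) :
    IsReflection G (fun z => (k - z.1, z.2)) (fun z => k / 2 - z.1) where
  invol z := by simp
  cont := by fun_prop
  cont' := by fun_prop
  neg z := by ring
  fixed z hz := by ext <;> simp; linarith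
  invariant := invariant_reflect hG k

theorem isReflection_snd (hG : G.IsSymmetric) (k : ℕ) :
    IsReflection G (fun z => (z.1, k - z.2)) (fun z => z.2 - k / 2) where
  invol z := by simp
  cont := by fun_prop
  cont' := by fun_prop
  neg z := by ring
  fixed z hz := by ext <;> simp; linarith
  invariant := invariant_reflect_up hG k

theorem isReflection_snd' (hG : G.IsSymmetric) (k : ℕ) :
    IsReflection G (fun z => (z.1, k - z.2)) (fun z => k / 2 - z.2) where
  invol z := by simp
  cont := by fun_prop
  cont' := by fun_prop
  neg z := by ring
  fixed z hz := by ext <;> simp; linarith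
  invariant := invariant_reflect_up hG k

/-! ### The drawing of a set of vertices -/

/-- The drawing of the subgraph induced by a set `P` of vertices of height at most `n`, together
with the lower parts of the edges from `P` to vertices of height more than `n`. -/
def skeleton (G : PlaneGraph) (n : ℝ) (P : Set G.verts) : Set (ℝ × ℝ) :=
  Subtype.val '' P ∪
    {z | ∃ e ∈ G.arcs, z ∈ e ∧ e ∩ G.verts ⊆ Subtype.val '' P} ∪
    {z | z.2 ≤ n ∧ ∃ e ∈ G.arcs, z ∈ e ∧ ∃ t ∈ P, t.1.2 < n ∧ ∃ t' : G.verts,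
      n < t'.1.2 ∧ e ∩ G.verts = {t.1, t'.1}}

/-- The vertices of height at most `n` that lie on the line of height `n` or on an edge
crossing it. -/
def topVerts (G : PlaneGraph) (n : ℝ) : Set G.verts :=
  {t | t.1.2 ≤ n ∧ (t.1.2 = n ∨ ∃ t', G.graph.Adj t t' ∧ n < t'.1.2)}

/-- Edges meet only at vertices, so a common point that is not a vertex lies on one edge used by
both sets. A fully drawn edge has both end points in its set; a truncated one has its unique lower
end point in its set, the upper one being too high. -/
theorem exists_common_vertex {n : ℝ} {P Q : Set G.verts} (hP : ∀ v ∈ P, v.1.2 ≤ n)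
    (hQ : ∀ v ∈ Q, v.1.2 ≤ n) (h : (skeleton G n P ∩ skeleton G n Q).Nonempty) :
    ∃ v ∈ P, v ∈ Q := by
  obtain ⟨z, hzP, hzQ⟩ := h
  have aux : ∀ P : Set G.verts, (∀ v ∈ P, v.1.2 ≤ n) → z ∈ skeleton G n P →
      ∀ hz : z ∈ G.verts, (⟨z, hz⟩ : G.verts) ∈ P := by
    rintro P hP ((⟨v, hv, rfl⟩ | ⟨e, he, hze, heP⟩) | ⟨hzn, e, he, hze, t, ht, htn, t', ht', hev⟩) hz
    · exact hv
    · obtain ⟨v, hv, hvz⟩ := heP ⟨hze, hz⟩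
      have : v = ⟨z, hz⟩ := Subtype.ext hvz
      exact this ▸ hv
    · have : z ∈ ({t.1, t'.1} : Set (ℝ × ℝ)) := hev ▸ ⟨hze, hz⟩
      rcases this with h | h
      · have : t = ⟨z, hz⟩ := Subtype.ext h.symm
        exact this ▸ ht
      · rw [h] at hzn; exact absurd ht' (not_lt.2 hzn)
  by_cases hz : z ∈ G.verts
  · exact ⟨⟨z, hz⟩, aux P hP hzP hz, aux Q hQ hzQ hz⟩
  have aux2 : ∀ P : Set G.verts, z ∈ skeleton G n P → ∃ e ∈ G.arcs, z ∈ e ∧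
      ((e ∩ G.verts ⊆ Subtype.val '' P) ∨ ∃ t ∈ P, t.1.2 < n ∧ ∃ t' : G.verts, n < t'.1.2 ∧
      e ∩ G.verts = {t.1, t'.1}) := by
    rintro P ((⟨v, hv, rfl⟩ | ⟨e, he, hze, heP⟩) | ⟨-, e, he, hze, h⟩)
    · exact absurd v.2 hz
    · exact ⟨e, he, hze, .inl heP⟩
    · exact ⟨e, he, hze, .inr h⟩
  obtain ⟨e, he, hze, heP⟩ := aux2 P hzP
  obtain ⟨f, hf, hzf, hfQ⟩ := aux2 Q hzQ
  obtain rfl : e = f := by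
    by_contra hne
    exact hz (G.inter_subset e he f hf hne ⟨hze, hzf⟩)
  have key : ∀ P Q : Set G.verts, (∀ v ∈ Q, v.1.2 ≤ n) → (e ∩ G.verts ⊆ Subtype.val '' Q) →
      ((e ∩ G.verts ⊆ Subtype.val '' P) ∨ ∃ t ∈ P, t.1.2 < n ∧ ∃ t' : G.verts, n < t'.1.2 ∧
      e ∩ G.verts = {t.1, t'.1}) → ∃ v ∈ P, v ∈ Q := by
    rintro P Q hQ heQ (heP | ⟨t, ht, htn, t', ht', hev⟩)
    · obtain ⟨u, hu, v, hv, γ, -, -, huv⟩ := G.arc_spec e he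
      obtain ⟨a, ha, hau⟩ := heP (show u ∈ e ∩ G.verts by rw [huv]; simp)
      obtain ⟨b, hb, hbu⟩ := heQ (show u ∈ e ∩ G.verts by rw [huv]; simp)
      have : a = b := Subtype.ext (hau.trans hbu.symm)
      exact ⟨a, ha, this ▸ hb⟩
    · obtain ⟨b, hb, hbt⟩ := heQ (show t'.1 ∈ e ∩ G.verts by rw [hev]; simp)
      exact absurd (hQ b hb) (not_le.2 (by rw [hbt]; exact ht'))
  rcases hfQ with hfQ | ⟨s, hs, hsn, s', hs', hev'⟩
  · exact key P Q hQ hfQ heP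
  · rcases heP with heP | ⟨t, ht, htn, t', ht', hev⟩
    · obtain ⟨v, hv, hv'⟩ := key Q P hP heP (.inr ⟨s, hs, hsn, s', hs', hev'⟩)
      exact ⟨v, hv', hv⟩
    · have hst : t.1 ∈ ({s.1, s'.1} : Set (ℝ × ℝ)) := by rw [← hev', hev]; simp
      rcases hst with h | h
      · have : t = s := Subtype.ext h
        exact ⟨t, ht, this ▸ hs⟩
      · exact absurd (hP t ht) (not_le.2 (by rw [h]; exact hs'))

theorem exists_path_of_arc {e : Set (ℝ × ℝ)} (he : e ∈ G.arcs) {x y : ℝ × ℝ}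
    (hxy : e ∩ G.verts = {x, y}) : ∃ γ : Path x y, Function.Injective γ ∧ Set.range γ = e := by
  obtain ⟨u, hu, v, hv, γ, hinj, hγ, huv⟩ := G.arc_spec e he
  rw [hxy] at huv
  rcases Set.pair_eq_pair_iff.1 huv with ⟨rfl, rfl⟩ | ⟨rfl, rfl⟩
  · exact ⟨γ, hinj, hγ⟩
  · exact ⟨γ.symm, hinj.comp unitInterval.symm_bijective.injective, by rw [Path.symm_range, hγ]⟩

theorem joinedIn_skeleton {n : ℝ} {P : Set G.verts} {u v : G.verts} (h : ConnIn G.graph P u v) :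
    JoinedIn (skeleton G n P) u.1 v.1 := by
  obtain ⟨h1, h2⟩ := h
  induction h2 with
  | refl => exact JoinedIn.refl (.inl (.inl ⟨u, h1, rfl⟩))
  | @tail b c hb hbc ih =>
    refine ih.trans ?_
    have hbP : b ∈ P := ConnIn.right_mem ⟨h1, hb⟩
    obtain ⟨⟨-, e, he, hev⟩, hcP⟩ := hbc
    obtain ⟨γ, -, hγ⟩ := exists_path_of_arc he hev
    refine ⟨γ, fun t => .inl (.inr ⟨e, he, by rw [← hγ]; exact ⟨t, rfl⟩, ?_⟩)⟩
    rw [hev]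
    rintro x (rfl | rfl)
    exacts [⟨b, hbP, rfl⟩, ⟨c, hcP, rfl⟩]

/-- The end points of an edge that crosses a horizontal symmetry axis are mirror images. -/
theorem eq_mirror_of_crossing (hG : G.IsSymmetric) {n : ℕ} {e : Set (ℝ × ℝ)} (he : e ∈ G.arcs)
    {t t' : ℝ × ℝ} (hev : e ∩ G.verts = {t, t'}) (ht : t.2 < n) (ht' : n < t'.2) :
    t' = (t.1, 2 * n - t.2) := by
  have hr := isReflection_snd hG (2 * n)
  push_cast at hr
  obtain ⟨γ, -, hγ⟩ := exists_path_of_arc he hev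
  obtain ⟨s, -, hs⟩ := intermediate_value_Icc (a := (0 : unitInterval)) (b := 1)
    (unitInterval.nonneg _) (f := fun s => (γ s).2)
    (continuous_snd.comp γ.continuous).continuousOn
    (show (n : ℝ) ∈ Set.Icc _ _ by simpa using ⟨ht.le, ht'.le⟩)
  have hse : γ s ∈ e := by rw [← hγ]; exact ⟨s, rfl⟩
  have hsv : γ s ∉ G.verts := by
    intro hv
    have : γ s ∈ ({t, t'} : Set (ℝ × ℝ)) := hev ▸ ⟨hse, hv⟩
    simp only at hs
    rcases this with h | h
    · rw [h] at hs; linarith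
    · rw [Set.mem_singleton_iff.1 h] at hs; linarith
  -- The edge meets the axis at a point that is not a vertex, so it is invariant and the reflection
  -- exchanges its end points.
  have hfix := hr.image_eq he hse hsv (by simp only at hs ⊢; rw [hs]; ring)
  have himg := hr.invariant.image_inter_verts hr.inj e
  rw [hfix, hev, Set.image_pair] at himg
  have : ((t.1, 2 * (n : ℝ) - t.2) : ℝ × ℝ) ∈ ({t, t'} : Set (ℝ × ℝ)) := by rw [himg]; simp
  rcases this with h | h
  · have := congrArg Prod.snd h
    simp only at this
    linarith
  · exact (Set.mem_singleton_iff.1 h).symm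

/-- A vertex of `topVerts` is joined to the line of height `n`. -/
theorem exists_joinedIn_top {n : ℝ} {P : Set G.verts} {t : G.verts} (ht : t ∈ P)
    (htop : t ∈ topVerts G n) : ∃ p, JoinedIn (skeleton G n P) t.1 (p, n) := by
  by_cases htn : t.1.2 = n
  · refine ⟨t.1.1, ?_⟩
    rw [← htn]
    exact JoinedIn.refl (.inl (.inl ⟨t, ht, rfl⟩))
  obtain ⟨htle, h⟩ := htop
  have htlt : t.1.2 < n := lt_of_le_of_ne htle htn
  obtain ⟨t', ⟨-, e, he, hev⟩, ht'⟩ := h.resolve_left htn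
  obtain ⟨γ, -, hγ⟩ := exists_path_of_arc he hev
  have hc : Continuous fun s => (γ.extend s).2 := continuous_snd.comp γ.continuous_extend
  -- The edge is followed only up to its first visit of height `n`, so that the piece stays below
  -- that line.
  have hZ : IsCompact (Set.Icc (0 : ℝ) 1 ∩ {s | (γ.extend s).2 = n}) :=
    isCompact_Icc.inter_right (isClosed_eq hc continuous_const)
  obtain ⟨τ, ⟨hτI, hτ⟩, hleast⟩ := hZ.exists_isLeast (by
    obtain ⟨s, hs, hsn⟩ := intermediate_value_Icc (zero_le_one' ℝ) hc.continuousOn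
      (show n ∈ Set.Icc _ _ by simpa using ⟨htle, ht'.le⟩)
    exact ⟨s, hs, hsn⟩)
  refine ⟨(γ.extend τ).1, ?_⟩
  have hj := (((convex_Icc 0 τ).isPathConnected ⟨0, by simpa using hτI.1⟩).image
    γ.continuous_extend).joinedIn (γ.extend 0) ⟨0, by simpa using hτI.1, rfl⟩ (γ.extend τ)
    ⟨τ, by simpa using hτI.1, rfl⟩
  rw [Path.extend_zero] at hj
  have hτ' : ((γ.extend τ).1, n) = γ.extend τ := Prod.ext rfl (Eq.symm hτ)
  rw [hτ']
  refine hj.mono ?_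
  rintro z ⟨s, hs, rfl⟩
  refine .inr ⟨?_, e, he, ?_, t, ht, htlt, t', ht', hev⟩
  · by_contra! hgt
    obtain ⟨r, hr, hrn⟩ := intermediate_value_Icc hs.1 hc.continuousOn
      (show n ∈ Set.Icc _ _ from ⟨by simpa using htle, hgt.le⟩)
    have h1 := hleast ⟨⟨hr.1, hr.2.trans (hs.2.trans hτI.2)⟩, hrn⟩
    have h2 : s = τ := le_antisymm hs.2 (h1.trans hr.2)
    rw [h2] at hgt
    exact hgt.ne' hτ
  · rw [← hγ, ← γ.extend_range]
    exact ⟨s, rfl⟩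

/-- The skeleton of a set of vertices in a half-plane bounded by a symmetry axis lies in the
half-plane. -/
theorem skeleton_nonneg (hG : G.IsSymmetric) {n : ℕ} {P : Set G.verts}
    {ρ : ℝ × ℝ → ℝ × ℝ} {ℓ : ℝ × ℝ → ℝ} (h : IsReflection G ρ ℓ) (hPℓ : ∀ v ∈ P, 0 ≤ ℓ v.1)
    (hℓ : ∀ z : ℝ × ℝ, z.2 ≤ n → 0 ≤ ℓ z → 0 ≤ ℓ (z.1, 2 * n - z.2)) {z : ℝ × ℝ}
    (hz : z ∈ skeleton G n P) : 0 ≤ ℓ z := by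
  rcases hz with (⟨v, hv, rfl⟩ | ⟨e, he, hze, heP⟩) | ⟨hzn, e, he, hze, t, ht, htn, t', ht', hev⟩
  · exact hPℓ v hv
  · refine h.nonneg_of_arc he (fun v hv => ?_) hze
    obtain ⟨w, hw, rfl⟩ := heP hv
    exact hPℓ w hw
  · refine h.nonneg_of_arc he (fun v hv => ?_) hze
    rw [hev] at hv
    rcases hv with rfl | hv
    · exact hPℓ t ht
    · rw [hv, eq_mirror_of_crossing hG he hev htn ht']
      exact hℓ _ htn.le (hPℓ t ht)

theorem snd_le_of_mem_skeleton (hG : G.IsSymmetric) {n : ℕ} {P : Set G.verts}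
    (hP : ∀ v ∈ P, v.1.2 ≤ n) {z : ℝ × ℝ} (hz : z ∈ skeleton G n P) : z.2 ≤ n := by
  rcases hz with (⟨v, hv, rfl⟩ | ⟨e, he, hze, heP⟩) | ⟨hzn, -⟩
  · exact hP v hv
  · have hr := isReflection_snd' hG (2 * n)
    have := hr.nonneg_of_arc he (fun v hv => by
      obtain ⟨w, hw, rfl⟩ := heP hv
      have := hP w hw
      push_cast
      linarith) hze
    push_cast at this
    linarith
  · exact hzn

/-- The rectangle `[a, b] × [0, n]`. -/
def box (a b n : ℝ) : Set (ℝ × ℝ) := Set.Icc a b ×ˢ Set.Icc 0 n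

theorem skeleton_subset_box (hG : G.IsSymmetric) {a b n : ℕ} {P : Set G.verts}
    (hP : ∀ v ∈ P, v.1 ∈ box a b n) : skeleton G n P ⊆ box a b n := by
  intro z hz
  have h1 := skeleton_nonneg hG (isReflection_fst hG (2 * a)) (fun v hv => by
    have := (hP v hv).1.1
    push_cast; linarith) (fun z _ hz => hz) hz
  have h2 := skeleton_nonneg hG (isReflection_fst' hG (2 * b)) (fun v hv => by
    have := (hP v hv).1.2
    push_cast; linarith) (fun z _ hz => hz) hz
  have h3 := skeleton_nonneg hG (isReflection_snd hG 0) (fun v hv => by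
    have := (hP v hv).2.1
    push_cast; linarith) (fun z hzn hz => by
      push_cast at hz ⊢
      linarith [(Nat.cast_nonneg n : (0 : ℝ) ≤ n)]) hz
  have h4 := snd_le_of_mem_skeleton hG (fun v hv => (hP v hv).2.2) hz
  push_cast at h1 h2 h3
  exact ⟨⟨by linarith, by linarith⟩, by linarith, by linarith⟩

/-- A horizontal crossing of a rectangle and a path from the lower to the upper side share a
vertex. -/
theorem exists_common_of_crossing (hG : G.IsSymmetric) {a b n : ℕ} {P Q : Set G.verts}
    (hP : ∀ v ∈ P, v.1 ∈ box a b n) (hQ : ∀ v ∈ Q, v.1 ∈ box a b n)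
    (h : ConnSets G.graph P {v | v.1.1 = a} {v | v.1.1 = b})
    (h' : ConnSets G.graph Q {v | v.1.2 = 0} (topVerts G n)) : ∃ v ∈ P, v ∈ Q := by
  obtain ⟨u, hu, v, hv, huv⟩ := h
  obtain ⟨x, hx, t, ht, hxt⟩ := h'
  obtain ⟨p, hp⟩ := exists_joinedIn_top hxt.right_mem ht
  refine exists_common_vertex (fun v hv => (hP v hv).2.2) (fun v hv => (hQ v hv).2.2)
    ((joinedIn_skeleton huv).inter_nonempty ((joinedIn_skeleton hxt).trans hp)
    (skeleton_subset_box hG hP) (skeleton_subset_box hG hQ) hu hv hx rfl)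

/-- A path from the left side and a path from the right side of a rectangle to its upper side share
a vertex if their end points are in the wrong order. -/
theorem exists_common_of_corner (hG : G.IsSymmetric) {a b n s : ℕ} {P Q : Set G.verts}
    (hP : ∀ v ∈ P, v.1 ∈ box a b n) (hQ : ∀ v ∈ Q, v.1 ∈ box a b n)
    (h : ConnSets G.graph P {v | v.1.1 = a} (topVerts G n ∩ {v | (s : ℝ) / 2 ≤ v.1.1}))
    (h' : ConnSets G.graph Q {v | v.1.1 = b} (topVerts G n ∩ {v | v.1.1 ≤ (s : ℝ) / 2})) :
    ∃ v ∈ P, v ∈ Q := by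
  obtain ⟨u, hu, v, hv, huv⟩ := h
  obtain ⟨x, hx, t, ht, hxt⟩ := h'
  obtain ⟨p, hp⟩ := exists_joinedIn_top (P := {v}) rfl hv.1
  obtain ⟨p', hp'⟩ := exists_joinedIn_top (P := {t}) rfl ht.1
  -- The piece from the last vertex to the upper side stays on its side of the symmetry axis x =
  -- s/2, so the order of the end points on the upper side is that of the vertices.
  have hps := skeleton_nonneg hG (isReflection_fst hG s) (P := {v}) (n := n) (fun w hw => by
    have := hv.2
    rw [hw]
    simp only [Set.mem_ofPred_eq] at this
    linarith) (fun z _ hz => hz) hp.target_mem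
  have hps' := skeleton_nonneg hG (isReflection_fst' hG s) (P := {t}) (n := n) (fun w hw => by
    have := ht.2
    rw [hw]
    simp only [Set.mem_ofPred_eq] at this
    linarith) (fun z _ hz => hz) hp'.target_mem
  have hmono : ∀ (P : Set G.verts) (v : G.verts), v ∈ P → skeleton G n {v} ⊆ skeleton G n P := by
    rintro P v hv z ((⟨w, rfl, rfl⟩ | ⟨e, he, hze, heP⟩) | ⟨hzn, e, he, hze, t, rfl, h⟩)
    · exact .inl (.inl ⟨_, hv, rfl⟩)
    · exact .inl (.inr ⟨e, he, hze, heP.trans (Set.image_mono (by simpa using hv))⟩)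
    · exact .inr ⟨hzn, e, he, hze, _, hv, h⟩
  refine exists_common_vertex (fun v hv => (hP v hv).2.2) (fun v hv => (hQ v hv).2.2)
    (((joinedIn_skeleton huv).trans (hp.mono (hmono P v huv.right_mem))).inter_nonempty_of_corner
    ((joinedIn_skeleton hxt).trans (hp'.mono (hmono Q t hxt.right_mem)))
    (skeleton_subset_box hG hP) (skeleton_subset_box hG hQ) hu hx (by
      simp only at hps hps'
      linarith))

end PlaneGraph

/-! ### The number of clusters -/

section Clusters

variable {V : Type*}

/-- The functions that are constant on the classes of a setoid. -/
def classFunctions (r : Setoid V) : Submodule ℝ (V → ℝ) where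
  carrier := {f | ∀ x y, r x y → f x = f y}
  add_mem' hf hg x y h := by simp [hf x y h, hg x y h]
  zero_mem' x y _ := rfl
  smul_mem' c f hf x y h := by simp [hf x y h]

theorem finrank_classFunctions [Finite V] (r : Setoid V) :
    Module.finrank ℝ (classFunctions r) = Nat.card (Quotient r) := by
  have := Fintype.ofFinite (Quotient r)
  have e : classFunctions r ≃ₗ[ℝ] (Quotient r → ℝ) :=
    { toFun := fun f => fun c => Quotient.lift f.1 f.2 c
      map_add' := fun f g => by ext c; induction c using Quotient.inductionOn; rfl
      map_smul' := fun a f => by ext c; induction c using Quotient.inductionOn; rfl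
      invFun := fun g => ⟨fun x => g ⟦x⟧, fun x y h => congrArg g (Quotient.sound h)⟩
      left_inv := fun f => by ext x; rfl
      right_inv := fun g => by ext c; induction c using Quotient.inductionOn; rfl }
  rw [e.finrank_eq, Module.finrank_fintype_fun_eq_card, Nat.card_eq_fintype_card]

theorem classFunctions_anti {r s : Setoid V} (h : r ≤ s) : classFunctions s ≤ classFunctions r :=
  fun _ hf x y hxy => hf x y (h hxy)

theorem classFunctions_sup (r s : Setoid V) :
    classFunctions (r ⊔ s) = classFunctions r ⊓ classFunctions s := by
  refine le_antisymm (le_inf (classFunctions_anti le_sup_left) (classFunctions_anti le_sup_right)) ?_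
  rintro f ⟨hr, hs⟩
  have : r ⊔ s ≤ Setoid.ker f := sup_le (fun {x y} h => hr x y h) (fun {x y} h => hs x y h)
  exact fun x y h => this h

theorem card_quotient_anti [Finite V] {r s : Setoid V} (h : r ≤ s) :
    Nat.card (Quotient s) ≤ Nat.card (Quotient r) := by
  rw [← finrank_classFunctions, ← finrank_classFunctions]
  exact Submodule.finrank_mono (classFunctions_anti h)

/-- The number of classes is the dimension of the space of functions constant on classes. The join
of partitions corresponds to the intersection of these spaces, and their sum lies in the space of
the meet; the dimension formula does the rest. -/
theorem card_quotient_add_le [Finite V] (r s : Setoid V) :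
    Nat.card (Quotient r) + Nat.card (Quotient s) ≤
      Nat.card (Quotient (r ⊓ s)) + Nat.card (Quotient (r ⊔ s)) := by
  simp only [← finrank_classFunctions]
  rw [← Submodule.finrank_sup_add_finrank_inf_eq, classFunctions_sup]
  exact Nat.add_le_add_right (Submodule.finrank_mono (sup_le (classFunctions_anti inf_le_left)
    (classFunctions_anti inf_le_right))) _

variable {H : SimpleGraph V}

/-- The number of clusters of a configuration, with boundary condition `ξ`. -/
noncomputable def clusters (ξ : Setoid V) (ω : Config H) : ℕ :=
  Nat.card (Quotient ((openGraph ω).reachableSetoid ⊔ ξ))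

theorem reachableSetoid_le_iff {K : SimpleGraph V} {r : Setoid V} :
    K.reachableSetoid ≤ r ↔ ∀ x y, K.Adj x y → r x y := by
  constructor
  · intro h x y hxy
    exact h (SimpleGraph.Adj.reachable hxy)
  · rintro h x y ⟨w⟩
    induction w with
    | nil => exact r.refl _
    | cons hadj _ ih => exact r.trans (h _ _ hadj) ih

theorem reachableSetoid_openGraph_sup (a b : Config H) :
    (openGraph (a ⊔ b)).reachableSetoid =
      (openGraph a).reachableSetoid ⊔ (openGraph b).reachableSetoid := by
  refine le_antisymm (reachableSetoid_le_iff.2 ?_) (sup_le ?_ ?_)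
  · rintro x y ⟨h, ho⟩
    rcases (Bool.or_eq_true _ _).mp ho with ho | ho
    · exact (le_sup_left : (openGraph a).reachableSetoid ≤ _)
        (SimpleGraph.Adj.reachable (G := openGraph a) ⟨h, ho⟩)
    · exact (le_sup_right : (openGraph b).reachableSetoid ≤ _)
        (SimpleGraph.Adj.reachable (G := openGraph b) ⟨h, ho⟩)
  · exact reachableSetoid_le_iff.2 fun x y h =>
      SimpleGraph.Adj.reachable (openGraph_mono le_sup_left h)
  · exact reachableSetoid_le_iff.2 fun x y h =>
      SimpleGraph.Adj.reachable (openGraph_mono le_sup_right h)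

theorem reachableSetoid_mono {K K' : SimpleGraph V} (h : K ≤ K') :
    K.reachableSetoid ≤ K'.reachableSetoid :=
  reachableSetoid_le_iff.2 fun _ _ hxy => SimpleGraph.Adj.reachable (h hxy)

theorem clusters_anti [Finite V] (ξ : Setoid V) {a b : Config H} (h : a ≤ b) :
    clusters ξ b ≤ clusters ξ a :=
  card_quotient_anti (sup_le_sup_right (reachableSetoid_mono (openGraph_mono h)) _)

/-- With q ≥ 1 this is the lattice condition behind FKG. -/
theorem clusters_add_le [Finite V] (ξ : Setoid V) (a b : Config H) :
    clusters ξ a + clusters ξ b ≤ clusters ξ (a ⊓ b) + clusters ξ (a ⊔ b) := by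
  refine (card_quotient_add_le _ _).trans (add_le_add (card_quotient_anti ?_) (le_of_eq ?_))
  · exact le_inf (sup_le_sup_right (reachableSetoid_mono (openGraph_mono inf_le_left)) _)
      (sup_le_sup_right (reachableSetoid_mono (openGraph_mono inf_le_right)) _)
  · rw [clusters, reachableSetoid_openGraph_sup, ← sup_sup_distrib_right]

/-- Map a function constant on the clusters of `a` to its increments along the newly opened edges.
The kernel consists of functions constant on the larger clusters, and the image has dimension at
most the number of new edges. -/
theorem clusters_le_add_card [Finite V] (ξ : Setoid V) (a b : Config H) :
    clusters ξ a ≤ clusters ξ (a ⊔ b) + {e | a e = false ∧ b e = true}.ncard := by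
  classical
  set N : Set H.edgeSet := {e | a e = false ∧ b e = true} with hN
  have := Fintype.ofFinite V
  have := Fintype.ofFinite N
  have hcard : N.ncard = Module.finrank ℝ (N → ℝ) := by
    rw [Module.finrank_fintype_fun_eq_card, ← Nat.card_eq_fintype_card]
    rfl
  set F := classFunctions ((openGraph a).reachableSetoid ⊔ ξ)
  set T : F →ₗ[ℝ] (N → ℝ) :=
    { toFun := fun f e => f.1 (Quot.out e.1.1).1 - f.1 (Quot.out e.1.1).2
      map_add' := fun f g => by ext e; simp; ring
      map_smul' := fun c f => by ext e; simp; ring } with hT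
  have h1 := T.finrank_range_add_finrank_ker
  have h2 : Module.finrank ℝ T.range ≤ Module.finrank ℝ (N → ℝ) := Submodule.finrank_le _
  have h3 : Module.finrank ℝ T.ker ≤
      Module.finrank ℝ (classFunctions ((openGraph (a ⊔ b)).reachableSetoid ⊔ ξ)) := by
    rw [← Submodule.finrank_map_subtype_eq F T.ker]
    refine Submodule.finrank_mono ?_
    rintro _ ⟨f, hf, rfl⟩
    rw [classFunctions_sup]
    refine ⟨?_, classFunctions_anti le_sup_right f.2⟩
    have hle : (openGraph (a ⊔ b)).reachableSetoid ≤ Setoid.ker f.1 := by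
      refine reachableSetoid_le_iff.2 ?_
      rintro x y ⟨h, ho⟩
      change f.1 x = f.1 y
      by_cases ha : a ⟨s(x, y), h⟩ = true
      · exact f.2 x y (le_sup_left (a := (openGraph a).reachableSetoid)
          (SimpleGraph.Adj.reachable (G := openGraph a) ⟨h, ha⟩))
      · have hb : b ⟨s(x, y), h⟩ = true := ((Bool.or_eq_true _ _).mp ho).resolve_left ha
        have hf0 := congrFun (LinearMap.mem_ker.1 hf) ⟨⟨s(x, y), h⟩, by simpa using ha, hb⟩
        simp only [hT, LinearMap.coe_mk, AddHom.coe_mk, Pi.zero_apply] at hf0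
        have hout : s((Quot.out s(x, y)).1, (Quot.out s(x, y)).2) = s(x, y) :=
          Quot.out_eq s(x, y)
        rcases Sym2.eq_iff.1 hout with ⟨h1, h2⟩ | ⟨h1, h2⟩
        · rw [h1, h2] at hf0; linarith
        · rw [h1, h2] at hf0; linarith
    exact fun x y h => hle h
  rw [clusters, clusters, ← finrank_classFunctions, ← finrank_classFunctions, hcard]
  change Module.finrank ℝ F ≤ _
  omega

end Clusters

/-! ### Random-cluster weights -/

section Weights

variable {V : Type*} [Fintype V] {H : SimpleGraph V}

open Classical in
/-- The part of the weight that does not depend on the clusters. -/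
noncomputable def edgeWeight (p : ℝ) (ω : Config H) : ℝ := ∏ e, bif ω e then p else 1 - p

theorem rcWeight_eq (p q : ℝ) (ξ : Setoid V) (ω : Config H) :
    rcWeight p q ξ ω = edgeWeight p ω * q ^ clusters ξ ω := by
  classical
  unfold rcWeight edgeWeight clusters
  simp only [Bool.cond_eq_ite]
  rw [Finset.prod_ite, Finset.prod_const, Finset.prod_const, Nat.card_eq_fintype_card,
    Nat.card_eq_fintype_card, Fintype.card_subtype, Fintype.card_subtype]
  simp only [Bool.not_eq_true]

theorem edgeWeight_nonneg {p : ℝ} (h0 : 0 ≤ p) (h1 : p ≤ 1) (ω : Config H) :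
    0 ≤ edgeWeight p ω :=
  Finset.prod_nonneg fun e _ => by cases ω e <;> simp <;> linarith

theorem rcWeight_nonneg {p q : ℝ} (h0 : 0 ≤ p) (h1 : p ≤ 1) (hq : 0 ≤ q) (ξ : Setoid V)
    (ω : Config H) : 0 ≤ rcWeight p q ξ ω := by
  rw [rcWeight_eq]
  exact mul_nonneg (edgeWeight_nonneg h0 h1 ω) (by positivity)

theorem sum_edgeWeight [Fintype (Config H)] (p : ℝ) : ∑ ω : Config H, edgeWeight p ω = 1 := by
  classical
  unfold edgeWeight
  have h := Finset.prod_univ_sum (fun _ : H.edgeSet => (Finset.univ : Finset Bool))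
    (fun _ b => bif b then p else 1 - p)
  simp only [Fintype.univ_bool, Finset.mem_singleton, Bool.true_eq_false, not_false_eq_true,
    Finset.sum_insert, cond_true, Finset.sum_singleton, cond_false, add_sub_cancel,
    Finset.prod_const_one] at h
  refine Eq.trans (Finset.sum_congr ?_ fun _ _ => rfl) h.symm
  ext ω
  simp

theorem sum_rcWeight_pos [Fintype (Config H)] {p q : ℝ} (h0 : 0 ≤ p) (h1 : p ≤ 1) (hq : 0 < q)
    (ξ : Setoid V) : 0 < ∑ ω : Config H, rcWeight p q ξ ω := by
  refine Finset.sum_pos' (fun ω _ => rcWeight_nonneg h0 h1 hq.le ξ ω) ?_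
  by_contra! hcon
  have : ∑ ω : Config H, edgeWeight p ω = 0 := by
    refine Finset.sum_eq_zero fun ω hω => ?_
    have h := (hcon ω hω).antisymm (rcWeight_nonneg h0 h1 hq.le ξ ω)
    rw [rcWeight_eq] at h
    exact (mul_eq_zero.1 h).resolve_right (by positivity)
  rw [sum_edgeWeight] at this
  exact one_ne_zero this

theorem edgeWeight_mul (p : ℝ) (a b : Config H) :
    edgeWeight p a * edgeWeight p b = edgeWeight p (a ⊓ b) * edgeWeight p (a ⊔ b) := by
  unfold edgeWeight
  rw [← Finset.prod_mul_distrib, ← Finset.prod_mul_distrib]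
  refine Finset.prod_congr rfl fun e _ => ?_
  simp only [Pi.inf_apply, Pi.sup_apply]
  cases a e <;> cases b e <;> simp [mul_comm]

theorem rcWeight_mul_le {p q : ℝ} (h0 : 0 ≤ p) (h1 : p ≤ 1) (hq : 1 ≤ q) (ξ : Setoid V)
    (a b : Config H) :
    rcWeight p q ξ a * rcWeight p q ξ b ≤ rcWeight p q ξ (a ⊓ b) * rcWeight p q ξ (a ⊔ b) := by
  simp only [rcWeight_eq]
  rw [mul_mul_mul_comm, mul_mul_mul_comm (edgeWeight p (a ⊓ b)), edgeWeight_mul, ← pow_add,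
    ← pow_add]
  exact mul_le_mul_of_nonneg_left (pow_le_pow_right₀ hq (clusters_add_le ξ a b))
    (mul_nonneg (edgeWeight_nonneg h0 h1 _) (edgeWeight_nonneg h0 h1 _))

theorem clusters_le_add_ncard (ξ : Setoid V) (ω ω' : Config H) :
    clusters ξ ω ≤ clusters ξ ω' + {e | ω e ≠ ω' e}.ncard := by
  refine (clusters_le_add_card ξ ω ω').trans (add_le_add (clusters_anti ξ le_sup_right) ?_)
  refine Set.ncard_le_ncard ?_ (Set.toFinite _)
  rintro e ⟨h1, h2⟩
  simp [h1, h2]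

/-- Finite energy. -/
theorem rcWeight_le {p q r : ℝ} (h0 : 0 < p) (h1 : p < 1) (hq : 1 ≤ q) (hr : 1 / p ≤ r)
    (hr' : 1 / (1 - p) ≤ r) (ξ : Setoid V) (ω ω' : Config H) :
    rcWeight p q ξ ω ≤ (r * q) ^ {e | ω e ≠ ω' e}.ncard * rcWeight p q ξ ω' := by
  classical
  have h1' : 0 < 1 - p := by linarith
  have hr1 : 1 ≤ r := le_trans (by rw [le_div_iff₀ h0]; linarith) hr
  have hedge : edgeWeight p ω ≤ r ^ {e | ω e ≠ ω' e}.ncard * edgeWeight p ω' := by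
    have hc : r ^ {e | ω e ≠ ω' e}.ncard = ∏ e : H.edgeSet, if ω e ≠ ω' e then r else 1 := by
      rw [Finset.prod_ite, Finset.prod_const, Finset.prod_const, one_pow, mul_one,
        Set.ncard_eq_toFinset_card']
      congr 2
      ext; simp
    unfold edgeWeight
    rw [hc, ← Finset.prod_mul_distrib]
    refine Finset.prod_le_prod (fun e _ => by cases ω e <;> simp <;> linarith) fun e _ => ?_
    rw [div_le_iff₀ h0] at hr
    rw [div_le_iff₀ h1'] at hr'
    cases hω : ω e <;> cases hω' : ω' e <;> simp <;> linarith
  rw [rcWeight_eq, rcWeight_eq, mul_pow, mul_mul_mul_comm, ← pow_add, add_comm _ (clusters ξ ω')]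
  exact mul_le_mul hedge (pow_le_pow_right₀ hq (clusters_le_add_ncard ξ ω ω')) (by positivity)
    (mul_nonneg (by positivity) (edgeWeight_nonneg h0.le h1.le _))

open Classical in
/-- The mean of a function under the random-cluster measure. -/
noncomputable def rcMean (p q : ℝ) (ξ : Setoid V) (f : Config H → ℝ) : ℝ :=
  (∑ ω : Config H, rcWeight p q ξ ω * f ω) / ∑ ω : Config H, rcWeight p q ξ ω

theorem rcProb_eq_rcMean (p q : ℝ) (ξ : Setoid V) (A : Set (Config H)) :
    rcProb p q ξ A = rcMean p q ξ (A.indicator 1) := by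
  classical
  unfold rcProb rcMean
  simp [Set.indicator_apply]

theorem rcProb_eq_indicator [Fintype (Config H)] (p q : ℝ) (ξ : Setoid V) (A : Set (Config H)) :
    rcProb p q ξ A = (∑ ω : Config H, A.indicator (rcWeight p q ξ) ω) /
      ∑ ω : Config H, rcWeight p q ξ ω := by
  classical
  unfold rcProb
  simp only [Set.indicator_apply]
  congr!

section Mean

variable {p q : ℝ} {ξ : Setoid V}

theorem rcMean_mono (h0 : 0 ≤ p) (h1 : p ≤ 1) (hq : 0 < q) {f g : Config H → ℝ} (hfg : f ≤ g) :
    rcMean p q ξ f ≤ rcMean p q ξ g := by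
  classical
  refine div_le_div_of_nonneg_right (Finset.sum_le_sum fun ω _ => ?_)
    (sum_rcWeight_pos h0 h1 hq ξ).le
  exact mul_le_mul_of_nonneg_left (hfg ω) (rcWeight_nonneg h0 h1 hq.le ξ ω)

theorem rcMean_const (h0 : 0 ≤ p) (h1 : p ≤ 1) (hq : 0 < q) (c : ℝ) :
    rcMean (H := H) p q ξ (fun _ => c) = c := by
  classical
  unfold rcMean
  rw [← Finset.sum_mul, mul_comm, mul_div_assoc, div_self (sum_rcWeight_pos h0 h1 hq ξ).ne',
    mul_one]

theorem rcMean_add (f g : Config H → ℝ) :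
    rcMean p q ξ (f + g) = rcMean p q ξ f + rcMean p q ξ g := by
  classical
  simp [rcMean, mul_add, Finset.sum_add_distrib, add_div]

theorem rcMean_mul_left (c : ℝ) (f : Config H → ℝ) :
    rcMean p q ξ (fun ω => c * f ω) = c * rcMean p q ξ f := by
  classical
  simp only [rcMean, mul_left_comm _ c, ← Finset.mul_sum, mul_div_assoc]

theorem rcMean_sum {ι : Type*} (s : Finset ι) (f : ι → Config H → ℝ) :
    rcMean p q ξ (fun ω => ∑ i ∈ s, f i ω) = ∑ i ∈ s, rcMean p q ξ (f i) := by
  classical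
  induction s using Finset.induction_on with
  | empty => simp [rcMean]
  | insert a s ha ih =>
    simp only [Finset.sum_insert ha]
    rw [← ih, ← rcMean_add]
    rfl

theorem rcMean_mul_le (h0 : 0 ≤ p) (h1 : p ≤ 1) (hq : 1 ≤ q) {f g : Config H → ℝ} (hf0 : 0 ≤ f)
    (hg0 : 0 ≤ g) (hf : Monotone f) (hg : Monotone g) :
    rcMean p q ξ f * rcMean p q ξ g ≤ rcMean p q ξ (f * g) := by
  classical
  have hpos := sum_rcWeight_pos (H := H) h0 h1 (zero_lt_one.trans_le hq) ξ
  have h := fkg f g (rcWeight p q ξ) (fun ω => rcWeight_nonneg h0 h1 (by linarith) ξ ω) hf0 hg0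
    hf hg (rcWeight_mul_le h0 h1 hq ξ)
  unfold rcMean
  rw [div_mul_div_comm, div_le_div_iff₀ (by positivity) hpos]
  calc _ ≤ _ := mul_le_mul_of_nonneg_right h hpos.le
    _ = _ := by simp only [Pi.mul_apply]; ring

theorem rcProb_nonneg (h0 : 0 ≤ p) (h1 : p ≤ 1) (hq : 0 < q) (A : Set (Config H)) :
    0 ≤ rcProb p q ξ A := by
  rw [rcProb_eq_rcMean, ← rcMean_const (H := H) (ξ := ξ) h0 h1 hq 0]
  exact rcMean_mono h0 h1 hq fun ω => Set.indicator_nonneg (fun _ _ => zero_le_one) _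

theorem rcProb_compl (h0 : 0 ≤ p) (h1 : p ≤ 1) (hq : 0 < q) (A : Set (Config H)) :
    rcProb p q ξ Aᶜ = 1 - rcProb p q ξ A := by
  rw [eq_sub_iff_add_eq, rcProb_eq_rcMean, rcProb_eq_rcMean, ← rcMean_add,
    ← rcMean_const (H := H) (ξ := ξ) h0 h1 hq 1]
  congr 1
  ext ω
  by_cases h : ω ∈ A <;> simp [h]

theorem monotone_indicator_one {V : Type*} {H : SimpleGraph V} {A : Set (Config H)} (hA : IsUpperSet A) :
    Monotone (A.indicator (1 : Config H → ℝ)) := by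
  intro a b hab
  by_cases ha : a ∈ A
  · simp [ha, hA hab ha]
  · rw [Set.indicator_of_notMem ha]
    exact Set.indicator_nonneg (fun _ _ => zero_le_one) _

theorem rcProb_inter_le (h0 : 0 ≤ p) (h1 : p ≤ 1) (hq : 1 ≤ q) {A B : Set (Config H)}
    (hA : IsUpperSet A) (hB : IsUpperSet B) :
    rcProb p q ξ A * rcProb p q ξ B ≤ rcProb p q ξ (A ∩ B) := by
  simp only [rcProb_eq_rcMean]
  refine (rcMean_mul_le h0 h1 hq (fun ω => Set.indicator_nonneg (fun _ _ => zero_le_one) _)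
    (fun ω => Set.indicator_nonneg (fun _ _ => zero_le_one) _) (monotone_indicator_one hA)
    (monotone_indicator_one hB)).trans (le_of_eq ?_)
  rw [Set.inter_indicator_one]
  rfl

/-- The random-cluster measure is dominated by independent percolation. -/
theorem rcProb_le_bernoulli (h0 : 0 ≤ p) (h1 : p ≤ 1) (hq : 1 ≤ q) {A : Set (Config H)}
    (hA : IsUpperSet A) [Fintype (Config H)] :
    rcProb p q ξ A ≤ ∑ ω : Config H, A.indicator (edgeWeight p) ω := by
  classical
  have hq0 : 0 < q := by linarith
  have hpos := sum_rcWeight_pos (H := H) h0 h1 hq0 ξ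
  have h := holley (μ := A.indicator (1 : Config H → ℝ))
    (f := fun ω => rcWeight p q ξ ω / ∑ ω : Config H, rcWeight p q ξ ω) (g := edgeWeight (V := V) (H := H) p)
    (fun ω => Set.indicator_nonneg (fun _ _ => zero_le_one) _)
    (fun ω => div_nonneg (rcWeight_nonneg h0 h1 hq0.le ξ ω) hpos.le) (edgeWeight_nonneg h0 h1)
    (monotone_indicator_one hA)
    (by rw [← Finset.sum_div, div_self hpos.ne', sum_edgeWeight])
    (fun a b => by
      rw [div_mul_eq_mul_div, div_mul_eq_mul_div]
      refine div_le_div_of_nonneg_right ?_ hpos.le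
      -- In Holley's criterion the edge weights balance exactly, and passing from `a` to `a ⊓ b` can
      -- only increase the number of clusters.
      rw [rcWeight_eq, rcWeight_eq, mul_right_comm _ (q ^ clusters ξ a), edgeWeight_mul,
        mul_right_comm _ (q ^ clusters ξ (a ⊓ b))]
      exact mul_le_mul_of_nonneg_left (pow_le_pow_right₀ hq (clusters_anti ξ inf_le_left))
        (mul_nonneg (edgeWeight_nonneg h0 h1 _) (edgeWeight_nonneg h0 h1 _)))
  rw [rcProb_eq_indicator]
  calc _ = ∑ ω, A.indicator 1 ω * (rcWeight p q ξ ω / ∑ ω : Config H, rcWeight p q ξ ω) := by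
        rw [Finset.sum_div]
        refine Finset.sum_congr rfl fun ω _ => ?_
        by_cases hω : ω ∈ A <;> simp [hω]
    _ ≤ _ := h
    _ = _ := by
        refine Finset.sum_congr rfl fun ω _ => ?_
        by_cases hω : ω ∈ A <;> simp [hω]

/-- The random-cluster measure dominates independent percolation with a smaller parameter. -/
theorem bernoulli_le_rcProb (h0 : 0 ≤ p) (h1 : p ≤ 1) (hq : 1 ≤ q) {A : Set (Config H)}
    (hA : IsUpperSet A) [Fintype (Config H)] :
    ∑ ω : Config H, A.indicator (edgeWeight (p / (p + q * (1 - p)))) ω ≤ rcProb p q ξ A := by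
  classical
  have hq0 : 0 < q := by linarith
  have hpos := sum_rcWeight_pos (H := H) h0 h1 hq0 ξ
  set s : ℝ := p + q * (1 - p) with hs
  have hs0 : 0 < s := by nlinarith
  set p' : ℝ := p / s with hp'
  have hp0 : 0 ≤ p' := by positivity
  have hp1' : 1 - p' = q * (1 - p) / s := by
    rw [hp', eq_div_iff hs0.ne', sub_mul, div_mul_cancel₀ _ hs0.ne']
    linarith
  have hp1 : p' ≤ 1 := by
    have : 0 ≤ 1 - p' := by rw [hp1']; exact div_nonneg (by nlinarith) hs0.le
    linarith
  -- The odds of `p'` are those of `p` divided by `q`. Each edge open in `a` and closed in `b` thus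
  -- supplies one factor `q`, which pays for the at most one cluster lost by opening it.
  have key : ∀ a b : Config H, edgeWeight p' a * edgeWeight p b *
      q ^ {e | b e = false ∧ a e = true}.ncard = edgeWeight p' (a ⊓ b) * edgeWeight p (a ⊔ b) := by
    intro a b
    have hc : q ^ {e | b e = false ∧ a e = true}.ncard =
        ∏ e : H.edgeSet, if b e = false ∧ a e = true then q else 1 := by
      rw [Finset.prod_ite, Finset.prod_const, Finset.prod_const, one_pow, mul_one,
        Set.ncard_eq_toFinset_card']
      congr 2
      ext; simp
    rw [hc]
    unfold edgeWeight
    rw [← Finset.prod_mul_distrib, ← Finset.prod_mul_distrib, ← Finset.prod_mul_distrib]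
    refine Finset.prod_congr rfl fun e _ => ?_
    simp only [Pi.inf_apply, Pi.sup_apply]
    cases a e <;> cases b e <;> simp [hp']
    field_simp
    rw [hs]
    ring
  have h := holley (μ := A.indicator (1 : Config H → ℝ)) (f := edgeWeight (V := V) (H := H) p')
    (g := fun ω => rcWeight p q ξ ω / ∑ ω : Config H, rcWeight p q ξ ω)
    (fun ω => Set.indicator_nonneg (fun _ _ => zero_le_one) _) (edgeWeight_nonneg hp0 hp1)
    (fun ω => div_nonneg (rcWeight_nonneg h0 h1 hq0.le ξ ω) hpos.le)
    (monotone_indicator_one hA)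
    (by rw [← Finset.sum_div, div_self hpos.ne', sum_edgeWeight])
    (fun a b => by
      rw [mul_div_assoc', mul_div_assoc']
      refine div_le_div_of_nonneg_right ?_ hpos.le
      rw [rcWeight_eq, rcWeight_eq, ← mul_assoc, ← mul_assoc, ← key, mul_assoc _ (q ^ _), ← pow_add,
        add_comm]
      refine mul_le_mul_of_nonneg_left (pow_le_pow_right₀ hq ?_)
        (mul_nonneg (edgeWeight_nonneg hp0 hp1 _) (edgeWeight_nonneg h0 h1 _))
      rw [sup_comm]
      exact clusters_le_add_card ξ b a)
  rw [rcProb_eq_indicator]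
  calc _ = ∑ ω, A.indicator 1 ω * edgeWeight p' ω := by
        refine Finset.sum_congr rfl fun ω _ => ?_
        by_cases hω : ω ∈ A <;> simp [hω]
    _ ≤ _ := h
    _ = _ := by
        rw [Finset.sum_div]
        refine Finset.sum_congr rfl fun ω _ => ?_
        by_cases hω : ω ∈ A <;> simp [hω]

end Mean

end Weights

/-! ### Comparison of two edge weights -/

/-- The event `A` depends only on the state of the edges in `F`. -/
def DeterminedBy {ι : Type*} (F : Set ι) (A : Set (ι → Bool)) : Prop :=
  ∀ ω ω' : ι → Bool, (∀ e ∈ F, ω e = ω' e) → ω ∈ A → ω' ∈ A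

section Comparison

variable {V : Type*} [Fintype V] {H : SimpleGraph V}

theorem edgeWeight_zero {ω : Config H} {e : H.edgeSet} (h : ω e = true) :
    edgeWeight 0 ω = 0 := by
  classical
  unfold edgeWeight
  exact Finset.prod_eq_zero (Finset.mem_univ e) (by simp [h])

theorem edgeWeight_one {ω : Config H} {e : H.edgeSet} (h : ω e = false) :
    edgeWeight 1 ω = 0 := by
  classical
  unfold edgeWeight
  exact Finset.prod_eq_zero (Finset.mem_univ e) (by simp [h])

theorem edgeWeight_change {p p' : ℝ} (h0 : 0 < p) (hpp : p < p') (h1 : p' < 1) :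
    ∃ c : ℝ, 0 < c ∧ ∀ ω : Config H, edgeWeight p' ω = c * (edgeWeight p ω *
      Real.exp (Real.log (p' * (1 - p) / (p * (1 - p'))) * ({e | ω e = true}.ncard : ℝ))) := by
  classical
  have h1' : 0 < 1 - p' := by linarith
  have h1p : 0 < 1 - p := by linarith
  have h0' : 0 < p' := by linarith
  have hexp : Real.exp (Real.log (p' * (1 - p) / (p * (1 - p')))) =
      p' * (1 - p) / (p * (1 - p')) := Real.exp_log (by positivity)
  refine ⟨∏ e : H.edgeSet, (1 - p') / (1 - p), Finset.prod_pos fun _ _ => by positivity,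
    fun ω => ?_⟩
  rw [mul_comm (Real.log _), Real.exp_nat_mul, hexp]
  have hc : (p' * (1 - p) / (p * (1 - p'))) ^ {e | ω e = true}.ncard =
      ∏ e : H.edgeSet, bif ω e then p' * (1 - p) / (p * (1 - p')) else 1 := by
    simp only [Bool.cond_eq_ite]
    rw [Finset.prod_ite, Finset.prod_const, Finset.prod_const, one_pow, mul_one,
      Set.ncard_eq_toFinset_card']
    congr 2
    ext; simp
  rw [hc]
  unfold edgeWeight
  rw [← Finset.prod_mul_distrib, ← Finset.prod_mul_distrib]
  refine Finset.prod_congr rfl fun e _ => ?_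
  cases ω e
  · simp; field_simp
  · simp; field_simp

/-- The derivative of log(p/(1 − p)) is 1/(p(1 − p)) ≥ 4. Here this is obtained from log(1 + x) ≥
2x/(x + 2), applied to the two factors of the odds ratio. -/
theorem four_mul_sub_le_log {p p' : ℝ} (h0 : 0 < p) (hpp : p < p') (h1 : p' < 1) :
    4 * (p' - p) ≤ Real.log (p' * (1 - p) / (p * (1 - p'))) := by
  have h1' : 0 < 1 - p' := by linarith
  have h1p : 0 < 1 - p := by linarith
  have h0' : 0 < p' := by linarith
  have e1 := Real.le_log_one_add_of_nonneg (x := p' / p - 1) (by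
    rw [le_sub_iff_add_le, zero_add, le_div_iff₀ h0]; linarith)
  have e2 := Real.le_log_one_add_of_nonneg (x := (1 - p) / (1 - p') - 1) (by
    rw [le_sub_iff_add_le, zero_add, le_div_iff₀ h1']; linarith)
  rw [add_sub_cancel] at e1 e2
  have hlog : Real.log (p' * (1 - p) / (p * (1 - p'))) =
      Real.log (p' / p) + Real.log ((1 - p) / (1 - p')) := by
    rw [← Real.log_mul (by positivity) (by positivity)]
    congr 1
    field_simp
  have f1 : 2 * (p' / p - 1) / (p' / p - 1 + 2) = 2 * (p' - p) / (p + p') := by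
    have hs : p + p' ≠ 0 := by linarith
    have h3 : p' / p - 1 + 2 = (p + p') / p := by field_simp; ring
    have h4 : p' / p - 1 = (p' - p) / p := by field_simp
    rw [h3, h4]
    field_simp
  have f2 : 2 * ((1 - p) / (1 - p') - 1) / ((1 - p) / (1 - p') - 1 + 2) =
      2 * (p' - p) / (2 - (p + p')) := by
    have : (2 - (p + p')) ≠ 0 := by linarith
    have h3 : (1 - p) / (1 - p') - 1 + 2 = (2 - (p + p')) / (1 - p') := by field_simp; ring
    have h4 : (1 - p) / (1 - p') - 1 = (p' - p) / (1 - p') := by field_simp; ring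
    rw [h3, h4]
    field_simp
  rw [f1] at e1
  rw [f2] at e2
  have hs : 0 < p + p' := by linarith
  have hs' : 0 < 2 - (p + p') := by linarith
  have key : 4 * (p' - p) ≤ 2 * (p' - p) / (p + p') + 2 * (p' - p) / (2 - (p + p')) := by
    rw [div_add_div _ _ hs.ne' hs'.ne', le_div_iff₀ (by positivity)]
    nlinarith [mul_nonneg (sub_nonneg.2 hpp.le) (sq_nonneg (p + p' - 1))]
  linarith

/-- The measure at `p'` is the one at `p` tilted by exp(L o), with o the number of open edges. On
the complement of `A` the tilt equals exp(L(o − f)), which is increasing and so negatively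
correlated with that complement; the normalisation is at least E[exp(L(o − f))] E[exp(L f)] by FKG,
and Jensen bounds the last factor below by exp(L E[f]). -/
theorem rcProb_compl_le {p p' q : ℝ} (h0 : 0 ≤ p) (hpp : p < p') (h1 : p' ≤ 1) (hq : 1 ≤ q)
    (ξ : Setoid V) {A : Set (Config H)} (hA : IsUpperSet A) {f : Config H → ℝ} (hf : Monotone f)
    (hf' : Monotone fun ω => ({e | ω e = true}.ncard : ℝ) - f ω) (hfA : ∀ ω ∉ A, f ω = 0) :
    rcProb p' q ξ Aᶜ ≤ rcProb p q ξ Aᶜ * Real.exp (-(4 * (p' - p) * rcMean p q ξ f)) := by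
  classical
  have hq0 : 0 < q := by linarith
  have h0' : 0 < p' := by linarith
  have h1p : p < 1 := by linarith
  by_cases hbot : (⊥ : Config H) ∈ A
  · have hAu : A = Set.univ := Set.eq_univ_of_forall fun ω => hA bot_le hbot
    subst hAu
    rw [rcProb_compl h0'.le h1 hq0, rcProb_compl h0 h1p.le hq0]
    simp [rcProb_eq_rcMean]
    have : ∀ p : ℝ, 0 ≤ p → p ≤ 1 → rcMean (H := H) p q ξ 1 = 1 :=
      fun p h0 h1 => rcMean_const h0 h1 hq0 1
    rw [this p' h0'.le h1, this p h0 h1p.le]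
    simp
  have hP1 : ∀ B : Set (Config H), rcProb p' q ξ B ≤ 1 := fun B => by
    have := rcProb_nonneg (ξ := ξ) h0'.le h1 hq0 Bᶜ
    rw [rcProb_compl h0'.le h1 hq0] at this
    linarith
  have hPB := rcProb_nonneg (ξ := ξ) h0 h1p.le hq0 Aᶜ
  rcases h0.eq_or_lt with rfl | h0
  -- At p = 0 only the closed configuration has weight; there f = 0 and `A` fails, so the right side
  -- equals 1.
  · have hw : ∀ ω : Config H, ω ≠ ⊥ → rcWeight 0 q ξ ω = 0 := by
      intro ω hω
      obtain ⟨e, he⟩ := Function.ne_iff.1 hω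
      rw [rcWeight_eq, edgeWeight_zero (e := e) (by simpa using he), zero_mul]
    have hm : rcMean 0 q ξ f = 0 := by
      unfold rcMean
      rw [Finset.sum_eq_zero, zero_div]
      intro ω _
      by_cases h : ω = ⊥
      · rw [h, hfA _ hbot, mul_zero]
      · rw [hw ω h, zero_mul]
    have hone : rcProb 0 q ξ Aᶜ = 1 := by
      rw [rcProb_compl le_rfl zero_le_one hq0, rcProb_eq_indicator, Finset.sum_eq_zero, zero_div,
        sub_zero]
      intro ω _
      by_cases h : ω = ⊥
      · rw [h, Set.indicator_of_notMem hbot]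
      · by_cases hωA : ω ∈ A
        · rw [Set.indicator_of_mem hωA, hw ω h]
        · rw [Set.indicator_of_notMem hωA]
    rw [hm, hone]
    simpa using hP1 Aᶜ
  rcases h1.eq_or_lt with rfl | h1
  -- At p' = 1 all edges are open. Either `A` occurs surely, or the increasing event `A` is empty
  -- and f is identically zero.
  · by_cases htop : (⊤ : Config H) ∈ A
    · have : rcProb 1 q ξ Aᶜ = 0 := by
        rw [rcProb_eq_indicator, Finset.sum_eq_zero, zero_div]
        intro ω _
        by_cases hωA : ω ∈ Aᶜ
        · have hω : ω ≠ ⊤ := by rintro rfl; exact hωA htop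
          obtain ⟨e, he⟩ := Function.ne_iff.1 hω
          rw [Set.indicator_of_mem hωA, rcWeight_eq, edgeWeight_one (e := e) (by simpa using he),
            zero_mul]
        · rw [Set.indicator_of_notMem hωA]
      rw [this]
      positivity
    · have hAe : ∀ ω, ω ∉ A := fun ω hω => htop (hA le_top hω)
      have hm : rcMean p q ξ f = 0 := by
        unfold rcMean
        rw [Finset.sum_eq_zero, zero_div]
        intro ω _
        rw [hfA ω (hAe ω), mul_zero]
      have hone : rcProb p q ξ Aᶜ = 1 := by
        have : A = ∅ := Set.eq_empty_of_forall_notMem hAe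
        rw [rcProb_compl h0.le h1p.le hq0, this, rcProb_eq_indicator]
        simp
      rw [hm, hone]
      simpa using hP1 Aᶜ
  -- the main case
  set L := Real.log (p' * (1 - p) / (p * (1 - p'))) with hL
  have hL4 : 4 * (p' - p) ≤ L := four_mul_sub_le_log h0 hpp h1
  have hL0 : 0 ≤ L := le_trans (by linarith) hL4
  set o : Config H → ℝ := fun ω => ({e | ω e = true}.ncard : ℝ) with ho
  set m := rcMean p q ξ f with hm
  have hm0 : 0 ≤ m := by
    rw [hm, ← rcMean_const (H := H) (ξ := ξ) h0.le h1p.le hq0 0]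
    refine rcMean_mono h0.le h1p.le hq0 fun ω => ?_
    rw [← hfA ⊥ hbot]
    exact hf bot_le
  set g : Config H → ℝ := fun ω => Real.exp (L * (o ω - f ω)) with hg
  set k : Config H → ℝ := fun ω => Real.exp (L * f ω) with hk
  have hg0 : 0 ≤ g := fun ω => (Real.exp_pos _).le
  have hk0 : 0 ≤ k := fun ω => (Real.exp_pos _).le
  have hgm : Monotone g := fun a b hab => Real.exp_le_exp.2 (mul_le_mul_of_nonneg_left (hf' hab) hL0)
  have hkm : Monotone k := fun a b hab => Real.exp_le_exp.2 (mul_le_mul_of_nonneg_left (hf hab) hL0)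
  have hgk : g * k = fun ω => Real.exp (L * o ω) := by
    funext ω
    simp only [hg, hk, Pi.mul_apply]
    rw [← Real.exp_add]
    congr 1
    ring
  have f1 : rcMean p q ξ g * rcMean p q ξ k ≤ rcMean p q ξ (fun ω => Real.exp (L * o ω)) := by
    rw [← hgk]; exact rcMean_mul_le h0.le h1p.le hq hg0 hk0 hgm hkm
  have f2 : Real.exp (L * m) ≤ rcMean p q ξ k := by
    -- Jensen's inequality, by means of the tangent line of the exponential at L m.
    calc Real.exp (L * m) = rcMean p q ξ
          (fun ω => Real.exp (L * m) * (((1 - L * m : ℝ)) + L * f ω)) := by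
          rw [rcMean_mul_left]
          have : (fun ω => ((1 - L * m : ℝ)) + L * f ω) = (fun _ : Config H => (1 - L * m : ℝ)) +
              fun ω => L * f ω := rfl
          rw [this, rcMean_add, rcMean_const h0.le h1p.le hq0, rcMean_mul_left, ← hm]
          ring
      _ ≤ _ := by
          refine rcMean_mono h0.le h1p.le hq0 fun ω => ?_
          have h := Real.add_one_le_exp (L * f ω - L * m)
          calc _ ≤ Real.exp (L * m) * Real.exp (L * f ω - L * m) :=
                mul_le_mul_of_nonneg_left (by linarith) (Real.exp_pos _).le
            _ = _ := by rw [← Real.exp_add]; simp [hk]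
  have f3 : rcMean p q ξ (Aᶜ.indicator 1 * g) ≤ rcProb p q ξ Aᶜ * rcMean p q ξ g := by
    have h := rcMean_mul_le (ξ := ξ) h0.le h1p.le hq
      (fun ω => Set.indicator_nonneg (fun _ _ => zero_le_one) _) hg0 (monotone_indicator_one hA) hgm
    have hsum : Aᶜ.indicator 1 * g + A.indicator 1 * g = g := by
      funext ω
      by_cases hω : ω ∈ A <;> simp [hω]
    have h2 := congrArg (rcMean p q ξ) hsum
    rw [rcMean_add] at h2
    rw [rcProb_compl h0.le h1p.le hq0, rcProb_eq_rcMean]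
    have h3 : rcMean p q ξ (A.indicator 1) * rcMean p q ξ g ≤ rcMean p q ξ (A.indicator 1 * g) := h
    linarith
  obtain ⟨c, hc, hchange⟩ := edgeWeight_change (H := H) h0 hpp h1
  have hratio : ∀ h : Config H → ℝ, rcMean p' q ξ h = rcMean p q ξ (fun ω =>
      h ω * Real.exp (L * o ω)) / rcMean p q ξ (fun ω => Real.exp (L * o ω)) := by
    intro h
    have hpos := sum_rcWeight_pos (H := H) h0.le h1p.le hq0 ξ
    unfold rcMean
    rw [div_div_div_cancel_right₀ hpos.ne']
    have e1 : ∀ ω : Config H, rcWeight p' q ξ ω = c * (rcWeight p q ξ ω * Real.exp (L * o ω)) := by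
      intro ω
      rw [rcWeight_eq, rcWeight_eq, hchange]
      ring
    simp only [e1, mul_assoc, ← Finset.mul_sum]
    rw [mul_div_mul_left _ _ hc.ne']
    congr 1
    refine Finset.sum_congr rfl fun ω _ => ?_
    ring
  have hgpos : 0 < rcMean p q ξ g := by
    have hpos := sum_rcWeight_pos (H := H) h0.le h1p.le hq0 ξ
    refine div_pos ?_ hpos
    refine Finset.sum_pos (fun ω _ => mul_pos ?_ (Real.exp_pos _)) ⟨⊥, Finset.mem_univ _⟩
    rw [rcWeight_eq]
    refine mul_pos (Finset.prod_pos fun e _ => ?_) (by positivity)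
    cases ω e <;> simp <;> linarith
  have f4 : rcMean p q ξ (fun ω => Aᶜ.indicator 1 ω * Real.exp (L * o ω)) =
      rcMean p q ξ (Aᶜ.indicator 1 * g) := by
    congr 1
    funext ω
    by_cases hω : ω ∈ A
    · simp [hω]
    · simp [hω, hg, hfA ω hω]
  rw [rcProb_eq_rcMean p', hratio, f4, div_le_iff₀ (lt_of_lt_of_le
    (mul_pos hgpos ((Real.exp_pos _).trans_le f2)) f1)]
  calc rcMean p q ξ (Aᶜ.indicator 1 * g) ≤ rcProb p q ξ Aᶜ * rcMean p q ξ g := f3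
    _ = rcProb p q ξ Aᶜ * Real.exp (-(L * m)) * (rcMean p q ξ g * Real.exp (L * m)) := by
        have hexp : Real.exp (-(L * m)) * Real.exp (L * m) = 1 := by rw [← Real.exp_add]; simp
        rw [mul_mul_mul_comm, hexp, mul_one]
    _ ≤ rcProb p q ξ Aᶜ * Real.exp (-(4 * (p' - p) * m)) *
          (rcMean p q ξ g * rcMean p q ξ k) := by
        refine mul_le_mul (mul_le_mul_of_nonneg_left (Real.exp_le_exp.2 ?_) hPB)
          (mul_le_mul_of_nonneg_left f2 hgpos.le) (by positivity) (by positivity)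
        have := mul_le_mul_of_nonneg_right hL4 hm0
        linarith
    _ ≤ _ := mul_le_mul_of_nonneg_left f1 (by positivity)

/-- The number of events that occur, among events that depend on disjoint sets of edges, increases
more slowly than the number of open edges. -/
theorem monotone_ncard_sub_sum_indicator {ι : Type*} (s : Finset ι) (A : ι → Set (Config H))
    (F : ι → Set H.edgeSet) (hF : ∀ i ∈ s, ∀ j ∈ s, i ≠ j → Disjoint (F i) (F j))
    (hA : ∀ i ∈ s, DeterminedBy (F i) (A i)) :
    Monotone fun ω : Config H => ({e | ω e = true}.ncard : ℝ) -
      ∑ i ∈ s, (A i).indicator (1 : Config H → ℝ) ω := by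
  classical
  intro a b hab
  rcases isEmpty_or_nonempty H.edgeSet with hE | hE
  · rw [Subsingleton.elim a b]
  set T := s.filter fun i => b ∈ A i ∧ a ∉ A i with hT
  have h1 : ∑ i ∈ s, (A i).indicator (1 : Config H → ℝ) b ≤
      ∑ i ∈ s, (A i).indicator (1 : Config H → ℝ) a + T.card := by
    rw [← sub_le_iff_le_add', ← Finset.sum_sub_distrib]
    calc _ ≤ ∑ i ∈ s, (if b ∈ A i ∧ a ∉ A i then 1 else 0 : ℝ) := by
          refine Finset.sum_le_sum fun i _ => ?_
          by_cases h : b ∈ A i <;> by_cases h' : a ∈ A i <;> simp [h, h']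
      _ = _ := by rw [Finset.sum_ite, hT]; simp
  -- An event that occurs for `b` but not for `a` requires a newly opened edge in its own set; as
  -- these sets are disjoint, distinct events use distinct edges.
  have hchg : ∀ i ∈ T, ∃ e ∈ F i, a e = false ∧ b e = true := by
    intro i hi
    obtain ⟨his, hb, ha⟩ := Finset.mem_filter.1 hi
    by_contra! hcon
    refine ha (hA i his b a (fun e he => ?_) hb)
    have h1 := hcon e he
    have h2 := hab e
    revert h1 h2
    cases a e <;> cases b e <;> simp
  choose! ed hed using hchg
  have h2 : T.card + {e | a e = true}.ncard ≤ {e | b e = true}.ncard := by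
    rw [← Finset.card_image_of_injOn (f := ed) (s := T)]
    · rw [← Set.ncard_coe_finset, ← Set.ncard_union_eq]
      · refine Set.ncard_le_ncard ?_ (Set.toFinite _)
        rintro e (he | he)
        · obtain ⟨i, hi, rfl⟩ := Finset.mem_image.1 (Finset.mem_coe.1 he)
          exact (hed i hi).2.2
        · have h2 := hab e
          simp only [Set.mem_ofPred_eq] at he
          rw [he] at h2
          exact Bool.eq_true_of_true_le h2
      · rw [Set.disjoint_left]
        intro e he he'
        obtain ⟨i, hi, rfl⟩ := Finset.mem_image.1 (Finset.mem_coe.1 he)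
        simp only [Set.mem_ofPred_eq] at he'
        rw [(hed i hi).2.1] at he'
        cases he'
    · intro i hi j hj hij
      by_contra hne
      exact Set.disjoint_left.1 (hF i (Finset.mem_filter.1 hi).1 j (Finset.mem_filter.1 hj).1 hne)
        (hed i hi).1 (by rw [hij]; exact (hed j hj).1)
  have h3 : (T.card : ℝ) + {e | a e = true}.ncard ≤ {e | b e = true}.ncard := by exact_mod_cast h2
  simp only
  linarith

end Comparison

/-! ### Local events and finite-volume laws -/

namespace DeterminedBy
variable {ι : Type*} {F F' : Set ι} {A B : Set (ι → Bool)}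

theorem mono (h : DeterminedBy F A) (hF : F ⊆ F') : DeterminedBy F' A :=
  fun ω ω' hω => h ω ω' fun e he => hω e (hF he)

theorem compl (h : DeterminedBy F A) : DeterminedBy F Aᶜ :=
  fun ω ω' hω hA hA' => hA (h ω' ω (fun e he => (hω e he).symm) hA')

theorem inter (h : DeterminedBy F A) (h' : DeterminedBy F B) : DeterminedBy F (A ∩ B) :=
  fun ω ω' hω hA => ⟨h ω ω' hω hA.1, h' ω ω' hω hA.2⟩

theorem mem_iff (h : DeterminedBy F A) {ω ω' : ι → Bool} (hω : ∀ e ∈ F, ω e = ω' e) :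
    ω ∈ A ↔ ω' ∈ A :=
  ⟨h ω ω' hω, h ω' ω fun e he => (hω e he).symm⟩

theorem eq_preimage_restrict {F : Finset ι} (h : DeterminedBy (F : Set ι) A) :
    A = F.restrict ⁻¹' (F.restrict (π := fun _ => Bool) '' A) := by
  refine (Set.subset_preimage_image _ _).antisymm ?_
  rintro ω ⟨ω', hω', h2⟩
  exact h ω' ω (fun e he => congrFun h2 ⟨e, he⟩) hω'

theorem measurableSet {F : Finset ι} (h : DeterminedBy (F : Set ι) A) : MeasurableSet A := by
  rw [h.eq_preimage_restrict]
  exact F.measurable_restrict (Set.toFinite _).measurableSet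

theorem isClopen {F : Finset ι} (h : DeterminedBy (F : Set ι) A) : IsClopen A := by
  rw [h.eq_preimage_restrict]
  exact (isClopen_discrete _).preimage (by fun_prop)

end DeterminedBy

section FiniteVolume
variable {W : Type*} {H : SimpleGraph W}

theorem determinedBy_cylinder (F : Finset H.edgeSet) (η : Config H) :
    DeterminedBy (F : Set H.edgeSet) {ω | ∀ e ∈ F, ω e = η e} :=
  fun _ _ h hω e he => (h e he).symm.trans (hω e he)

open Classical in
theorem measureReal_eq_sum {F : Finset H.edgeSet} {A : Set (Config H)}
    (h : DeterminedBy (F : Set H.edgeSet) A) (μ : Measure (Config H)) [IsFiniteMeasure μ] :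
    μ.real A = ∑ σ : F → Bool with σ ∈ F.restrict (π := fun _ => Bool) '' A,
      μ.real (F.restrict (π := fun _ => Bool) ⁻¹' {σ}) := by
  rw [sum_measureReal_preimage_singleton (f := F.restrict (π := fun _ => Bool)) _ fun σ _ =>
    F.measurable_restrict (measurableSet_singleton σ), Finset.coe_filter]
  congr 1
  refine h.eq_preimage_restrict.trans ?_
  ext ω
  simp

/-- Convergence of the probabilities of cylinders implies the convergence of the probabilities of
all events depending on finitely many edges. -/
theorem tendsto_measureReal_of_cylinder {μs : ℕ → Measure (Config H)} {μ : Measure (Config H)}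
    [∀ k, IsFiniteMeasure (μs k)] [IsFiniteMeasure μ]
    (hlim : ∀ (F : Finset H.edgeSet) (η : Config H),
      Tendsto (fun k => (μs k).real {ω | ∀ e ∈ F, ω e = η e}) atTop
        (𝓝 (μ.real {ω | ∀ e ∈ F, ω e = η e})))
    {F : Finset H.edgeSet} {A : Set (Config H)} (h : DeterminedBy (F : Set H.edgeSet) A) :
    Tendsto (fun k => (μs k).real A) atTop (𝓝 (μ.real A)) := by
  classical
  simp_rw [measureReal_eq_sum h]
  refine tendsto_finsetSum _ fun σ _ => ?_
  have h2 : F.restrict (π := fun _ => Bool) ⁻¹' {σ} =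
      {ω | ∀ e ∈ F, ω e = if he : e ∈ F then σ ⟨e, he⟩ else false} := by
    ext ω
    rw [Set.mem_preimage, Set.mem_singleton_iff, Set.mem_ofPred_eq]
    refine ⟨fun h e he => ?_, fun h => funext fun e => ?_⟩
    · rw [← h, dif_pos he]
      rfl
    · exact (h e.1 e.2).trans (dif_pos e.2)
  rw [h2]
  exact hlim F _

open Classical in
/-- The law of the random-cluster configuration in the finite volume `Λ`, extended by closed
edges. -/
noncomputable def finiteLaw (H : SimpleGraph W) (p q : ℝ) (Λ : Finset W)
    (ξ : Setoid (Λ : Set W)) : Measure (Config H) :=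
  ∑ ω : Config (H.induce (Λ : Set W)),
    ENNReal.ofReal (rcProb p q ξ {ω}) • Measure.dirac (extendClosed H Λ ω)

theorem rcProb_eq_sum_singleton {V : Type*} [Fintype V] {K : SimpleGraph V} [Fintype (Config K)]
    (p q : ℝ) (ξ : Setoid V) (A : Set (Config K)) :
    rcProb p q ξ A = ∑ ω : Config K, A.indicator (fun ω => rcProb p q ξ {ω}) ω := by
  classical
  rw [rcProb_eq_indicator, Finset.sum_div]
  refine Finset.sum_congr rfl fun ω _ => ?_
  by_cases h : ω ∈ A
  · have h2 : ∑ b, ({ω} : Set (Config K)).indicator (rcWeight p q ξ) b = rcWeight p q ξ ω := by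
      rw [Finset.sum_eq_single ω]
      · simp
      · intro b _ hb
        simp [hb]
      · simp
    rw [Set.indicator_of_mem h, Set.indicator_of_mem h, rcProb_eq_indicator, h2]
  · rw [Set.indicator_of_notMem h, Set.indicator_of_notMem h, zero_div]

theorem finiteLaw_real {p q : ℝ} (h0 : 0 ≤ p) (h1 : p ≤ 1) (hq : 0 < q) (Λ : Finset W)
    (ξ : Setoid (Λ : Set W)) {A : Set (Config H)} (hA : MeasurableSet A) :
    (finiteLaw H p q Λ ξ).real A = rcProb p q ξ (extendClosed H Λ ⁻¹' A) := by
  classical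
  rw [rcProb_eq_sum_singleton, finiteLaw, measureReal_def, Measure.finsetSum_apply,
    ENNReal.toReal_sum]
  · refine Finset.sum_congr rfl fun ω _ => ?_
    rw [Measure.smul_apply, Measure.dirac_apply' _ hA, smul_eq_mul, ENNReal.toReal_mul,
      ENNReal.toReal_ofReal (rcProb_nonneg h0 h1 hq _)]
    by_cases h : extendClosed H Λ ω ∈ A
    · simp [h]
    · simp [h]
  · intro ω _
    rw [Measure.smul_apply, smul_eq_mul]
    exact (ENNReal.mul_lt_top ENNReal.ofReal_lt_top (measure_lt_top _ _)).ne

theorem rcProb_univ {V : Type*} [Fintype V] {K : SimpleGraph V} {p q : ℝ} (h0 : 0 ≤ p)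
    (h1 : p ≤ 1) (hq : 0 < q) (ξ : Setoid V) : rcProb (H := K) p q ξ Set.univ = 1 := by
  classical
  rw [rcProb_eq_indicator, Set.indicator_univ]
  exact div_self (sum_rcWeight_pos h0 h1 hq ξ).ne'

theorem isProbabilityMeasure_finiteLaw {p q : ℝ} (h0 : 0 ≤ p) (h1 : p ≤ 1) (hq : 0 < q)
    (Λ : Finset W) (ξ : Setoid (Λ : Set W)) : IsProbabilityMeasure (finiteLaw H p q Λ ξ) := by
  constructor
  have h := finiteLaw_real (H := H) h0 h1 hq Λ ξ MeasurableSet.univ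
  rw [Set.preimage_univ, rcProb_univ h0 h1 hq, measureReal_def] at h
  rwa [← ENNReal.toReal_eq_one_iff]

/-- Exhausting finite volumes and boundary conditions. -/
def IsExhaustion (H : SimpleGraph W) (Λ : ℕ → Finset W) (ξ : ∀ k, Setoid (Λ k : Set W)) : Prop :=
  Monotone Λ ∧ (∀ x, ∃ k, x ∈ Λ k) ∧ ∀ k, IsBoundaryCondition H (Λ k) (ξ k)

/-- The finite-volume probabilities of all local events converge. -/
def LocalLimit (p q : ℝ) (Λ : ℕ → Finset W) (ξ : ∀ k, Setoid (Λ k : Set W))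
    (μ : Measure (Config H)) : Prop :=
  ∀ (F : Finset H.edgeSet) (A : Set (Config H)), DeterminedBy (F : Set H.edgeSet) A →
    Tendsto (fun k => rcProb (H := H.induce (Λ k : Set W)) p q (ξ k)
      (extendClosed H (Λ k) ⁻¹' A)) atTop (𝓝 (μ.real A))

/-- A local event is a finite disjoint union of cylinders, so convergence on cylinders extends to
all local events. -/
theorem isInfiniteVolume_iff {p q : ℝ} (h0 : 0 ≤ p) (h1 : p ≤ 1) (hq : 0 < q)
    {μ : Measure (Config H)} : IsInfiniteVolume H p q μ ↔ IsProbabilityMeasure μ ∧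
      ∃ (Λ : ℕ → Finset W) (ξ : ∀ k, Setoid (Λ k : Set W)), IsExhaustion H Λ ξ ∧
        LocalLimit p q Λ ξ μ := by
  refine and_congr_right fun hμ => exists₂_congr fun Λ ξ => ?_
  simp only [IsExhaustion, and_assoc]
  refine and_congr_right fun _ => and_congr_right fun _ => and_congr_right fun _ => ?_
  have := fun k => isProbabilityMeasure_finiteLaw (H := H) h0 h1 hq (Λ k) (ξ k)
  constructor
  · intro h F A hA
    have h2 := tendsto_measureReal_of_cylinder
      (μs := fun k => finiteLaw H p q (Λ k) (ξ k)) (μ := μ) (fun F η => (h F η).congr fun k =>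
        (finiteLaw_real h0 h1 hq _ _ (determinedBy_cylinder F η).measurableSet).symm) hA
    refine Tendsto.congr (fun k => ?_) h2
    exact finiteLaw_real h0 h1 hq (Λ k) (ξ k) hA.measurableSet
  · intro h F η
    have h2 := h F {ω | ∀ e ∈ F, ω e = η e} (determinedBy_cylinder F η)
    exact h2

theorem LocalLimit.comp {p q : ℝ} {Λ : ℕ → Finset W} {ξ : ∀ k, Setoid (Λ k : Set W)}
    {μ : Measure (Config H)} (h : LocalLimit p q Λ ξ μ) {s : ℕ → ℕ} (hs : StrictMono s) :
    LocalLimit p q (fun k => Λ (s k)) (fun k => ξ (s k)) μ :=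
  fun F A hA => (h F A hA).comp hs.tendsto_atTop

theorem IsExhaustion.comp {Λ : ℕ → Finset W} {ξ : ∀ k, Setoid (Λ k : Set W)}
    (h : IsExhaustion H Λ ξ) {s : ℕ → ℕ} (hs : StrictMono s) :
    IsExhaustion H (fun k => Λ (s k)) (fun k => ξ (s k)) :=
  ⟨h.1.comp hs.monotone, fun x => by
    obtain ⟨k, hk⟩ := h.2.1 x
    exact ⟨k, h.1 (hs.id_le k) hk⟩, fun k => h.2.2 _⟩

/-- Along every exhaustion some subsequence of the finite-volume laws has an infinite-volume
limit. -/
theorem IsExhaustion.exists_localLimit {Λ : ℕ → Finset W} {ξ : ∀ k, Setoid (Λ k : Set W)}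
    (h : IsExhaustion H Λ ξ) {p q : ℝ} (h0 : 0 ≤ p) (h1 : p ≤ 1) (hq : 0 < q) :
    ∃ (s : ℕ → ℕ) (μ : Measure (Config H)), StrictMono s ∧ IsProbabilityMeasure μ ∧
      LocalLimit p q (fun k => Λ (s k)) (fun k => ξ (s k)) μ := by
  have hW : Countable W := by
    rw [← Set.countable_univ_iff]
    refine (Set.countable_iUnion fun k => (Λ k).countable_toSet).mono fun x _ => ?_
    obtain ⟨k, hk⟩ := h.2.1 x
    exact Set.mem_iUnion.2 ⟨k, hk⟩
  -- The probability measures on the compact configuration space form a compact space. Local events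
  -- are clopen, so weak convergence gives convergence of their probabilities.
  obtain ⟨μ, s, hs, hlim⟩ := CompactSpace.tendsto_subseq fun k =>
    (show ProbabilityMeasure (Config H) from ⟨finiteLaw H p q (Λ k) (ξ k), isProbabilityMeasure_finiteLaw h0 h1 hq _ _⟩)
  refine ⟨s, μ, hs, inferInstance, fun F A hA => ?_⟩
  have h2 := ProbabilityMeasure.tendsto_measure_of_null_frontier_of_tendsto' hlim
    (E := A) (by rw [hA.isClopen.frontier_eq, measure_empty])
  have h3 := (ENNReal.tendsto_toReal (measure_ne_top _ _)).comp h2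
  refine h3.congr fun k => ?_
  exact finiteLaw_real h0 h1 hq _ _ hA.measurableSet

/-- If the infinite-volume measures with parameters `p` and `p'` are unique, both are local limits
along the same finite volumes and boundary conditions. -/
theorem exists_common_exhaustion {p p' q : ℝ} (h0 : 0 ≤ p) (h1 : p ≤ 1) (h0' : 0 ≤ p')
    (h1' : p' ≤ 1) (hq : 0 < q) {φ φ' : Measure (Config H)} (hφ : IsUniqueInfiniteVolume H p q φ)
    (hφ' : IsUniqueInfiniteVolume H p' q φ') :
    ∃ (Λ : ℕ → Finset W) (ξ : ∀ k, Setoid (Λ k : Set W)), IsExhaustion H Λ ξ ∧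
      LocalLimit p q Λ ξ φ ∧ LocalLimit p' q Λ ξ φ' := by
  obtain ⟨-, Λ, ξ, hΛ, hlim⟩ := (isInfiniteVolume_iff h0 h1 hq).1 hφ.1
  obtain ⟨s, μ, hs, hμ, hlim'⟩ := hΛ.exists_localLimit h0' h1' hq
  -- The subsequential limit at `p'` is an infinite-volume measure, hence equals `φ'`; the
  -- convergence at `p` survives on the subsequence.
  obtain rfl := hφ'.2 μ ((isInfiniteVolume_iff h0' h1' hq).2 ⟨hμ, _, _, hΛ.comp hs, hlim'⟩)
  exact ⟨_, _, hΛ.comp hs, hlim.comp hs, hlim'⟩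

end FiniteVolume

/-! ### Invariance under automorphisms -/

/-- Monotonicity gives one inclusion; the other follows by transporting back along the inverse
bijection. -/
theorem Setoid.comap_sup_equiv {V V' : Type*} (f : V ≃ V') (r s : Setoid V') :
    (r ⊔ s).comap f = r.comap f ⊔ s.comap f := by
  have hle : ∀ {a b : Setoid V'}, a ≤ b → a.comap f ≤ b.comap f := fun h x y hxy => h hxy
  refine le_antisymm (fun x y hxy => ?_) (sup_le (hle le_sup_left) (hle le_sup_right))
  have h : r ⊔ s ≤ (r.comap f ⊔ s.comap f).comap f.symm := by
    refine sup_le (fun a b hab => ?_) fun a b hab => ?_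
    · exact (le_sup_left : r.comap f ≤ _) (show r (f (f.symm a)) (f (f.symm b)) by simpa using hab)
    · exact (le_sup_right : s.comap f ≤ _) (show s (f (f.symm a)) (f (f.symm b)) by simpa using hab)
  have h2 : (r.comap f ⊔ s.comap f) (f.symm (f x)) (f.symm (f y)) := h hxy
  simpa using h2

section Transport
variable {V V' : Type*} {K : SimpleGraph V} {K' : SimpleGraph V'}

/-- The configuration transported by an isomorphism. -/
def pullConfig (f : K ≃g K') (ω : Config K') : Config K := fun e => ω (f.mapEdgeSet e)

theorem openGraph_pullConfig_adj (f : K ≃g K') (ω : Config K') {x y : V} :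
    (openGraph (pullConfig f ω)).Adj x y ↔ (openGraph ω).Adj (f x) (f y) := by
  constructor
  · rintro ⟨h, hω⟩
    exact ⟨f.map_adj_iff.2 h, hω⟩
  · rintro ⟨h, hω⟩
    exact ⟨f.map_adj_iff.1 h, hω⟩

/-- The isomorphism between the open subgraphs. -/
def openGraphIso (f : K ≃g K') (ω : Config K') : openGraph (pullConfig f ω) ≃g openGraph ω :=
  ⟨f.toEquiv, (openGraph_pullConfig_adj f ω).symm⟩

theorem rcWeight_pullConfig (f : K ≃g K') (p q : ℝ) (ξ : Setoid V') (ω : Config K') :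
    rcWeight p q (ξ.comap f) (pullConfig f ω) = rcWeight p q ξ ω := by
  have h : ∀ b, Nat.card {e : K.edgeSet // pullConfig f ω e = b} =
      Nat.card {e : K'.edgeSet // ω e = b} := fun b =>
    Nat.card_congr (f.mapEdgeSet.subtypeEquiv fun e => Iff.rfl)
  have h2 : (openGraph (pullConfig f ω)).reachableSetoid ⊔ ξ.comap f =
      ((openGraph ω).reachableSetoid ⊔ ξ).comap f := by
    have h3 : (openGraph (pullConfig f ω)).reachableSetoid =
        (openGraph ω).reachableSetoid.comap f.toEquiv := by
      ext x y
      exact (openGraphIso f ω).reachable_iff.symm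
    rw [h3]
    exact (Setoid.comap_sup_equiv f.toEquiv _ _).symm
  unfold rcWeight
  rw [h, h, h2]
  congr 2
  exact Nat.card_congr (Quotient.congr f.toEquiv fun x y => Iff.rfl)

theorem rcProb_pullConfig [Fintype V] [Fintype V'] (f : K ≃g K') (p q : ℝ) (ξ : Setoid V')
    (A : Set (Config K)) :
    rcProb p q (ξ.comap f) A = rcProb p q ξ (pullConfig f ⁻¹' A) := by
  classical
  let e : Config K' ≃ Config K := f.mapEdgeSet.symm.arrowCongr (Equiv.refl Bool)
  have he : ∀ ω, e ω = pullConfig f ω := fun ω => rfl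
  rw [rcProb_eq_indicator, rcProb_eq_indicator, ← e.sum_comp, ← e.sum_comp]
  simp_rw [he, rcWeight_pullConfig]
  congr 1
  refine Finset.sum_congr rfl fun ω _ => ?_
  by_cases h : pullConfig f ω ∈ A
  · rw [Set.indicator_of_mem h, Set.indicator_of_mem (show ω ∈ pullConfig f ⁻¹' A from h),
      rcWeight_pullConfig]
  · rw [Set.indicator_of_notMem h, Set.indicator_of_notMem (show ω ∉ pullConfig f ⁻¹' A from h)]

theorem connIn_pullConfig (f : K ≃g K') (ω : Config K') {D : Set V'} {x y : V} :
    ConnIn (openGraph (pullConfig f ω)) (f ⁻¹' D) x y ↔ ConnIn (openGraph ω) D (f x) (f y) := by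
  constructor
  · rintro ⟨hx, h⟩
    exact ⟨hx, Relation.ReflTransGen.lift f
      (fun a b hab => ⟨(openGraph_pullConfig_adj f ω).1 hab.1, hab.2⟩) _ _ h⟩
  · rintro ⟨hx, h⟩
    refine ⟨hx, ?_⟩
    have h2 := Relation.ReflTransGen.lift (p := fun a b =>
      (openGraph (pullConfig f ω)).Adj a b ∧ b ∈ f ⁻¹' D) f.symm (fun a b hab => ?_) _ _ h
    · simpa [Function.onFun] using h2
    · refine ⟨(openGraph_pullConfig_adj f ω).2 (by simpa using hab.1), ?_⟩
      simpa using hab.2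

theorem connSets_pullConfig (f : K ≃g K') (ω : Config K') {D A B : Set V'} :
    ConnSets (openGraph (pullConfig f ω)) (f ⁻¹' D) (f ⁻¹' A) (f ⁻¹' B) ↔
      ConnSets (openGraph ω) D A B := by
  constructor
  · rintro ⟨a, ha, b, hb, h⟩
    exact ⟨f a, ha, f b, hb, (connIn_pullConfig f ω).1 h⟩
  · rintro ⟨a, ha, b, hb, h⟩
    refine ⟨f.symm a, by simpa using ha, f.symm b, by simpa using hb, ?_⟩
    rw [connIn_pullConfig]
    simpa using h

end Transport

section Automorphism
variable {W : Type*} {H : SimpleGraph W}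

theorem extendClosed_eq_true {Λ : Finset W} {ω : Config (H.induce (Λ : Set W))} {e : H.edgeSet} :
    extendClosed H Λ ω e = true ↔
      ∃ f : (H.induce (Λ : Set W)).edgeSet, f.1.map Subtype.val = e.1 ∧ ω f = true := by
  simp [extendClosed]

theorem openGraph_extendClosed_adj {Λ : Finset W} {ω : Config (H.induce (Λ : Set W))} {x y : W} :
    (openGraph (extendClosed H Λ ω)).Adj x y ↔
      ∃ (hx : x ∈ Λ) (hy : y ∈ Λ), (openGraph ω).Adj ⟨x, hx⟩ ⟨y, hy⟩ := by
  constructor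
  · rintro ⟨h, hω⟩
    obtain ⟨⟨f, hf⟩, hfe, hω'⟩ := extendClosed_eq_true.1 hω
    induction f with
    | _ a b =>
      have h2 : s(a.1, b.1) = s(x, y) := hfe
      rcases Sym2.eq_iff.1 h2 with ⟨rfl, rfl⟩ | ⟨rfl, rfl⟩
      · exact ⟨a.2, b.2, hf, hω'⟩
      · exact ⟨b.2, a.2, SimpleGraph.Adj.symm ⟨hf, hω'⟩⟩
  · rintro ⟨hx, hy, h, hω⟩
    exact ⟨h, extendClosed_eq_true.2 ⟨⟨_, h⟩, rfl, hω⟩⟩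

theorem config_ext_openGraph {ω ω' : Config H}
    (h : ∀ x y, (openGraph ω).Adj x y ↔ (openGraph ω').Adj x y) : ω = ω' := by
  funext ⟨e, he⟩
  induction e with
  | _ x y =>
    rw [Bool.eq_iff_iff]
    exact ⟨fun h2 => ((h x y).1 ⟨he, h2⟩).2, fun h2 => ((h x y).2 ⟨he, h2⟩).2⟩

theorem DeterminedBy.preimage_pullConfig {F : Finset H.edgeSet} {A : Set (Config H)}
    (h : DeterminedBy (F : Set H.edgeSet) A) (σ : H ≃g H) :
    DeterminedBy (F.map σ.mapEdgeSet.toEmbedding : Set H.edgeSet) (pullConfig σ ⁻¹' A) := by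
  intro ω ω' hω hA
  refine h _ _ (fun e he => hω _ ?_) hA
  exact Finset.mem_coe.2 (Finset.mem_map_of_mem _ he)

theorem measurable_pullConfig (σ : H ≃g H) : Measurable (pullConfig σ) :=
  measurable_pi_lambda _ fun _ => measurable_pi_apply _

/-- An automorphism carries the approximating volumes and boundary conditions to others that are
equally admissible. -/
theorem IsInfiniteVolume.map_pullConfig {p q : ℝ} (h0 : 0 ≤ p) (h1 : p ≤ 1) (hq : 0 < q)
    {μ : Measure (Config H)} (h : IsInfiniteVolume H p q μ) (σ : H ≃g H) :
    IsInfiniteVolume H p q (μ.map (pullConfig σ)) := by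
  rw [isInfiniteVolume_iff h0 h1 hq] at h ⊢
  obtain ⟨hμ, Λ, ξ, ⟨hΛ, hex, hξ⟩, hlim⟩ := h
  refine ⟨Measure.isProbabilityMeasure_map (measurable_pullConfig σ).aemeasurable, ?_⟩
  let Λ' : ℕ → Finset W := fun k => (Λ k).map σ.symm.toEquiv.toEmbedding
  have hΛ' : ∀ k x, x ∈ Λ' k ↔ σ x ∈ Λ k := by
    intro k x
    simp only [Λ', Finset.mem_map]
    constructor
    · rintro ⟨a, ha, rfl⟩
      simpa using ha
    · exact fun h => ⟨σ x, h, by simp⟩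
  let f : ∀ k, H.induce (Λ' k : Set W) ≃g H.induce (Λ k : Set W) := fun k =>
    ⟨σ.toEquiv.subtypeEquiv fun x => hΛ' k x, σ.map_adj_iff⟩
  refine ⟨Λ', fun k => (ξ k).comap (f k), ⟨fun k l hkl => ?_, fun x => ?_, fun k x y hxy => ?_⟩,
    fun F A hA => ?_⟩
  · exact Finset.map_subset_map.2 (hΛ hkl)
  · obtain ⟨k, hk⟩ := hex (σ x)
    exact ⟨k, (hΛ' k x).2 hk⟩
  · have hout : ∀ x : (Λ' k : Set W), (∃ z ∉ Λ k, H.Adj (f k x) z) → ∃ z ∉ Λ' k, H.Adj x z := by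
      rintro x ⟨z, hz, hxz⟩
      refine ⟨σ.symm z, by simpa [hΛ'] using hz, ?_⟩
      rw [← σ.map_adj_iff, σ.apply_symm_apply]
      exact hxz
    exact (hξ k _ _ hxy).imp (fun h => (f k).injective h) fun h => ⟨hout x h.1, hout y h.2⟩
  · rw [measureReal_def, Measure.map_apply (measurable_pullConfig σ) hA.measurableSet,
      ← measureReal_def]
    refine (hlim _ _ (hA.preimage_pullConfig σ)).congr fun k => ?_
    rw [rcProb_pullConfig (f k)]
    congr 1
    ext ω
    have h2 : pullConfig σ (extendClosed H (Λ k) ω) =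
        extendClosed H (Λ' k) (pullConfig (f k) ω) := by
      refine config_ext_openGraph fun x y => ?_
      rw [openGraph_pullConfig_adj, openGraph_extendClosed_adj, openGraph_extendClosed_adj]
      constructor
      · rintro ⟨hx, hy, h⟩
        exact ⟨(hΛ' k x).2 hx, (hΛ' k y).2 hy, (openGraph_pullConfig_adj (f k) ω).2 h⟩
      · rintro ⟨hx, hy, h⟩
        exact ⟨(hΛ' k x).1 hx, (hΛ' k y).1 hy, (openGraph_pullConfig_adj (f k) ω).1 h⟩
    rw [Set.mem_preimage, Set.mem_preimage, Set.mem_preimage, Set.mem_preimage, h2]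

/-- The image of `φ` under an automorphism is again an infinite-volume measure, so uniqueness forces
invariance. -/
theorem IsUniqueInfiniteVolume.measureReal_pullConfig {p q : ℝ} (h0 : 0 ≤ p) (h1 : p ≤ 1)
    (hq : 0 < q) {φ : Measure (Config H)} (h : IsUniqueInfiniteVolume H p q φ) (σ : H ≃g H)
    {F : Finset H.edgeSet} {A : Set (Config H)} (hA : DeterminedBy (F : Set H.edgeSet) A) :
    φ.real (pullConfig σ ⁻¹' A) = φ.real A := by
  conv_rhs => rw [← h.2 _ (h.1.map_pullConfig h0 h1 hq σ)]
  rw [measureReal_def, measureReal_def,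
    Measure.map_apply (measurable_pullConfig σ) hA.measurableSet]

end Automorphism

/-! ### Local events -/

/-- The event that `A` and `B` are connected by an open path in `D`. -/
def connEvent {W : Type*} (H : SimpleGraph W) (D A B : Set W) : Set (Config H) :=
  {ω | ConnSets (openGraph ω) D A B}

/-- Events that depend on finitely many edges. -/
def IsLocal {ι : Type*} (A : Set (ι → Bool)) : Prop := ∃ F : Finset ι, DeterminedBy (F : Set ι) A

/-- The edges with both end points in `D`. -/
def edgesIn {W : Type*} (H : SimpleGraph W) (D : Set W) : Set H.edgeSet := {e | ∀ x ∈ e.1, x ∈ D}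

namespace IsLocal
variable {ι : Type*} {A B : Set (ι → Bool)}

theorem of_finite {F : Set ι} (hF : F.Finite) (h : DeterminedBy F A) : IsLocal A :=
  ⟨hF.toFinset, by rwa [hF.coe_toFinset]⟩

theorem measurableSet (h : IsLocal A) : MeasurableSet A := h.choose_spec.measurableSet

theorem compl (h : IsLocal A) : IsLocal Aᶜ := ⟨h.choose, h.choose_spec.compl⟩

theorem inter (h : IsLocal A) (h' : IsLocal B) : IsLocal (A ∩ B) := by
  classical
  exact ⟨h.choose ∪ h'.choose, (h.choose_spec.mono (by simp)).inter (h'.choose_spec.mono (by simp))⟩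

theorem diff (h : IsLocal A) (h' : IsLocal B) : IsLocal (A \ B) := h.inter h'.compl

end IsLocal

section ConnEvent
variable {W : Type*} {H : SimpleGraph W} {D A B : Set W}

theorem edgesIn_finite (hD : D.Finite) : (edgesIn H D).Finite := by
  have h : (edgesIn H D) ⊆ Subtype.val ⁻¹' ((fun p : W × W => s(p.1, p.2)) '' (D ×ˢ D)) := by
    rintro ⟨e, he⟩ hD
    induction e with
    | _ x y => exact ⟨(x, y), ⟨hD x (by simp), hD y (by simp)⟩, rfl⟩
  exact (((hD.prod hD).image _).preimage Subtype.val_injective.injOn).subset h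

theorem edgesIn_disjoint {D' : Set W} (h : Disjoint D D') :
    Disjoint (edgesIn H D) (edgesIn H D') := by
  rw [Set.disjoint_left] at h ⊢
  rintro ⟨e, he⟩ h1 h2
  induction e with
  | _ x y => exact h (h1 x (by simp)) (h2 x (by simp))

theorem isUpperSet_connEvent : IsUpperSet (connEvent H D A B) :=
  fun _ _ h hω => hω.mono (fun _ _ _ _ huv => openGraph_mono h huv) le_rfl
    Set.inter_subset_left Set.inter_subset_left

theorem determinedBy_connEvent : DeterminedBy (edgesIn H D) (connEvent H D A B) := by
  refine fun ω ω' h hω => hω.mono (fun u v hu hv huv => ?_) le_rfl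
    Set.inter_subset_left Set.inter_subset_left
  refine ⟨huv.1, ?_⟩
  rw [← h]
  · exact huv.2
  · intro x hx
    rcases Sym2.mem_iff.1 hx with rfl | rfl
    · exact hu
    · exact hv

theorem isLocal_connEvent (hD : D.Finite) : IsLocal (connEvent H D A B) :=
  .of_finite (edgesIn_finite hD) determinedBy_connEvent

theorem connEvent_symm : connEvent H D A B = connEvent H D B A :=
  Set.ext fun _ => ⟨ConnSets.symm, ConnSets.symm⟩

theorem connEvent_mono {D' A' B' : Set W} (hD : D ⊆ D') (hA : A ∩ D ⊆ A') (hB : B ∩ D ⊆ B') :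
    connEvent H D A B ⊆ connEvent H D' A' B' :=
  fun _ h => h.mono (fun _ _ _ _ h => h) hD hA hB

end ConnEvent

/-! ### Inequalities in infinite volume -/

section Limits
variable {W : Type*} {H : SimpleGraph W}

theorem IsExhaustion.eventually_subset {Λ : ℕ → Finset W} {ξ : ∀ k, Setoid (Λ k : Set W)}
    (h : IsExhaustion H Λ ξ) {D : Set W} (hD : D.Finite) : ∀ᶠ k in atTop, D ⊆ Λ k := by
  have : ∀ x ∈ D, ∀ᶠ k in atTop, x ∈ Λ k := fun x _ => by
    obtain ⟨k, hk⟩ := h.2.1 x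
    exact eventually_atTop.2 ⟨k, fun l hl => h.1 hl hk⟩
  exact (eventually_all_finite hD).2 this

theorem monotone_extendClosed (Λ : Finset W) : Monotone (extendClosed H Λ) := by
  intro ω ω' h e
  rw [Bool.le_iff_imp]
  intro he
  obtain ⟨f, hf, hω⟩ := extendClosed_eq_true.1 he
  exact extendClosed_eq_true.2 ⟨f, hf, (Bool.le_iff_imp.1 (h f)) hω⟩

theorem isUpperSet_preimage_extendClosed {A : Set (Config H)} (hA : IsUpperSet A) (Λ : Finset W) :
    IsUpperSet (extendClosed H Λ ⁻¹' A) :=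
  fun _ _ h hω => hA (monotone_extendClosed Λ h) hω

/-- The edge of `H` corresponding to an edge of an induced subgraph. -/
def liftEdge (Λ : Set W) (f : (H.induce Λ).edgeSet) : H.edgeSet :=
  ⟨f.1.map Subtype.val, by
    obtain ⟨f, hf⟩ := f
    induction f with
    | _ a b => exact hf⟩

theorem liftEdge_injective (Λ : Set W) : Function.Injective (liftEdge (H := H) Λ) :=
  fun _ _ h => Subtype.ext (Sym2.map.injective Subtype.val_injective (Subtype.ext_iff.1 h))

theorem extendClosed_liftEdge {Λ : Finset W} (ω : Config (H.induce (Λ : Set W)))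
    (f : (H.induce (Λ : Set W)).edgeSet) : extendClosed H Λ ω (liftEdge _ f) = ω f := by
  rw [Bool.eq_iff_iff, extendClosed_eq_true]
  constructor
  · rintro ⟨g, hg, hω⟩
    rwa [← liftEdge_injective (H := H) _ (Subtype.ext hg : liftEdge _ g = liftEdge _ f)]
  · exact fun h => ⟨f, rfl, h⟩

theorem exists_liftEdge_eq {Λ : Set W} {e : H.edgeSet} (he : e ∈ edgesIn H Λ) :
    ∃ f, liftEdge Λ f = e := by
  obtain ⟨e, h⟩ := e
  induction e with
  | _ x y => exact ⟨⟨s(⟨x, he x (by simp)⟩, ⟨y, he y (by simp)⟩), h⟩, rfl⟩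

theorem determinedBy_preimage_extendClosed {A : Set (Config H)} {F : Set H.edgeSet}
    (hA : DeterminedBy F A) (Λ : Finset W) :
    DeterminedBy (liftEdge (Λ : Set W) ⁻¹' F) (extendClosed H Λ ⁻¹' A) := by
  intro ω ω' h hω
  refine hA _ _ (fun e he => ?_) hω
  rw [Bool.eq_iff_iff, extendClosed_eq_true, extendClosed_eq_true]
  constructor
  · rintro ⟨f, hf, hω⟩
    refine ⟨f, hf, ?_⟩
    rwa [← h]
    rwa [Set.mem_preimage, show liftEdge _ f = e from Subtype.ext hf]
  · rintro ⟨f, hf, hω⟩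
    refine ⟨f, hf, ?_⟩
    rwa [h]
    rwa [Set.mem_preimage, show liftEdge _ f = e from Subtype.ext hf]

variable {p p' q : ℝ} {Λ : ℕ → Finset W} {ξ : ∀ k, Setoid (Λ k : Set W)} {φ φ' : Measure (Config H)}

/-- The FKG inequality. -/
theorem LocalLimit.mul_le (hlim : LocalLimit p q Λ ξ φ) (h0 : 0 ≤ p) (h1 : p ≤ 1) (hq : 1 ≤ q)
    {A B : Set (Config H)} (hA : IsLocal A) (hB : IsLocal B) (hA' : IsUpperSet A)
    (hB' : IsUpperSet B) : φ.real A * φ.real B ≤ φ.real (A ∩ B) := by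
  obtain ⟨F, hF⟩ := hA
  obtain ⟨F', hF'⟩ := hB
  obtain ⟨F'', hF''⟩ := IsLocal.inter ⟨F, hF⟩ ⟨F', hF'⟩
  refine le_of_tendsto_of_tendsto' ((hlim F A hF).mul (hlim F' B hF')) (hlim F'' _ hF'')
    fun k => ?_
  rw [Set.preimage_inter]
  exact rcProb_inter_le h0 h1 hq (isUpperSet_preimage_extendClosed hA' _)
    (isUpperSet_preimage_extendClosed hB' _)

/-- Comparison of two edge parameters by means of disjointly supported events that imply `A`. -/
theorem LocalLimit.compl_le_exp [IsProbabilityMeasure φ] [IsProbabilityMeasure φ']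
    (hlim : LocalLimit p q Λ ξ φ) (hlim' : LocalLimit p' q Λ ξ φ') (h0 : 0 ≤ p) (hpp : p < p')
    (h1 : p' ≤ 1) (hq : 1 ≤ q) {A : Set (Config H)} (hA : IsLocal A) (hA' : IsUpperSet A)
    {ι : Type*} (s : Finset ι) (B : ι → Set (Config H)) (F : ι → Set H.edgeSet)
    (hF : ∀ i ∈ s, ∀ j ∈ s, i ≠ j → Disjoint (F i) (F j)) (hFfin : ∀ i ∈ s, (F i).Finite)
    (hB : ∀ i ∈ s, DeterminedBy (F i) (B i)) (hB' : ∀ i ∈ s, IsUpperSet (B i))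
    (hBA : ∀ i ∈ s, B i ⊆ A) :
    φ'.real Aᶜ ≤ φ.real Aᶜ * Real.exp (-(4 * (p' - p) * ∑ i ∈ s, φ.real (B i))) := by
  obtain ⟨FA, hFA⟩ := hA.compl
  have hBlim : Tendsto (fun k => ∑ i ∈ s, rcProb (H := H.induce (Λ k : Set W)) p q (ξ k)
      (extendClosed H (Λ k) ⁻¹' B i)) atTop (𝓝 (∑ i ∈ s, φ.real (B i))) := by
    refine tendsto_finsetSum _ fun i hi => ?_
    obtain ⟨F', hF'⟩ := IsLocal.of_finite (hFfin i hi) (hB i hi)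
    exact hlim F' _ hF'
  refine le_of_tendsto_of_tendsto' (hlim' FA _ hFA) ((hlim FA _ hFA).mul
    ((Real.continuous_exp.tendsto _).comp (hBlim.const_mul (4 * (p' - p))).neg)) fun k => ?_
  have h2 := rcProb_compl_le h0 hpp h1 hq (ξ k)
    (isUpperSet_preimage_extendClosed hA' (Λ k))
    (f := fun ω => ∑ i ∈ s, (extendClosed H (Λ k) ⁻¹' B i).indicator 1 ω)
    (fun ω ω' h => Finset.sum_le_sum fun i hi =>
      monotone_indicator_one (isUpperSet_preimage_extendClosed (hB' i hi) _) h)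
    (monotone_ncard_sub_sum_indicator s _ (fun i => liftEdge (Λ k : Set W) ⁻¹' F i)
      (fun i hi j hj hij => (hF i hi j hj hij).preimage _)
      fun i hi => determinedBy_preimage_extendClosed (hB i hi) _)
    (fun ω hω => Finset.sum_eq_zero fun i hi => Set.indicator_of_notMem
      (fun h : ω ∈ extendClosed H (Λ k) ⁻¹' B i => hω (hBA i hi h)) _)
  rw [rcMean_sum] at h2
  simp_rw [← rcProb_eq_rcMean] at h2
  exact h2

theorem connIn_extendClosed {Λ : Finset W} {ω : Config (H.induce (Λ : Set W))} {D : Set W}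
    {x y : (Λ : Set W)} :
    ConnIn (openGraph (extendClosed H Λ ω)) D x y ↔
      ConnIn (openGraph ω) (Subtype.val ⁻¹' D) x y := by
  constructor
  · rintro ⟨hx, h⟩
    have : ∀ z, Relation.ReflTransGen
        (fun a b => (openGraph (extendClosed H Λ ω)).Adj a b ∧ b ∈ D) x z → ∀ hz : z ∈ (Λ : Set W),
        ConnIn (openGraph ω) (Subtype.val ⁻¹' D) x ⟨z, hz⟩ := by
      intro z hz
      induction hz with
      | refl => exact fun hz => ConnIn.refl hx
      | tail _ h2 ih =>
        intro hz
        obtain ⟨hb, hc, h3⟩ := openGraph_extendClosed_adj.1 h2.1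
        exact (ih hb).tail h3 h2.2
    exact this y h y.2
  · rintro ⟨hx, h⟩
    refine ⟨hx, Relation.ReflTransGen.lift Subtype.val (fun a b hab => ?_) _ _ h⟩
    exact ⟨openGraph_extendClosed_adj.2 ⟨a.2, b.2, hab.1⟩, hab.2⟩

theorem connSets_extendClosed {Λ : Finset W} {ω : Config (H.induce (Λ : Set W))} {D A B : Set W}
    (hD : D ⊆ Λ) : ConnSets (openGraph (extendClosed H Λ ω)) D A B ↔
      ConnSets (openGraph ω) (Subtype.val ⁻¹' D) (Subtype.val ⁻¹' A) (Subtype.val ⁻¹' B) := by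
  constructor
  · rintro ⟨a, ha, b, hb, h⟩
    exact ⟨⟨a, hD h.left_mem⟩, ha, ⟨b, hD h.right_mem⟩, hb, connIn_extendClosed.1 h⟩
  · rintro ⟨a, ha, b, hb, h⟩
    exact ⟨a, ha, b, hb, connIn_extendClosed.2 h⟩

theorem connIn_induce {Λ D : Set W} {x y : Λ}
    (h : ConnIn (H.induce Λ) (Subtype.val ⁻¹' D) x y) : ConnIn H D x y :=
  ⟨h.1, Relation.ReflTransGen.lift Subtype.val (fun _ _ hab => ⟨hab.1, hab.2⟩) _ _ h.2⟩

theorem connIn_induce_of {Λ D : Set W} (hD : D ⊆ Λ) {x y : Λ} (h : ConnIn H D x y) :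
    ConnIn (H.induce Λ) (Subtype.val ⁻¹' D) x y := by
  obtain ⟨hx, h⟩ := h
  have : ∀ z, Relation.ReflTransGen (fun a b => H.Adj a b ∧ b ∈ D) x z → ∀ hz : z ∈ Λ,
      ConnIn (H.induce Λ) (Subtype.val ⁻¹' D) x ⟨z, hz⟩ := by
    intro z hz
    induction hz with
    | refl => exact fun hz => ConnIn.refl hx
    | @tail b c h1 h2 ih =>
      intro hz
      have hb : b ∈ Λ := by
        rcases Relation.ReflTransGen.cases_tail h1 with h | ⟨_, _, h⟩
        · rw [h]; exact x.2
        · exact hD h.2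
      exact (ih hb).tail (show (H.induce Λ).Adj ⟨b, hb⟩ ⟨c, hz⟩ from h2.1) h2.2
  exact this y h y.2

theorem ncard_le_of_encard_le {α : Type*} {s : Set α} {d : ℕ} (h : s.encard ≤ d) : s.ncard ≤ d :=
  ENat.toNat_le_of_le_natCast h

theorem encard_preimage_le {α β : Type*} {f : α → β} (hf : Function.Injective f) (s : Set β) :
    (f ⁻¹' s).encard ≤ s.encard := by
  rw [← hf.encard_image]
  exact Set.encard_le_encard (Set.image_preimage_subset f s)

/-- Gluing of paths in infinite volume. -/
theorem LocalLimit.gluing [IsProbabilityMeasure φ] (hlim : LocalLimit p q Λ ξ φ)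
    (hΛ : IsExhaustion H Λ ξ) (h0 : 0 < p) (h1 : p < 1) (hq : 1 ≤ q) {r : ℝ} (hr : 1 / p ≤ r)
    (hr' : 1 / (1 - p) ≤ r) {C : Type*} (col : W → C) {d L : ℕ} (hL : 1 ≤ L)
    (hd : ∀ z, {e : H.edgeSet | ∃ x ∈ e.1, col x = z}.encard ≤ d)
    (hd' : ∀ z, {v | col v = z}.encard ≤ d) (hdeg : ∀ u, {v | H.Adj u v}.encard ≤ L)
    {D A A' B B' : Set W} (hD : D.Finite)
    (hcol : ∀ u ∈ D, ∀ v ∈ D, col u = col v → ConnIn H {x | x ∈ D ∧ col x = col u} u v)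
    (hA : ∀ a ∈ A, ∀ v ∈ D, col v = col a → v ∈ A) (hBB : Disjoint B B')
    (hlink : ∀ P Q : Set W, P ⊆ D → Q ⊆ D → ConnSets H P A A' → ConnSets H Q B B' →
      ∃ x ∈ P, ∃ y ∈ Q, col x = col y) (s : ℕ) :
    φ.real (connEvent H D A A' \ connEvent H D A B) ≤
      ((2 * (r * q)) ^ d) ^ s * φ.real (connEvent H D B B')ᶜ +
        (1 + 1 / (2 * L * (r * q)) ^ d)⁻¹ ^ s := by
  classical
  have hloc : ∀ {A B : Set W}, IsLocal (connEvent H D A B) := isLocal_connEvent hD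
  obtain ⟨F₁, hF₁⟩ := (hloc (A := A) (B := A')).diff (hloc (A := A) (B := B))
  obtain ⟨F₂, hF₂⟩ := (hloc (A := B) (B := B')).compl
  refine le_of_tendsto_of_tendsto (hlim _ _ hF₁) (((hlim _ _ hF₂).const_mul _).add_const _) ?_
  -- As soon as the finite volume contains `D`, all connections in question take place inside it,
  -- and the constants do not depend on the volume or the boundary condition.
  filter_upwards [hΛ.eventually_subset hD] with k hk
  have hZ := sum_rcWeight_pos (H := H.induce (Λ k : Set W)) (q := q) h0.le h1.le (by linarith) (ξ k)
  have hr1 : 1 ≤ r := le_trans (by rw [le_div_iff₀ h0]; linarith) hr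
  have hval : Function.Injective (Subtype.val : ↥(Λ k : Set W) → W) := Subtype.val_injective
  have key := Gluing.sum_indicator_le (H := H.induce (Λ k : Set W)) (rcWeight p q (ξ k))
    (rcWeight_nonneg h0.le h1.le (by linarith) (ξ k)) (R := r * q) (by nlinarith)
    (rcWeight_le h0 h1 hq hr hr' (ξ k)) (fun x => col x) hL (d := d)
    (fun z => ncard_le_of_encard_le (((Set.encard_le_encard fun f hf => ?_).trans
      (encard_preimage_le (liftEdge_injective _) _)).trans (hd z)))
    (fun z => ncard_le_of_encard_le ((encard_preimage_le hval {v | col v = z}).trans (hd' z)))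
    (fun u => ncard_le_of_encard_le ((encard_preimage_le hval {v | H.Adj u v}).trans (hdeg u)))
    (D := Subtype.val ⁻¹' D) (A := Subtype.val ⁻¹' A) (A' := Subtype.val ⁻¹' A')
    (B := Subtype.val ⁻¹' B) (B' := Subtype.val ⁻¹' B')
    (fun u hu v hv huv => connIn_induce_of (fun x hx => hk hx.1) (hcol u hu v hv huv))
    (fun a ha v hv hav => hA a ha v hv hav) (hBB.preimage _)
    (fun P Q hP hQ hPA hQB => ?_) s
  · have h1 : extendClosed H (Λ k) ⁻¹' (connEvent H D A A' \ connEvent H D A B) =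
        {ω | ConnSets (openGraph ω) (Subtype.val ⁻¹' D) (Subtype.val ⁻¹' A) (Subtype.val ⁻¹' A') ∧
          ¬ ConnSets (openGraph ω) (Subtype.val ⁻¹' D) (Subtype.val ⁻¹' A)
            (Subtype.val ⁻¹' B)} := by
      ext ω
      exact and_congr (connSets_extendClosed hk) (connSets_extendClosed hk).not
    have h2 : extendClosed H (Λ k) ⁻¹' (connEvent H D B B')ᶜ =
        {ω | ¬ ConnSets (openGraph ω) (Subtype.val ⁻¹' D) (Subtype.val ⁻¹' B)
          (Subtype.val ⁻¹' B')} := by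
      ext ω
      exact (connSets_extendClosed hk).not
    rw [h1, h2, rcProb_eq_indicator, rcProb_eq_indicator, div_le_iff₀ hZ]
    refine key.trans_eq ?_
    field_simp
  · obtain ⟨x, hx, hxz⟩ := hf
    refine ⟨x, ?_, hxz⟩
    exact Sym2.mem_map.2 ⟨x, hx, rfl⟩
  · have himg : ∀ {P : Set (Λ k : Set W)} {A A' : Set W}, ConnSets (H.induce (Λ k : Set W)) P
        (Subtype.val ⁻¹' A) (Subtype.val ⁻¹' A') → ConnSets H (Subtype.val '' P) A A' := by
      rintro P A A' ⟨a, ha, b, hb, h⟩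
      exact ⟨a, ha, b, hb, connIn_induce (by rwa [Set.preimage_image_eq _ hval])⟩
    obtain ⟨-, ⟨x, hx, rfl⟩, -, ⟨y, hy, rfl⟩, hxy⟩ := hlink _ _
      (Set.image_subset_iff.2 hP) (Set.image_subset_iff.2 hQ) (himg hPA) (himg hQB)
    exact ⟨x, hx, y, hy, hxy⟩

end Limits

/-! ### Independent edges -/

/-- The law of a single edge that is open with probability `p`. -/
noncomputable def coin (p : unitInterval) : Measure Bool :=
  ENNReal.ofReal p • Measure.dirac true + ENNReal.ofReal (1 - p) • Measure.dirac false

instance (p : unitInterval) : IsProbabilityMeasure (coin p) := by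
  constructor
  simp only [coin, Measure.add_apply, Measure.smul_apply, measure_univ, smul_eq_mul, mul_one]
  rw [← ENNReal.ofReal_add p.2.1 (by linarith [p.2.2])]
  simp

theorem coin_real (p : unitInterval) (b : Bool) :
    (coin p).real {b} = bif b then (p : ℝ) else 1 - p := by
  have h1 : (0 : ℝ) ≤ 1 - p := by linarith [p.2.2]
  cases b
  · simp [coin, measureReal_def, h1]
  · simp [coin, measureReal_def, p.2.1]

/-- The law of independent edges. -/
noncomputable def edgeLaw (ι : Type*) (p : unitInterval) : Measure (ι → Bool) :=
  Measure.infinitePi fun _ => coin p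

instance (ι : Type*) (p : unitInterval) : IsProbabilityMeasure (edgeLaw ι p) := by
  unfold edgeLaw; infer_instance

section Bernoulli
variable {ι : Type*} {p : unitInterval}

theorem edgeLaw_real_pi (F : Finset ι) (t : ι → Set Bool) :
    (edgeLaw ι p).real (Set.pi F t) = ∏ i ∈ F, (coin p).real (t i) := by
  rw [edgeLaw, measureReal_def, Measure.infinitePi_pi (μ := fun _ : ι => coin p) (s := F) (t := t)
    fun i _ => (Set.toFinite _).measurableSet, ENNReal.toReal_prod]
  rfl

theorem edgeLaw_all_open (F : Finset ι) :
    (edgeLaw ι p).real {ω | ∀ e ∈ F, ω e = true} = (p : ℝ) ^ F.card := by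
  have : {ω : ι → Bool | ∀ e ∈ F, ω e = true} = Set.pi F fun _ => {true} := by ext; simp
  rw [this, edgeLaw_real_pi]
  simp [coin_real]

theorem edgeLaw_all_closed (F : Finset ι) :
    (edgeLaw ι p).real {ω | ∀ e ∈ F, ω e = false} = (1 - p : ℝ) ^ F.card := by
  have : {ω : ι → Bool | ∀ e ∈ F, ω e = false} = Set.pi F fun _ => {false} := by ext; simp
  rw [this, edgeLaw_real_pi]
  simp [coin_real]

theorem edgeLaw_exists_closed_le (F : Finset ι) :
    (edgeLaw ι p).real {ω | ∃ e ∈ F, ω e = false} ≤ F.card * (1 - p : ℝ) := by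
  have : {ω : ι → Bool | ∃ e ∈ F, ω e = false} = ⋃ e ∈ F, {ω | ∀ e' ∈ ({e} : Finset ι), ω e' = false} := by
    ext; simp
  rw [this]
  refine (measureReal_biUnion_finset_le _ _).trans ?_
  simp only [edgeLaw_all_closed, Finset.card_singleton, pow_one, Finset.sum_const, nsmul_eq_mul]
  exact le_rfl

theorem edgeLaw_preimage {κ : Type*} {f : κ → ι} (hf : Function.Injective f)
    {A : Set (κ → Bool)} (hA : MeasurableSet A) :
    (edgeLaw ι p).real ((fun ω i => ω (f i)) ⁻¹' A) = (edgeLaw κ p).real A := by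
  have h := Measure.map_infinitePi_infinitePi_of_inj (P := fun _ : ι => coin p) hf
  change (edgeLaw ι p).map (fun ω i => ω (f i)) = edgeLaw κ p at h
  rw [← h, measureReal_def, measureReal_def, Measure.map_apply (by fun_prop) hA]

theorem edgeLaw_inter {F F' : Set ι} (hF : F.Finite) (hF' : F'.Finite) (hFF : Disjoint F F')
    {A B : Set (ι → Bool)} (hA : DeterminedBy F A) (hB : DeterminedBy F' B) :
    (edgeLaw ι p).real (A ∩ B) = (edgeLaw ι p).real A * (edgeLaw ι p).real B := by
  lift F to Finset ι using hF
  lift F' to Finset ι using hF'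
  have h := ProbabilityTheory.iIndepFun_infinitePi (P := fun _ : ι => coin p)
    (X := fun _ b => b) (fun _ => measurable_id)
  have h2 := h.indepFun_finset F F' (by exact_mod_cast hFF) fun _ => measurable_pi_apply _
  rw [hA.eq_preimage_restrict, hB.eq_preimage_restrict, measureReal_def, measureReal_def,
    measureReal_def, ← ENNReal.toReal_mul]
  congr 1
  exact h2.measure_inter_preimage_eq_mul _ _ (Set.toFinite _).measurableSet
    (Set.toFinite _).measurableSet

end Bernoulli

section Domination
variable {W : Type*} {H : SimpleGraph W}

theorem edgeLaw_eq_sum_edgeWeight (p : unitInterval) (Λ : Finset W)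
    [Fintype (Config (H.induce (Λ : Set W)))] {A : Set (Config H)}
    (hA : DeterminedBy (edgesIn H (Λ : Set W)) A) :
    (edgeLaw H.edgeSet p).real A =
      ∑ ω, (extendClosed H Λ ⁻¹' A).indicator (edgeWeight (p : ℝ)) ω := by
  classical
  have hpre : A = (fun (ω : Config H) f => ω (liftEdge (Λ : Set W) f)) ⁻¹'
      (extendClosed H Λ ⁻¹' A) := by
    ext ω
    refine hA.mem_iff fun e he => ?_
    obtain ⟨f, rfl⟩ := exists_liftEdge_eq he
    rw [extendClosed_liftEdge]
  have hone : ∀ ω : Config (H.induce (Λ : Set W)),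
      (edgeLaw (H.induce (Λ : Set W)).edgeSet p).real {ω} = edgeWeight (p : ℝ) ω := by
    intro ω
    have : ({ω} : Set (Config (H.induce (Λ : Set W)))) =
        Set.pi (Finset.univ : Finset (H.induce (Λ : Set W)).edgeSet) fun e => {ω e} := by
      ext; simp [funext_iff]
    rw [this, edgeLaw_real_pi]
    simp_rw [coin_real]
    exact Finset.prod_congr (by ext; simp) fun _ _ => rfl
  conv_lhs => rw [hpre]
  rw [edgeLaw_preimage (liftEdge_injective _) (Set.toFinite _).measurableSet]
  have hset : extendClosed H Λ ⁻¹' A = ((Finset.univ.filter fun ω => extendClosed H Λ ω ∈ A :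
      Finset (Config (H.induce (Λ : Set W)))) : Set _) := by
    ext; simp
  conv_lhs => rw [hset, ← sum_measureReal_singleton]
  rw [Finset.sum_filter]
  refine Finset.sum_congr rfl fun ω _ => ?_
  rw [hone, Set.indicator_apply]
  rfl

variable {p q : ℝ} {Λ : ℕ → Finset W} {ξ : ∀ k, Setoid (Λ k : Set W)} {φ : Measure (Config H)}

theorem edgesIn_eventually (hΛ : IsExhaustion H Λ ξ) (F : Finset H.edgeSet) :
    ∀ᶠ k in atTop, (F : Set H.edgeSet) ⊆ edgesIn H (Λ k : Set W) := by
  have hfin : (⋃ e ∈ F, {x | x ∈ e.1}).Finite := by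
    refine Set.Finite.biUnion F.finite_toSet fun e _ => ?_
    obtain ⟨e, he⟩ := e
    induction e with
    | _ x y => exact (Set.toFinite {x, y}).subset fun z hz => by simpa using hz
  filter_upwards [hΛ.eventually_subset hfin] with k hk e he x hx
  exact hk (Set.mem_biUnion he hx)

theorem LocalLimit.le_edgeLaw (hlim : LocalLimit p q Λ ξ φ) (hΛ : IsExhaustion H Λ ξ)
    (hp : p ∈ unitInterval) (hq : 1 ≤ q) {A : Set (Config H)} (hA : IsLocal A)
    (hA' : IsUpperSet A) : φ.real A ≤ (edgeLaw H.edgeSet ⟨p, hp⟩).real A := by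
  classical
  obtain ⟨F, hF⟩ := hA
  refine le_of_tendsto (hlim F A hF) ?_
  filter_upwards [edgesIn_eventually hΛ F] with k hk
  rw [edgeLaw_eq_sum_edgeWeight _ (Λ k) (hF.mono hk)]
  exact rcProb_le_bernoulli hp.1 hp.2 hq (isUpperSet_preimage_extendClosed hA' _)

theorem div_mem_unitInterval {p q : ℝ} (hp : p ∈ unitInterval) (hq : 0 ≤ q) :
    p / (p + q * (1 - p)) ∈ unitInterval := by
  have h2 : 0 ≤ q * (1 - p) := mul_nonneg hq (by linarith [hp.2])
  have h1 := hp.1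
  exact ⟨by positivity, div_le_one_of_le₀ (by linarith) (by positivity)⟩

theorem LocalLimit.edgeLaw_le (hlim : LocalLimit p q Λ ξ φ) (hΛ : IsExhaustion H Λ ξ)
    (hp : p ∈ unitInterval) (hq : 1 ≤ q) {A : Set (Config H)} (hA : IsLocal A)
    (hA' : IsUpperSet A) :
    (edgeLaw H.edgeSet ⟨_, div_mem_unitInterval hp (zero_le_one.trans hq)⟩).real A ≤
      φ.real A := by
  classical
  obtain ⟨F, hF⟩ := hA
  refine ge_of_tendsto (hlim F A hF) ?_
  filter_upwards [edgesIn_eventually hΛ F] with k hk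
  rw [edgeLaw_eq_sum_edgeWeight _ (Λ k) (hF.mono hk)]
  exact bernoulli_le_rcProb hp.1 hp.2 hq (isUpperSet_preimage_extendClosed hA' _)

end Domination

namespace PlaneGraph

/-! ### Automorphisms and rectangles -/

section Isos
variable {G : PlaneGraph}

/-- The automorphism of the graph given by a symmetry of the drawing. -/
noncomputable def InvariantUnder.iso {T : ℝ × ℝ → ℝ × ℝ} (h : G.InvariantUnder T)
    (hT : Function.Injective T) : G.graph ≃g G.graph where
  toEquiv := Equiv.ofBijective (fun v => ⟨T v.1, h.mem_verts v.2⟩)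
    ⟨fun u v huv => Subtype.ext (hT (Subtype.ext_iff.1 huv)), fun v => by
      obtain ⟨u, hu, huv⟩ : v.1 ∈ T '' G.verts := by rw [h.1]; exact v.2
      exact ⟨⟨u, hu⟩, Subtype.ext huv⟩⟩
  map_rel_iff' := by
    intro u v
    refine and_congr (not_congr ?_) ?_
    · exact ⟨fun huv => Subtype.ext (hT (Subtype.ext_iff.1 huv)), fun huv => by rw [huv]⟩
    · constructor
      · rintro ⟨e, he, hev⟩
        obtain ⟨f, hf, rfl⟩ : e ∈ (fun e => T '' e) '' G.arcs := by rw [h.2]; exact he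
        refine ⟨f, hf, hT.image_injective ?_⟩
        rw [← h.image_inter_verts hT, Set.image_pair]
        exact hev
      · rintro ⟨e, he, hev⟩
        refine ⟨T '' e, h.mem_arcs he, ?_⟩
        rw [h.image_inter_verts hT, hev, Set.image_pair]
        rfl

theorem exists_iso_translate_up (hG : G.IsSymmetric) (k : ℕ) :
    ∃ τ : G.graph ≃g G.graph, ∀ v, (τ v).1 = (v.1.1, v.1.2 + k) :=
  ⟨(invariant_translate_up hG k).iso fun x y h => by
    ext
    · exact (Prod.ext_iff.1 h).1
    · simpa using (Prod.ext_iff.1 h).2, fun _ => rfl⟩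

theorem exists_iso_reflect (hG : G.IsSymmetric) (k : ℕ) :
    ∃ τ : G.graph ≃g G.graph, ∀ v, (τ v).1 = (k - v.1.1, v.1.2) :=
  ⟨(invariant_reflect hG k).iso fun x y h => by
    ext
    · simpa using (Prod.ext_iff.1 h).1
    · exact (Prod.ext_iff.1 h).2, fun _ => rfl⟩

theorem exists_iso_translate (hG : G.IsSymmetric) (k : ℕ) :
    ∃ τ : G.graph ≃g G.graph, ∀ v, (τ v).1 = (v.1.1 + k, v.1.2) :=
  ⟨(invariant_translate hG k).iso fun x y h => by
    ext
    · simpa using (Prod.ext_iff.1 h).1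
    · exact (Prod.ext_iff.1 h).2, fun _ => rfl⟩

theorem exists_iso_swap (hG : G.IsSymmetric) :
    ∃ τ : G.graph ≃g G.graph, ∀ v, (τ v).1 = (v.1.2, v.1.1) :=
  ⟨(invariant_swap hG).iso fun x y h => by
    ext
    · exact (Prod.ext_iff.1 h).2
    · exact (Prod.ext_iff.1 h).1, fun _ => rfl⟩

/-- Some automorphism preserving distances along the axes moves the first coordinate into the unit
interval. -/
theorem exists_iso_fst_mem (hG : G.IsSymmetric) (x : ℝ) :
    ∃ τ : G.graph ≃g G.graph, (∀ u v : G.verts, |(τ u).1.1 - (τ v).1.1| = |u.1.1 - v.1.1|) ∧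
      (∀ v : G.verts, (τ v).1.2 = v.1.2) ∧
        ∀ v : G.verts, v.1.1 ∈ Set.Icc (⌊x⌋ : ℝ) (⌊x⌋ + 1) → (τ v).1.1 ∈ Set.Icc (0 : ℝ) 1 := by
  -- The symmetries at hand are x ↦ k − x and x ↦ x + k with k a natural number: intervals with ⌊x⌋
  -- + 1 ≥ 0 are reflected, the others are translated.
  rcases le_total 0 (⌊x⌋ + 1) with hx | hx
  · obtain ⟨k, hk⟩ := Int.eq_ofNat_of_zero_le hx
    obtain ⟨τ, hτ⟩ := exists_iso_reflect hG k
    have hk' : (⌊x⌋ : ℝ) + 1 = k := by exact_mod_cast hk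
    refine ⟨τ, fun u v => ?_, fun v => by rw [hτ], fun v hv => ?_⟩
    · rw [hτ, hτ, show (k - u.1.1 - (k - v.1.1) : ℝ) = -(u.1.1 - v.1.1) by ring, abs_neg]
    · rw [hτ]
      constructor <;> simp only <;> linarith [hv.1, hv.2]
  · obtain ⟨k, hk⟩ := Int.eq_ofNat_of_zero_le (show 0 ≤ -⌊x⌋ by omega)
    obtain ⟨τ, hτ⟩ := exists_iso_translate hG k
    have hk' : -(⌊x⌋ : ℝ) = k := by exact_mod_cast hk
    refine ⟨τ, fun u v => ?_, fun v => by rw [hτ], fun v hv => ?_⟩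
    · rw [hτ, hτ, show (u.1.1 + k - (v.1.1 + k) : ℝ) = u.1.1 - v.1.1 by ring]
    · rw [hτ]
      constructor <;> simp only <;> linarith [hv.1, hv.2]

/-- Some automorphism preserving distances along the axes moves a unit square to the standard
one. -/
theorem exists_iso_mem_square (hG : G.IsSymmetric) (x y : ℝ) :
    ∃ τ : G.graph ≃g G.graph, (∀ u v : G.verts, |(τ u).1.1 - (τ v).1.1| = |u.1.1 - v.1.1|) ∧
      (∀ u v : G.verts, |(τ u).1.2 - (τ v).1.2| = |u.1.2 - v.1.2|) ∧
      ∀ v : G.verts, v.1 ∈ Set.Icc (⌊x⌋ : ℝ) (⌊x⌋ + 1) ×ˢ Set.Icc (⌊y⌋ : ℝ) (⌊y⌋ + 1) →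
        (τ v).1 ∈ Set.Icc (0 : ℝ) 1 ×ˢ Set.Icc (0 : ℝ) 1 := by
  obtain ⟨σ, hσ⟩ := exists_iso_swap hG
  obtain ⟨τ₁, h1, h2, h3⟩ := exists_iso_fst_mem hG x
  obtain ⟨τ₂, h1', h2', h3'⟩ := exists_iso_fst_mem hG y
  have e1 : ∀ v, (σ (τ₂ (σ (τ₁ v)))).1.1 = (τ₁ v).1.1 := fun v => by rw [hσ, h2', hσ]
  have e2 : ∀ v, (σ (τ₂ (σ (τ₁ v)))).1.2 = (τ₂ (σ (τ₁ v))).1.1 := fun v => by rw [hσ]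
  have e3 : ∀ v, (σ (τ₁ v)).1.1 = v.1.2 := fun v => by rw [hσ, h2]
  refine ⟨((τ₁.trans σ).trans τ₂).trans σ, fun u v => ?_, fun u v => ?_, fun v hv => ⟨?_, ?_⟩⟩
  · simp only [RelIso.trans_apply, e1, h1]
  · simp only [RelIso.trans_apply, e2, h1', e3]
  · simp only [RelIso.trans_apply, e1]
    exact h3 v hv.1
  · simp only [RelIso.trans_apply, e2]
    exact h3' _ (by rw [e3]; exact hv.2)

/-- The vertices in a rectangle. -/
def rectVerts (G : PlaneGraph) (a b c d : ℝ) : Set G.verts :=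
  {v | v.1 ∈ Set.Icc a b ×ˢ Set.Icc c d}

theorem rectVerts_finite (hlf : G.IsLocallyFinite) (a b c d : ℝ) : (G.rectVerts a b c d).Finite := by
  have h := hlf.1 (Set.Icc a b ×ˢ Set.Icc c d)
    ((Metric.isBounded_Icc a b).prod (Metric.isBounded_Icc c d))
  refine Set.Finite.subset (h.preimage Subtype.val_injective.injOn) fun v hv => ⟨hv, v.2⟩

theorem mem_floor_square (z : ℝ × ℝ) :
    z ∈ Set.Icc (⌊z.1⌋ : ℝ) (⌊z.1⌋ + 1) ×ˢ Set.Icc (⌊z.2⌋ : ℝ) (⌊z.2⌋ + 1) :=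
  ⟨⟨Int.floor_le _, (Int.lt_floor_add_one _).le⟩, ⟨Int.floor_le _, (Int.lt_floor_add_one _).le⟩⟩

/-- By periodicity every vertex is moved by an automorphism into one unit square, which contains
finitely many vertices. The two bounds that follow rest on the same argument. -/
theorem exists_degree_le (hG : G.IsSymmetric) (hlf : G.IsLocallyFinite) :
    ∃ L : ℕ, 1 ≤ L ∧ ∀ u, {v | G.graph.Adj u v}.encard ≤ L := by
  have hfin := rectVerts_finite hlf 0 1 0 1
  have hN := fun u => hlf.2 u
  refine ⟨(hfin.toFinset.sup fun u => (G.graph.neighborSet u).ncard) + 1, by omega, fun u => ?_⟩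
  obtain ⟨τ, -, -, hτ⟩ := exists_iso_mem_square hG u.1.1 u.1.2
  have h1 : {v | G.graph.Adj u v} = τ ⁻¹' G.graph.neighborSet (τ u) := by
    ext v
    exact τ.map_adj_iff.symm
  rw [h1]
  refine (encard_preimage_le τ.injective _).trans ?_
  rw [← (hN _).cast_ncard_eq]
  have h2 := Finset.le_sup (f := fun u => (G.graph.neighborSet u).ncard)
    (hfin.mem_toFinset.2 (hτ u (mem_floor_square u.1)))
  exact_mod_cast h2.trans (Nat.le_succ _)

theorem exists_displacement_le (hG : G.IsSymmetric) (hlf : G.IsLocallyFinite) :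
    ∃ r : ℕ, 1 ≤ r ∧ ∀ u v, G.graph.Adj u v → |u.1.1 - v.1.1| ≤ r ∧ |u.1.2 - v.1.2| ≤ r := by
  have hfin := rectVerts_finite hlf 0 1 0 1
  have hfin2 : (⋃ u ∈ G.rectVerts 0 1 0 1, (fun v => (u, v)) '' G.graph.neighborSet u).Finite :=
    hfin.biUnion fun u _ => (hlf.2 u).image _
  obtain ⟨R, hR⟩ := (hfin2.image fun p : G.verts × G.verts =>
    max |p.1.1.1 - p.2.1.1| |p.1.1.2 - p.2.1.2|).bddAbove
  obtain ⟨r, hr⟩ := exists_nat_ge R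
  refine ⟨r + 1, by omega, fun u v huv => ?_⟩
  obtain ⟨τ, h1, h2, hτ⟩ := exists_iso_mem_square hG u.1.1 u.1.2
  have h3 := hR ⟨(τ u, τ v), Set.mem_biUnion (hτ u (mem_floor_square u.1))
    ⟨τ v, τ.map_adj_iff.2 huv, rfl⟩, rfl⟩
  simp only [h1, h2] at h3
  push_cast
  constructor
  · linarith [(le_max_left _ _).trans h3]
  · linarith [(le_max_right _ _).trans h3]

/-- The number of vertices in a rectangle is bounded by a multiple of its area. -/
theorem exists_encard_rectVerts_le (hG : G.IsSymmetric) (hlf : G.IsLocallyFinite) :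
    ∃ c : ℕ, 1 ≤ c ∧ ∀ b n : ℕ, (G.rectVerts 0 b 0 n).encard ≤ (c * ((b + 1) * (n + 1)) : ℕ) := by
  have hfin := rectVerts_finite hlf 0 1 0 1
  refine ⟨(G.rectVerts 0 1 0 1).ncard + 1, by omega, fun b n => ?_⟩
  have hsq : ∀ i j : ℕ, (G.rectVerts i (i + 1) j (j + 1)).encard ≤
      ((G.rectVerts 0 1 0 1).ncard + 1 : ℕ) := by
    intro i j
    obtain ⟨τ, -, -, hτ⟩ := exists_iso_mem_square hG i j
    simp only [Int.floor_natCast, Int.cast_natCast] at hτ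
    refine (Set.encard_le_encard (t := τ ⁻¹' G.rectVerts 0 1 0 1) fun v hv => hτ v hv).trans ?_
    refine (encard_preimage_le τ.injective _).trans ?_
    rw [← hfin.cast_ncard_eq]
    exact_mod_cast Nat.le_succ _
  have hcov : G.rectVerts 0 b 0 n ⊆ ⋃ p ∈ Finset.range (b + 1) ×ˢ Finset.range (n + 1),
      G.rectVerts (p.1 : ℕ) ((p.1 : ℕ) + 1) (p.2 : ℕ) ((p.2 : ℕ) + 1) := by
    intro v hv
    obtain ⟨⟨h1, h2⟩, h3, h4⟩ := hv
    refine Set.mem_biUnion (x := (⌊v.1.1⌋₊, ⌊v.1.2⌋₊)) ?_ ⟨⟨Nat.floor_le h1,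
      (Nat.lt_floor_add_one _).le⟩, ⟨Nat.floor_le h3, (Nat.lt_floor_add_one _).le⟩⟩
    have h5 : ⌊v.1.1⌋₊ ≤ b := Nat.floor_le_of_le h2
    have h6 : ⌊v.1.2⌋₊ ≤ n := Nat.floor_le_of_le h4
    simp only [Finset.coe_product, Set.mem_prod, Finset.mem_coe,
      Finset.mem_range]
    omega
  refine (Set.encard_le_encard hcov).trans ?_
  refine (Finset.set_encard_biUnion_le _ _).trans ?_
  refine (Finset.sum_le_sum fun p _ => hsq p.1 p.2).trans ?_
  rw [Finset.sum_const, Finset.card_product, Finset.card_range, Finset.card_range, nsmul_eq_mul]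
  push_cast
  rw [mul_comm]

end Isos
end PlaneGraph

namespace PlaneGraph

/-! ### Crossing events of the slab -/

section SlabEvents
variable {G : PlaneGraph} {VS : Type*} {S : SimpleGraph VS}

/-- The automorphism of the slab induced by an automorphism of the plane graph. -/
def slabIso (τ : G.graph ≃g G.graph) (S : SimpleGraph VS) : G.slab S ≃g G.slab S where
  toEquiv := Equiv.prodCongr τ.toEquiv (Equiv.refl VS)
  map_rel_iff' := by
    rintro ⟨u, s⟩ ⟨v, t⟩
    have h : τ u = τ v ↔ u = v := τ.injective.eq_iff
    have h' : G.graph.Adj (τ u) (τ v) ↔ G.graph.Adj u v := τ.map_adj_iff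
    simp [SimpleGraph.boxProd_adj, h, h']

/-- The event that there is an open path over `D` from a vertex over `A` to a vertex over `B`. -/
def slabEvent (G : PlaneGraph) (S : SimpleGraph VS) (D A B : Set G.verts) :
    Set (Config (G.slab S)) :=
  connEvent (G.slab S) (Prod.fst ⁻¹' D) (Prod.fst ⁻¹' A) (Prod.fst ⁻¹' B)

theorem finite_preimage_fst [Finite VS] {D : Set G.verts} (hD : D.Finite) :
    (Prod.fst ⁻¹' D : Set (G.verts × VS)).Finite := by
  rw [← Set.prod_univ]
  exact hD.prod Set.finite_univ

theorem isLocal_slabEvent [Finite VS] {D A B : Set G.verts} (hD : D.Finite) :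
    IsLocal (slabEvent G S D A B) :=
  isLocal_connEvent (finite_preimage_fst hD)

theorem slabEvent_mono {D A B D' A' B' : Set G.verts} (hD : D ⊆ D') (hA : A ∩ D ⊆ A')
    (hB : B ∩ D ⊆ B') : slabEvent G S D A B ⊆ slabEvent G S D' A' B' :=
  connEvent_mono (fun _ h => hD h) (fun _ h => hA h) fun _ h => hB h

theorem slabEvent_symm {D A B : Set G.verts} : slabEvent G S D A B = slabEvent G S D B A :=
  connEvent_symm

/-- Invariance of the probabilities of local events under the automorphisms of the plane graph. -/
def IsSlabInvariant (μ : Measure (Config (G.slab S))) : Prop :=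
  ∀ (τ : G.graph ≃g G.graph) (A : Set (Config (G.slab S))), IsLocal A →
    μ.real (pullConfig (slabIso τ S) ⁻¹' A) = μ.real A

theorem IsSlabInvariant.slabEvent [Finite VS] {μ : Measure (Config (G.slab S))}
    (h : IsSlabInvariant μ) (τ : G.graph ≃g G.graph) {D A B D' A' B' : Set G.verts}
    (hD : D.Finite) (hD' : D' = τ ⁻¹' D) (hA' : A' = τ ⁻¹' A) (hB' : B' = τ ⁻¹' B) :
    μ.real (G.slabEvent S D' A' B') = μ.real (G.slabEvent S D A B) := by
  subst hD' hA' hB'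
  have h1 := finite_preimage_fst (VS := VS) (hD.preimage τ.injective.injOn)
  rw [← h τ (G.slabEvent S (τ ⁻¹' D) (τ ⁻¹' A) (τ ⁻¹' B)) (isLocal_connEvent h1)]
  have h2 : pullConfig (slabIso τ S) ⁻¹' G.slabEvent S (τ ⁻¹' D) (τ ⁻¹' A) (τ ⁻¹' B) =
      G.slabEvent S D A B := by
    ext ω
    exact connSets_pullConfig (slabIso τ S) ω (D := Prod.fst ⁻¹' D) (A := Prod.fst ⁻¹' A)
      (B := Prod.fst ⁻¹' B)
  rw [h2]

/-- The vertical line through `(a, 0)`. -/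
def vLine (G : PlaneGraph) (a : ℝ) : Set G.verts := {v | v.1.1 = a}

/-- The horizontal line through `(0, a)`. -/
def hLine (G : PlaneGraph) (a : ℝ) : Set G.verts := {v | v.1.2 = a}

/-- The event that `[a, b] × [c, d]` is crossed horizontally. -/
def crossX (G : PlaneGraph) (S : SimpleGraph VS) (a b c d : ℝ) : Set (Config (G.slab S)) :=
  G.slabEvent S (G.rectVerts a b c d) (G.vLine a) (G.vLine b)

/-- The event that the bottom of `[a, b] × [0, d]` is connected to its top inside it. -/
def crossY (G : PlaneGraph) (S : SimpleGraph VS) (a b d : ℝ) : Set (Config (G.slab S)) :=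
  G.slabEvent S (G.rectVerts a b 0 d) (G.hLine 0) (G.topVerts d)

theorem crossH_eq_crossX (b d : ℝ) : crossH G S b d = G.crossX S 0 b 0 d := by
  ext ω
  exact crossH_iff G S b d ω

/-- A reflection serves as the translation: it exchanges the two vertical sides, which does not
matter for a crossing. -/
theorem IsSlabInvariant.crossX_translate [Finite VS] (hG : G.IsSymmetric)
    (hlf : G.IsLocallyFinite) {μ : Measure (Config (G.slab S))} (h : IsSlabInvariant μ)
    (c w : ℕ) (n : ℝ) : μ.real (G.crossX S c (c + w : ℕ) 0 n) = μ.real (G.crossX S 0 w 0 n) := by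
  obtain ⟨τ, hτ⟩ := exists_iso_reflect hG (c + w)
  rw [crossX, slabEvent_symm]
  refine h.slabEvent τ (rectVerts_finite hlf _ _ _ _) ?_ ?_ ?_
  · ext v
    simp only [rectVerts, Set.mem_ofPred_eq, Set.mem_preimage, hτ, Set.mem_prod, Set.mem_Icc]
    push_cast
    constructor <;> rintro ⟨⟨_, _⟩, _, _⟩ <;> refine ⟨⟨?_, ?_⟩, ?_, ?_⟩ <;> linarith
  · ext v
    simp only [vLine, Set.mem_ofPred_eq, Set.mem_preimage, hτ]
    push_cast
    constructor <;> intro _ <;> linarith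
  · ext v
    simp only [vLine, Set.mem_ofPred_eq, Set.mem_preimage, hτ]
    push_cast
    constructor <;> intro _ <;> linarith

theorem IsSlabInvariant.crossX_translate_up [Finite VS] (hG : G.IsSymmetric)
    (hlf : G.IsLocallyFinite) {μ : Measure (Config (G.slab S))} (h : IsSlabInvariant μ)
    (b n : ℝ) (j : ℕ) : μ.real (G.crossX S 0 b j (j + n)) = μ.real (G.crossX S 0 b 0 n) := by
  obtain ⟨τ, hτ⟩ := exists_iso_translate_up hG j
  symm
  refine h.slabEvent τ (rectVerts_finite hlf _ _ _ _) ?_ ?_ ?_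
  · ext v
    simp only [rectVerts, Set.mem_ofPred_eq, Set.mem_preimage, hτ, Set.mem_prod, Set.mem_Icc]
    constructor <;> rintro ⟨⟨_, _⟩, _, _⟩ <;> refine ⟨⟨?_, ?_⟩, ?_, ?_⟩ <;> linarith
  · ext v
    simp only [vLine, Set.mem_ofPred_eq, Set.mem_preimage, hτ]
  · ext v
    simp only [vLine, Set.mem_ofPred_eq, Set.mem_preimage, hτ]

/-- A path from height `0` to height `2 n` reaches the top of the strip of height `n` inside the
strip. -/
theorem slabEvent_subset_crossY {c c' n : ℝ} (hn : 0 < n) :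
    G.slabEvent S (G.rectVerts c c' 0 (2 * n)) (G.hLine 0) (G.hLine (2 * n)) ⊆
      G.crossY S c c' n := by
  rintro ω ⟨a, ha, b, hb, hab⟩
  have ha' : a.1.1.2 = 0 := ha
  have hb' : b.1.1.2 = 2 * n := hb
  obtain ⟨w, hwB, hwD, h⟩ := hab.exists_first (B := {v : G.verts × VS | n < v.1.1.2})
    (show n < b.1.1.2 by linarith)
  have hwB' : n < w.1.1.2 := hwB
  rcases h with rfl | ⟨u, hu, huw⟩
  · linarith
  · have huD := hu.right_mem
    have hun : u.1.1.2 ≤ n := not_lt.1 huD.2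
    refine ⟨a, ha, u, ?_, hu.mono (fun _ _ _ _ h => h) ?_⟩
    · refine ⟨hun, .inr ⟨w.1, ?_, hwB'⟩⟩
      rcases SimpleGraph.boxProd_adj.1 (openGraph_le ω huw) with ⟨h, -⟩ | ⟨-, h⟩
      · exact h
      · rw [h] at hun
        linarith
    · rintro v ⟨hv, hvn⟩
      exact ⟨hv.1, hv.2.1, not_lt.1 hvn⟩

/-- After a reflection and the exchange of coordinates, the crossing of the 2n × n rectangle joins
height 0 to height 2n over [c, c + n]. It is cut where it first exceeds height n. -/
theorem IsSlabInvariant.crossX_le_crossY [Finite VS] (hG : G.IsSymmetric)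
    (hlf : G.IsLocallyFinite) {μ : Measure (Config (G.slab S))} [IsFiniteMeasure μ]
    (h : IsSlabInvariant μ) (c n : ℕ) (hn : 1 ≤ n) :
    μ.real (G.crossX S 0 (2 * n : ℕ) 0 n) ≤ μ.real (G.crossY S c (c + n : ℕ) n) := by
  obtain ⟨σ, hσ⟩ := exists_iso_swap hG
  obtain ⟨τ, hτ⟩ := exists_iso_reflect hG (c + n)
  have hστ : ∀ v, ((τ.trans σ) v).1 = (v.1.2, ((c + n : ℕ) : ℝ) - v.1.1) := fun v => by
    rw [RelIso.trans_apply, hσ, hτ]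
  rw [crossX, ← h.slabEvent (τ.trans σ) (rectVerts_finite hlf _ _ _ _) rfl rfl rfl]
  refine measureReal_mono ((subset_of_eq ?_).trans
    (slabEvent_subset_crossY (by exact_mod_cast hn)))
  congr 1
  · ext v
    simp only [rectVerts, Set.mem_ofPred_eq, Set.mem_preimage, hστ, Set.mem_prod, Set.mem_Icc]
    push_cast
    constructor <;> rintro ⟨⟨_, _⟩, _, _⟩ <;> refine ⟨⟨?_, ?_⟩, ?_, ?_⟩ <;> linarith
  · ext v
    simp only [vLine, hLine, Set.mem_ofPred_eq, Set.mem_preimage, hστ]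
  · ext v
    simp only [vLine, hLine, Set.mem_ofPred_eq, Set.mem_preimage, hστ]
    push_cast
    rfl

/-! ### Projection to the plane graph -/

theorem connIn_fst {K : SimpleGraph (G.verts × VS)} (hK : K ≤ G.slab S)
    {P : Set (G.verts × VS)} {x y : G.verts × VS} (h : ConnIn K P x y) :
    ConnIn G.graph (Prod.fst '' P) x.1 y.1 := by
  obtain ⟨hx, h⟩ := h
  induction h with
  | refl => exact ConnIn.refl ⟨x, hx, rfl⟩
  | @tail b c _ hbc ih =>
    rcases SimpleGraph.boxProd_adj.1 (hK hbc.1) with ⟨h, -⟩ | ⟨-, h⟩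
    · exact ih.tail h ⟨c, hbc.2, rfl⟩
    · rwa [← h]

theorem connSets_fst {K : SimpleGraph (G.verts × VS)} (hK : K ≤ G.slab S)
    {P : Set (G.verts × VS)} {A B : Set G.verts}
    (h : ConnSets K P (Prod.fst ⁻¹' A) (Prod.fst ⁻¹' B)) :
    ConnSets G.graph (Prod.fst '' P) A B := by
  obtain ⟨a, ha, b, hb, h⟩ := h
  exact ⟨a.1, ha, b.1, hb, connIn_fst hK h⟩

theorem connIn_column (hS : S.Connected) {P : Set G.verts} {u v : G.verts × VS}
    (hu : u.1 ∈ P) (huv : u.1 = v.1) :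
    ConnIn (G.slab S) {x | x ∈ (Prod.fst ⁻¹' P : Set (G.verts × VS)) ∧ x.1 = u.1} u v := by
  obtain ⟨u, s⟩ := u
  obtain ⟨v, t⟩ := v
  obtain rfl : u = v := huv
  obtain ⟨w⟩ := hS.preconnected s t
  induction w with
  | nil => exact ConnIn.refl ⟨hu, rfl⟩
  | @cons a b c hab _ ih =>
    refine ConnIn.trans (ConnIn.adj (y := (u, b)) ⟨hu, rfl⟩ ⟨hu, rfl⟩ ?_) (ih hu)
    exact SimpleGraph.boxProd_adj.2 (.inr ⟨hab, rfl⟩)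

theorem connIn_cluster {V : Type*} {K : SimpleGraph V} {D : Set V} {x y : V} (h : ConnIn K D x y) :
    ConnIn K {z | ConnIn K D x z} x y := by
  obtain ⟨hx, h⟩ := h
  refine ⟨ConnIn.refl hx, ?_⟩
  induction h with
  | refl => exact .refl
  | tail h1 h2 ih => exact ih.tail ⟨h2.1, ConnIn.tail ⟨hx, h1⟩ h2.1 h2.2⟩

/-- In a single layer, crossings of overlapping rectangles can be glued. -/
theorem crossX_inter_subset [Subsingleton VS] (hG : G.IsSymmetric) {w j n : ℕ} (hw : 2 * n ≤ w)
    (hj : j ≤ n) :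
    G.crossX S 0 w 0 n ∩ (G.crossY S (w - n : ℕ) ((w - n : ℕ) + n : ℕ) n ∩
      G.crossX S (w + j - 2 * n : ℕ) ((w + j - 2 * n : ℕ) + 2 * n : ℕ) 0 n) ⊆
      G.crossX S 0 (w + j : ℕ) 0 n := by
  rintro ω ⟨⟨a, ha, b, hb, hab⟩, ⟨c, hc, d, hd, hcd⟩, e, he, f, hf, hef⟩
  have hle := openGraph_le ω
  have h1 : (w - n) + n = w := by omega
  have h2 : (w + j - 2 * n) + 2 * n = w + j := by omega
  rw [h1] at hcd
  rw [h2] at hef hf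
  have hc1 : ((w + j - 2 * n : ℕ) : ℝ) ≤ (w - n : ℕ) := by exact_mod_cast (by omega)
  have hc2 : (w : ℝ) ≤ (w + j : ℕ) := by exact_mod_cast (by omega)
  have hmem : ∀ {D x}, (∀ v ∈ Prod.fst '' {z | ConnIn (openGraph ω) (Prod.fst ⁻¹' D) x z}, v ∈ D) :=
    fun {D x} v ⟨z, hz, hzv⟩ => hzv ▸ hz.right_mem
  have cross : ∀ {D : Set G.verts} {x y : G.verts × VS} {A B : Set G.verts},
      ConnIn (openGraph ω) (Prod.fst ⁻¹' D) x y → x.1 ∈ A → y.1 ∈ B →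
      ConnSets G.graph (Prod.fst '' {z | ConnIn (openGraph ω) (Prod.fst ⁻¹' D) x z}) A B :=
    fun h hx hy => connSets_fst hle ⟨_, hx, _, hy, connIn_cluster h⟩
  have hY : ∀ v ∈ G.rectVerts (w - n : ℕ) w 0 n,
      v.1 ∈ box (0 : ℕ) w n ∧ v.1 ∈ box (w + j - 2 * n : ℕ) (w + j : ℕ) n := by
    rintro v ⟨⟨h3, h4⟩, h5, h6⟩
    exact ⟨⟨⟨(Nat.cast_le.2 (Nat.zero_le _)).trans h3, h4⟩, h5, h6⟩,
      ⟨⟨hc1.trans h3, h4.trans hc2⟩, h5, h6⟩⟩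
  -- In a single layer a common vertex of the projections is a common vertex of the clusters, so no
  -- gluing is required.
  obtain ⟨v, ⟨z, hz, rfl⟩, ⟨z', hz', hzz⟩⟩ := exists_common_of_crossing hG (a := 0) (b := w) (n := n)
    (fun v hv => by rw [Nat.cast_zero]; exact hmem v hv) (fun v hv => (hY v (hmem v hv)).1)
    (cross hab (by rw [Nat.cast_zero]; exact ha) hb) (cross hcd hc hd)
  obtain rfl : z' = z := Prod.ext hzz (Subsingleton.elim _ _)
  obtain ⟨v, ⟨t, ht, rfl⟩, ⟨t', ht', htt⟩⟩ := exists_common_of_crossing hG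
    (a := w + j - 2 * n) (b := w + j) (n := n)
    (fun v hv => hmem v hv) (fun v hv => (hY v (hmem v hv)).2)
    (cross hef he hf) (cross hcd hc hd)
  obtain rfl : t' = t := Prod.ext htt (Subsingleton.elim _ _)
  have hmono : ∀ {D : Set G.verts} {x y : G.verts × VS},
      ConnIn (openGraph ω) (Prod.fst ⁻¹' D) x y → D ⊆ G.rectVerts 0 (w + j : ℕ) 0 n →
      ConnIn (openGraph ω) (Prod.fst ⁻¹' G.rectVerts 0 (w + j : ℕ) 0 n) x y :=
    fun h hD => h.mono (fun _ _ _ _ h => h) fun _ hv => hD hv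
  have hD1 : G.rectVerts 0 w 0 n ⊆ G.rectVerts 0 (w + j : ℕ) 0 n :=
    fun v hv => ⟨⟨hv.1.1, hv.1.2.trans hc2⟩, hv.2⟩
  have hD2 : G.rectVerts (w - n : ℕ) w 0 n ⊆ G.rectVerts 0 (w + j : ℕ) 0 n :=
    fun v hv => ⟨⟨(Nat.cast_nonneg _).trans hv.1.1, hv.1.2.trans hc2⟩, hv.2⟩
  have hD3 : G.rectVerts (w + j - 2 * n : ℕ) (w + j : ℕ) 0 n ⊆ G.rectVerts 0 (w + j : ℕ) 0 n :=
    fun v hv => ⟨⟨(Nat.cast_nonneg _).trans hv.1.1, hv.1.2⟩, hv.2⟩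
  refine ⟨a, ha, f, hf, ?_⟩
  exact (hmono hz hD1).trans <| (hmono hz' hD2).symm.trans <| (hmono ht' hD2).trans <|
    (hmono ht hD3).symm.trans (hmono hef hD3)

end SlabEvents
end PlaneGraph

/-! ### Gluing in the slab -/

/-- Optimisation over the number of contact sites: choose t with K^t = δ^(−1/2) and k = ⌊t⌋. Then
K^k δ ≤ δ^(1/2), while ρ^t is a fixed power of δ; rounding costs at most a factor 1/ρ. If δ ≥ 1 the
bound P ≤ 1 suffices. -/
theorem exists_rpow_bound {K ρ : ℝ} (hK : 1 < K) (hρ0 : 0 < ρ) (hρ1 : ρ < 1) :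
    ∃ C b : ℝ, 1 ≤ C ∧ 0 < b ∧ b ≤ 1 / 2 ∧ ∀ P δ : ℝ, P ≤ 1 → 0 < δ →
      (∀ k : ℕ, P ≤ K ^ k * δ + ρ ^ k) → P ≤ C * δ ^ b := by
  have hlK : 0 < Real.log K := Real.log_pos hK
  have hlρ : Real.log ρ < 0 := Real.log_neg hρ0 hρ1
  set a := -Real.log ρ / (2 * Real.log K) with ha
  have ha0 : 0 < a := div_pos (by linarith) (by linarith)
  refine ⟨1 + ρ⁻¹, min (1 / 2) a, ?_, lt_min (by norm_num) ha0, min_le_left _ _, ?_⟩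
  · linarith [inv_pos.2 hρ0]
  intro P δ hP hδ h
  have hρi : 0 < ρ⁻¹ := inv_pos.2 hρ0
  rcases le_or_gt 1 δ with h1 | h1
  · have h2 : 1 ≤ δ ^ min (1 / 2) a := Real.one_le_rpow h1 (lt_min (by norm_num) ha0).le
    nlinarith
  · have hlδ : Real.log δ < 0 := Real.log_neg hδ h1
    set t := -Real.log δ / (2 * Real.log K) with ht
    have ht0 : 0 ≤ t := div_nonneg (by linarith) (by linarith)
    have hK0 : 0 < K := by linarith
    have e1 : K ^ t = δ ^ (-(1 / 2) : ℝ) := by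
      rw [Real.rpow_def_of_pos hK0, Real.rpow_def_of_pos hδ, ht]
      congr 1
      field_simp
    have e2 : ρ ^ t = δ ^ a := by
      rw [Real.rpow_def_of_pos hρ0, Real.rpow_def_of_pos hδ, ht, ha]
      congr 1
      field_simp
    have h3 : K ^ ⌊t⌋₊ ≤ K ^ t := by
      rw [← Real.rpow_natCast]
      exact Real.rpow_le_rpow_of_exponent_le hK.le (Nat.floor_le ht0)
    have h4 : ρ ^ ⌊t⌋₊ ≤ ρ⁻¹ * ρ ^ t := by
      rw [← Real.rpow_natCast, ← Real.rpow_neg_one, ← Real.rpow_add hρ0]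
      exact Real.rpow_le_rpow_of_exponent_ge hρ0 hρ1.le (by linarith [Nat.lt_floor_add_one t])
    have h5 : K ^ t * δ = δ ^ (1 / 2 : ℝ) := by
      rw [e1]
      nth_rewrite 2 [← Real.rpow_one δ]
      rw [← Real.rpow_add hδ]
      norm_num
    have h6 : δ ^ (1 / 2 : ℝ) ≤ δ ^ min (1 / 2) a :=
      Real.rpow_le_rpow_of_exponent_ge hδ h1.le (min_le_left _ _)
    have h7 : δ ^ a ≤ δ ^ min (1 / 2) a :=
      Real.rpow_le_rpow_of_exponent_ge hδ h1.le (min_le_right _ _)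
    calc P ≤ K ^ ⌊t⌋₊ * δ + ρ ^ ⌊t⌋₊ := h _
      _ ≤ K ^ t * δ + ρ⁻¹ * ρ ^ t := add_le_add (mul_le_mul_of_nonneg_right h3 hδ.le) h4
      _ ≤ δ ^ min (1 / 2) a + ρ⁻¹ * δ ^ min (1 / 2) a := by
        rw [h5, e2]
        exact add_le_add h6 (mul_le_mul_of_nonneg_left h7 hρi.le)
      _ = _ := by ring

theorem encard_incident_le {W : Type*} {H : SimpleGraph W} {L m : ℕ}
    (hdeg : ∀ u, {v | H.Adj u v}.encard ≤ L) {X : Set W} (hX : X.encard ≤ m) :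
    {e : H.edgeSet | ∃ x ∈ e.1, x ∈ X}.encard ≤ (m * L : ℕ) := by
  have hfin : X.Finite := Set.finite_of_encard_le_coe hX
  have h1 : Subtype.val '' {e : H.edgeSet | ∃ x ∈ e.1, x ∈ X} ⊆
      ⋃ x ∈ X, (fun y => s(x, y)) '' {v | H.Adj x v} := by
    rintro - ⟨⟨e, he⟩, ⟨x, hx, hxX⟩, rfl⟩
    obtain ⟨y, rfl⟩ := Sym2.mem_iff_exists.1 hx
    exact Set.mem_biUnion hxX ⟨y, he, rfl⟩
  rw [← Subtype.val_injective.encard_image]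
  refine (Set.encard_le_encard h1).trans ?_
  rw [← hfin.coe_toFinset]
  refine (Finset.set_encard_biUnion_le _ _).trans ?_
  refine (Finset.sum_le_sum fun x _ => (Set.encard_image_le _ _).trans (hdeg x)).trans ?_
  rw [Finset.sum_const, nsmul_eq_mul, ← Set.encard_coe_eq_coe_finsetCard, hfin.coe_toFinset]
  push_cast
  exact mul_le_mul_left hX _

/-! ### Gluing for events over sets of plane vertices. -/

namespace PlaneGraph

section Slab
variable {G : PlaneGraph} {VS : Type*} {S : SimpleGraph VS}

theorem isSlabInvariant_of_unique {p q : ℝ} (h0 : 0 ≤ p) (h1 : p ≤ 1) (hq : 0 < q)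
    {φ : Measure (Config (G.slab S))} (h : IsUniqueInfiniteVolume (G.slab S) p q φ) :
    IsSlabInvariant φ :=
  fun τ _ hA => h.measureReal_pullConfig h0 h1 hq (slabIso τ S) hA.choose_spec

theorem isSlabInvariant_edgeLaw (p : unitInterval) :
    IsSlabInvariant (edgeLaw (G.slab S).edgeSet p) :=
  fun τ _ hA => edgeLaw_preimage (slabIso τ S).mapEdgeSet.injective hA.measurableSet

theorem encard_column [Finite VS] (X : Set G.verts) :
    (Prod.fst ⁻¹' X : Set (G.verts × VS)).encard = X.encard * Nat.card VS := by
  rw [← Set.prod_univ, Set.encard_prod, Set.encard_univ, ENat.card_eq_coe_natCard]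

theorem exists_slab_degree_le [Finite VS] (S : SimpleGraph VS) (hG : G.IsSymmetric)
    (hlf : G.IsLocallyFinite) :
    ∃ L : ℕ, 1 ≤ L ∧ ∀ u, {v | (G.slab S).Adj u v}.encard ≤ L := by
  obtain ⟨L, hL, hdeg⟩ := exists_degree_le hG hlf
  refine ⟨L + Nat.card VS, by omega, fun u => ?_⟩
  have h : {v | (G.slab S).Adj u v} ⊆
      (fun v => (v, u.2)) '' {v | G.graph.Adj u.1 v} ∪ (fun t => (u.1, t)) '' Set.univ := by
    rintro ⟨v, t⟩ hv
    rcases SimpleGraph.boxProd_adj.1 hv with ⟨h, h'⟩ | ⟨-, h'⟩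
    · exact .inl ⟨v, h, Prod.ext rfl h'⟩
    · exact .inr ⟨t, trivial, Prod.ext h' rfl⟩
  refine (Set.encard_le_encard h).trans ((Set.encard_union_le _ _).trans ?_)
  push_cast
  refine add_le_add ((Set.encard_image_le _ _).trans (hdeg _)) ((Set.encard_image_le _ _).trans ?_)
  rw [Set.encard_univ, ENat.card_eq_coe_natCard]

/-- Gluing in the slab, uniformly in the edge parameter. -/
theorem exists_slab_gluing [Finite VS] (hG : G.IsSymmetric) (hlf : G.IsLocallyFinite)
    (hS : S.Connected) {p₀ p₁ q : ℝ} (h0 : 0 < p₀) (h1 : p₁ < 1) (hq : 1 ≤ q) :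
    ∃ C b : ℝ, 1 ≤ C ∧ 0 < b ∧ b ≤ 1 / 2 ∧ ∀ p, p₀ ≤ p → p ≤ p₁ →
      ∀ (Λ : ℕ → Finset (G.verts × VS)) (ξ : ∀ k, Setoid (Λ k : Set (G.verts × VS)))
        (φ : Measure (Config (G.slab S))), IsProbabilityMeasure φ →
      IsExhaustion (G.slab S) Λ ξ → LocalLimit p q Λ ξ φ →
      ∀ D A A' B B' : Set G.verts, D.Finite → Disjoint B B' →
      (∀ P Q : Set G.verts, P ⊆ D → Q ⊆ D → ConnSets G.graph P A A' → ConnSets G.graph Q B B' →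
        ∃ v ∈ P, v ∈ Q) →
      ∀ δ, 0 < δ → φ.real (G.slabEvent S D B B')ᶜ ≤ δ →
        φ.real (G.slabEvent S D A A' \ G.slabEvent S D A B) ≤ C * δ ^ b := by
  obtain ⟨L, hL, hdeg⟩ := exists_slab_degree_le S hG hlf
  set d := (1 * Nat.card VS) * L with hd
  have : Nonempty VS := hS.nonempty
  have hVS : 1 ≤ Nat.card VS := Nat.card_pos
  have hd1 : 1 ≤ d := by
    rw [hd, one_mul]
    exact Nat.mul_pos hVS hL
  -- A finite-energy constant valid for all p in [p₀, p₁]; this makes `C` and `b` uniform in p.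
  set r := max (1 / p₀) (1 / (1 - p₁)) with hr
  rcases le_or_gt p₀ p₁ with hpp | hpp
  swap
  · exact ⟨1, 1 / 2, le_rfl, by norm_num, le_rfl, fun p h h' => absurd (h.trans h') hpp.not_ge⟩
  have hr1 : 1 ≤ r := le_trans (by rw [le_div_iff₀ h0]; linarith) (le_max_left _ _)
  have hR : 1 ≤ r * q := by nlinarith
  have hL' : (1 : ℝ) ≤ L := by exact_mod_cast hL
  have hκ : 0 < 1 / (2 * L * (r * q)) ^ d := by positivity
  obtain ⟨C, b, hC, hb0, hb1, hbound⟩ := exists_rpow_bound (K := (2 * (r * q)) ^ d)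
    (ρ := (1 + 1 / (2 * L * (r * q)) ^ d)⁻¹) (one_lt_pow₀ (by linarith) (by omega))
    (by positivity) (inv_lt_one_of_one_lt₀ (by linarith))
  refine ⟨C, b, hC, hb0, hb1, fun p hp hp' Λ ξ φ hφ hΛ hlim D A A' B B' hD hBB hlink δ hδ hδ' => ?_⟩
  refine hbound _ _ measureReal_le_one hδ fun k => ?_
  have hz : ∀ z : G.verts, {v : G.verts × VS | v.1 = z}.encard ≤ (1 * Nat.card VS : ℕ) := by
    intro z
    have h := encard_column (VS := VS) ({z} : Set G.verts)
    rw [Set.encard_singleton] at h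
    refine (Set.encard_le_encard (t := Prod.fst ⁻¹' {z}) fun v hv => hv).trans ?_
    rw [h]
    push_cast
    exact le_rfl
  have key := hlim.gluing hΛ (p := p) (by linarith) (by linarith) hq (r := r)
    ((one_div_le_one_div_of_le h0 hp).trans (le_max_left _ _))
    ((one_div_le_one_div_of_le (by linarith) (by linarith)).trans (le_max_right _ _))
    Prod.fst hL (d := d) (fun z => ?_) (fun z => (hz z).trans ?_) hdeg
    (D := Prod.fst ⁻¹' D) (A := Prod.fst ⁻¹' A) (A' := Prod.fst ⁻¹' A') (B := Prod.fst ⁻¹' B)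
    (B' := Prod.fst ⁻¹' B') (finite_preimage_fst hD)
    (fun u hu v hv huv => ?_) (fun a ha v hv hav => ?_) (hBB.preimage _)
    (fun P Q hP hQ hPA hQB => ?_) k
  · refine key.trans (add_le_add ?_ le_rfl)
    exact mul_le_mul_of_nonneg_left hδ' (by positivity)
  · exact encard_incident_le hdeg (hz z)
  · exact_mod_cast Nat.le_mul_of_pos_right _ hL
  · have := connIn_column hS hu huv
    exact this
  · rw [Set.mem_preimage, hav]
    exact ha
  · obtain ⟨v, ⟨x, hx, rfl⟩, y, hy, hxy⟩ := hlink _ _ (Set.image_subset_iff.2 hP)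
      (Set.image_subset_iff.2 hQ) (connSets_fst le_rfl hPA) (connSets_fst le_rfl hQB)
    exact ⟨x, hx, y, hy, hxy.symm⟩

theorem topVerts_disjoint_hLine {r : ℕ}
    (hr : ∀ u v, G.graph.Adj u v → |u.1.1 - v.1.1| ≤ r ∧ |u.1.2 - v.1.2| ≤ r) {n : ℕ}
    (hn : r < n) : Disjoint (G.topVerts n) (G.hLine 0) := by
  rw [Set.disjoint_left]
  rintro t ⟨-, ht⟩ ht0
  have ht0' : t.1.2 = 0 := ht0
  have hn' : (r : ℝ) < n := by exact_mod_cast hn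
  have hr0 : (0 : ℝ) ≤ r := Nat.cast_nonneg r
  rcases ht with ht | ⟨t', htt, ht'⟩
  · linarith
  · have h := (abs_le.1 (hr _ _ htt).2).1
    linarith

end Slab
end PlaneGraph

/-! ### Widening a crossing by gluing. -/

namespace PlaneGraph

section Extension
variable {G : PlaneGraph} {VS : Type*} {S : SimpleGraph VS}

theorem measureReal_le_add_diff {Ω : Type*} [MeasurableSpace Ω] {μ : Measure Ω} [IsFiniteMeasure μ]
    (A B : Set Ω) : μ.real A ≤ μ.real B + μ.real (A \ B) :=
  (measureReal_mono (by simp : A ⊆ B ∪ A \ B)).trans (measureReal_union_le _ _)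

/-- The chance that a crossing of a rectangle of width `w` cannot be extended to width `w + j` is
bounded by a power of the chance that the rectangle of size `2 n × n` is not crossed. -/
theorem exists_extension_bound [Finite VS] (hG : G.IsSymmetric) (hlf : G.IsLocallyFinite)
    (hS : S.Connected) {p₀ p₁ q : ℝ} (h0 : 0 < p₀) (h1 : p₁ < 1) (hq : 1 ≤ q) :
    ∃ (C b : ℝ) (n₀ : ℕ), 1 ≤ C ∧ 0 < b ∧ 2 ≤ n₀ ∧ ∀ p, p₀ ≤ p → p ≤ p₁ →
      ∀ φ : Measure (Config (G.slab S)), IsUniqueInfiniteVolume (G.slab S) p q φ →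
      ∀ n w j : ℕ, n₀ ≤ n → 2 * n ≤ w → 2 * j ≤ n →
      φ.real (G.crossX S 0 (2 * n : ℕ) 0 n) < 1 →
      φ.real (G.crossX S 0 w 0 n) ≤ φ.real (G.crossX S 0 (w + j : ℕ) 0 n) +
        C * (1 - φ.real (G.crossX S 0 (2 * n : ℕ) 0 n)) ^ b := by
  obtain ⟨C, b, hC, hb0, hb1, hglue⟩ := exists_slab_gluing (G := G) (S := S) hG hlf hS h0 h1 hq
  obtain ⟨r, hr1, hr⟩ := exists_displacement_le hG hlf
  refine ⟨C + C * (1 + C) ^ b, b * b, r + 1, ?_, by positivity, by omega,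
    fun p hp hp' φ hφ n w j hn hw hj hlt => ?_⟩
  · have : (0 : ℝ) ≤ (1 + C) ^ b := by positivity
    nlinarith
  have hp0 : 0 ≤ p := h0.le.trans hp
  have hp1 : p ≤ 1 := hp'.trans h1.le
  have hinv := isSlabInvariant_of_unique hp0 hp1 (by linarith) hφ
  obtain ⟨hprob, Λ, ξ, hΛ, hlim⟩ := (isInfiniteVolume_iff hp0 hp1 (by linarith)).1 hφ.1
  replace hglue := hglue p hp hp' Λ ξ φ hprob hΛ hlim
  set ε := 1 - φ.real (G.crossX S 0 (2 * n : ℕ) 0 n) with hε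
  have hε0 : 0 < ε := by linarith
  have hε1 : ε ≤ 1 := by
    have : 0 ≤ φ.real (G.crossX S 0 (2 * n : ℕ) 0 n) := measureReal_nonneg
    linarith
  have hfin := rectVerts_finite hlf
  have hloc : ∀ {a b c d A B}, IsLocal (G.slabEvent S (G.rectVerts a b c d) A B) :=
    isLocal_slabEvent (hfin _ _ _ _)
  have hcompl : ∀ {A : Set (Config (G.slab S))}, IsLocal A → φ.real Aᶜ = 1 - φ.real A :=
    fun hA => probReal_compl_eq_one_sub hA.measurableSet
  have hdisj := topVerts_disjoint_hLine hr (n := n) (by omega)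
  set c := w + j - 2 * n with hc
  have hcw : c + 2 * n = w + j := by omega
  -- `R` and `L` are the half-planes to the right and to the left of x = w − n/2, the vertical axis
  -- of the square [w − n, w] × [0, n].
  set R := {v : G.verts | ((2 * w - n : ℕ) : ℝ) / 2 ≤ v.1.1} with hR
  set L := {v : G.verts | v.1.1 ≤ ((2 * w - n : ℕ) : ℝ) / 2} with hL
  have hs : ((2 * w - n : ℕ) : ℝ) = 2 * w - n := by
    rw [Nat.cast_sub (by omega)]; push_cast; ring
  have hwn : ((w - n : ℕ) : ℝ) = w - n := Nat.cast_sub (by omega)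
  have hcc : (c : ℝ) = w + j - 2 * n := by
    rw [hc, Nat.cast_sub (by omega)]; push_cast; ring
  have hjn : 2 * (j : ℝ) ≤ n := by exact_mod_cast hj
  have hn0 : (0 : ℝ) < n := by exact_mod_cast (by omega)
  -- a vertical crossing ends on the right half of the top with good probability
  have hU : φ.real (G.slabEvent S (G.rectVerts (w - n : ℕ) w 0 n) (G.hLine 0)
      (G.topVerts n ∩ R))ᶜ ≤ ε ^ (1 / 2 : ℝ) := by
    set U₁ := G.slabEvent S (G.rectVerts (w - n : ℕ) w 0 n) (G.hLine 0) (G.topVerts n ∩ R)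
    set U₂ := G.slabEvent S (G.rectVerts (w - n : ℕ) w 0 n) (G.hLine 0) (G.topVerts n ∩ L) with hU₂
    have heq : φ.real U₁ = φ.real U₂ := by
      obtain ⟨τ, hτ⟩ := exists_iso_reflect hG (2 * w - n)
      refine hinv.slabEvent τ (hfin _ _ _ _) ?_ ?_ ?_
      · ext v
        simp only [rectVerts, Set.mem_ofPred_eq, Set.mem_preimage, hτ, Set.mem_prod, Set.mem_Icc]
        rw [hs, hwn]
        constructor <;> rintro ⟨⟨_, _⟩, _, _⟩ <;> refine ⟨⟨?_, ?_⟩, ?_, ?_⟩ <;> linarith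
      · ext v
        simp only [hLine, Set.mem_ofPred_eq, Set.mem_preimage, hτ]
      · have hadj : ∀ u v, G.graph.Adj (τ u) v ↔ G.graph.Adj u (τ.symm v) := fun u v => by
          rw [← τ.map_adj_iff (w := τ.symm v), τ.apply_symm_apply]
        ext v
        simp only [topVerts, hR, hL, Set.mem_inter_iff, Set.mem_ofPred_eq, Set.mem_preimage, hτ]
        refine and_congr (and_congr_right fun _ => or_congr_right ?_) ?_
        · constructor
          · rintro ⟨t, ht, htn⟩
            exact ⟨τ t, τ.map_adj_iff.2 ht, by rw [hτ]; exact htn⟩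
          · rintro ⟨t, ht, htn⟩
            refine ⟨τ.symm t, (hadj _ _).1 ht, ?_⟩
            have := hτ (τ.symm t)
            rw [τ.apply_symm_apply] at this
            rw [this] at htn
            exact htn
        · rw [hs]
          constructor <;> intro _ <;> linarith
    have hY : 1 - ε ≤ φ.real (U₁ ∪ U₂) := by
      have h2 := hinv.crossX_le_crossY hG hlf (w - n) n (by omega)
      rw [show w - n + n = w by omega] at h2
      have h3 : G.crossY S (w - n : ℕ) w n ⊆ U₁ ∪ U₂ := by
        rintro ω ⟨x, hx, y, hy, hxy⟩
        rcases le_total (((2 * w - n : ℕ) : ℝ) / 2) y.1.1.1 with h | h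
        · exact .inl ⟨x, hx, y, ⟨hy, h⟩, hxy⟩
        · exact .inr ⟨x, hx, y, ⟨hy, h⟩, hxy⟩
      have h4 : φ.real (G.crossY S (w - n : ℕ) w n) ≤ φ.real (U₁ ∪ U₂) := measureReal_mono h3
      linarith
    -- The square-root trick: `U₁` and `U₂` are increasing, equally likely by reflection, and one of
    -- them occurs with probability at least 1 − ε. By FKG, (1 − P(U₁))² ≤ ε.
    have hfkg := hlim.mul_le hp0 hp1 hq (hloc : IsLocal U₁) (hloc : IsLocal U₂)
      isUpperSet_connEvent isUpperSet_connEvent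
    have hadd := measureReal_union_add_inter (μ := φ) (s := U₁) (t := U₂)
      (hloc : IsLocal U₂).measurableSet
    rw [hcompl hloc, ← Real.sqrt_eq_rpow]
    refine Real.le_sqrt_of_sq_le ?_
    rw [← heq] at hfkg hadd
    calc (1 - φ.real U₁) ^ 2 = 1 - 2 * φ.real U₁ + φ.real U₁ * φ.real U₁ := by ring
      _ ≤ ε := by linarith
  -- extension to the corner
  have h1' : φ.real (G.crossX S 0 w 0 n \ G.slabEvent S (G.rectVerts 0 w 0 n) (G.vLine 0)
      (G.topVerts n ∩ R)) ≤ C * (ε ^ (1 / 2 : ℝ)) ^ b := by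
    -- A crossing of the wide rectangle and a path from its top right part to its bottom meet in
    -- projection; gluing connects the left side to that part of the top.
    refine hglue _ _ _ _ (G.hLine 0) (hfin _ _ _ _) (hdisj.mono_left Set.inter_subset_left)
      (fun P Q hP hQ hPA hQB => ?_) _ (by positivity) ((measureReal_mono ?_).trans hU)
    · exact exists_common_of_crossing hG (a := 0) (b := w) (n := n)
        (fun v hv => by rw [Nat.cast_zero]; exact hP hv)
        (fun v hv => by rw [Nat.cast_zero]; exact hQ hv) (by rw [Nat.cast_zero]; exact hPA)
        (hQB.symm.mono (fun _ _ _ _ h => h) le_rfl Set.inter_subset_left fun v hv => hv.1.1)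
    · rw [slabEvent_symm]
      refine Set.compl_subset_compl.2 (slabEvent_mono (fun v hv => ⟨⟨?_, hv.1.2⟩, hv.2⟩)
        Set.inter_subset_left Set.inter_subset_left)
      exact (Nat.cast_nonneg _).trans hv.1.1
  -- In the same way the right side x = w + j is joined to the left part of the top, by gluing a
  -- crossing of [c, w + j] to a vertical crossing of [c, c + n]. The latter ends at x ≤ w + j − n ≤
  -- w − n/2, because 2j ≤ n.
  have h2' : φ.real (G.slabEvent S (G.rectVerts c (w + j : ℕ) 0 n) (G.vLine (w + j : ℕ))
      (G.topVerts n ∩ L))ᶜ ≤ ε + C * ε ^ b := by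
    have hX : φ.real (G.slabEvent S (G.rectVerts c (w + j : ℕ) 0 n) (G.vLine (w + j : ℕ))
        (G.vLine c)) = 1 - ε := by
      rw [slabEvent_symm, ← hcw]
      have := hinv.crossX_translate hG hlf c (2 * n) n
      rw [crossX] at this
      rw [this, hε]
      ring
    have h3 := measureReal_le_add_diff (μ := φ) (G.slabEvent S (G.rectVerts c (w + j : ℕ) 0 n)
      (G.vLine (w + j : ℕ)) (G.vLine c)) (G.slabEvent S (G.rectVerts c (w + j : ℕ) 0 n)
      (G.vLine (w + j : ℕ)) (G.topVerts n ∩ L))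
    have h4 := hglue (G.rectVerts c (w + j : ℕ) 0 n) (G.vLine (w + j : ℕ)) (G.vLine c)
      (G.topVerts n ∩ L) (G.hLine 0) (hfin _ _ _ _) (hdisj.mono_left Set.inter_subset_left)
      (fun P Q hP hQ hPA hQB => ?_) ε hε0 ?_
    · rw [hcompl hloc]
      linarith
    · exact exists_common_of_crossing hG (a := c) (b := w + j) (n := n)
        (fun v hv => hP hv) (fun v hv => hQ hv) hPA.symm
        (hQB.symm.mono (fun _ _ _ _ h => h) le_rfl Set.inter_subset_left fun v hv => hv.1.1)
    · have h5 := hinv.crossX_le_crossY hG hlf c n (by omega)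
      have h6 : G.crossY S c (c + n : ℕ) n ⊆ G.slabEvent S (G.rectVerts c (w + j : ℕ) 0 n)
          (G.topVerts n ∩ L) (G.hLine 0) := by
        rw [crossY, slabEvent_symm]
        refine slabEvent_mono (fun v hv => ⟨⟨hv.1.1, hv.1.2.trans ?_⟩, hv.2⟩)
          (fun v hv => ⟨hv.1, ?_⟩) Set.inter_subset_left
        · exact_mod_cast (by omega)
        · have h7 := hv.2.1.2
          push_cast at h7
          change v.1.1 ≤ ((2 * w - n : ℕ) : ℝ) / 2
          rw [hs]
          linarith
      have h7 : φ.real (G.crossY S c (c + n : ℕ) n) ≤ _ := measureReal_mono h6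
      rw [hcompl hloc]
      linarith
  -- passing the corner
  have h3' : φ.real (G.slabEvent S (G.rectVerts 0 (w + j : ℕ) 0 n) (G.vLine 0)
      (G.topVerts n ∩ R) \ G.crossX S 0 (w + j : ℕ) 0 n) ≤ C * (ε + C * ε ^ b) ^ b := by
    -- The path from the left ends on the top to the right of the path from the right, so their
    -- projections meet; a third gluing joins the two vertical sides.
    refine hglue _ _ _ _ (G.topVerts n ∩ L) (hfin _ _ _ _) ?_
      (fun P Q hP hQ hPA hQB => ?_) _ (by positivity) ((measureReal_mono ?_).trans h2')
    · rw [Set.disjoint_left]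
      rintro v hv ⟨-, hv'⟩
      have e1 : v.1.1 = ((w + j : ℕ) : ℝ) := hv
      have e2 : v.1.1 ≤ ((2 * w - n : ℕ) : ℝ) / 2 := hv'
      push_cast at e1
      rw [hs] at e2
      have : (0 : ℝ) ≤ j := Nat.cast_nonneg j
      linarith
    · exact exists_common_of_corner hG (a := 0) (b := w + j) (n := n) (s := 2 * w - n)
        (fun v hv => by rw [Nat.cast_zero]; exact hP hv)
        (fun v hv => by rw [Nat.cast_zero]; exact hQ hv) (by rw [Nat.cast_zero]; exact hPA) hQB
    · refine Set.compl_subset_compl.2 (slabEvent_mono (fun v hv => ⟨⟨?_, hv.1.2⟩, hv.2⟩)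
        Set.inter_subset_left Set.inter_subset_left)
      exact (Nat.cast_nonneg _).trans hv.1.1
  have hsub : G.slabEvent S (G.rectVerts 0 w 0 n) (G.vLine 0) (G.topVerts n ∩ R) ⊆
      G.slabEvent S (G.rectVerts 0 (w + j : ℕ) 0 n) (G.vLine 0) (G.topVerts n ∩ R) := by
    refine slabEvent_mono (fun v hv => ⟨⟨hv.1.1, hv.1.2.trans ?_⟩, hv.2⟩)
      Set.inter_subset_left Set.inter_subset_left
    exact_mod_cast Nat.le_add_right _ _
  have h4' := measureReal_le_add_diff (μ := φ) (G.crossX S 0 w 0 n)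
    (G.slabEvent S (G.rectVerts 0 w 0 n) (G.vLine 0) (G.topVerts n ∩ R))
  have h5' := measureReal_le_add_diff (μ := φ) (G.slabEvent S (G.rectVerts 0 (w + j : ℕ) 0 n)
    (G.vLine 0) (G.topVerts n ∩ R)) (G.crossX S 0 (w + j : ℕ) 0 n)
  have h6' := measureReal_mono (μ := φ) hsub
  -- Since b ≤ 1/2 and ε ≤ 1, all errors are bounded by multiples of ε^(b²).
  have e1 : (ε ^ (1 / 2 : ℝ)) ^ b ≤ ε ^ (b * b) := by
    rw [← Real.rpow_mul hε0.le]
    exact Real.rpow_le_rpow_of_exponent_ge hε0 hε1 (by nlinarith)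
  have e2 : (ε + C * ε ^ b) ^ b ≤ (1 + C) ^ b * ε ^ (b * b) := by
    rw [Real.rpow_mul hε0.le, ← Real.mul_rpow (by positivity) (by positivity)]
    refine Real.rpow_le_rpow (by positivity) ?_ hb0.le
    have : ε ≤ ε ^ b := by
      nth_rewrite 1 [← Real.rpow_one ε]
      exact Real.rpow_le_rpow_of_exponent_ge hε0 hε1 (by linarith)
    linarith
  have e3 := mul_le_mul_of_nonneg_left e1 (by linarith : (0 : ℝ) ≤ C)
  have e4 := mul_le_mul_of_nonneg_left e2 (by linarith : (0 : ℝ) ≤ C)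
  calc φ.real (G.crossX S 0 w 0 n) ≤ φ.real (G.crossX S 0 (w + j : ℕ) 0 n) +
      (C * ε ^ (b * b) + C * ((1 + C) ^ b * ε ^ (b * b))) := by linarith
    _ = _ := by ring

/-- Go from `m` to `w` in steps of length `j`, the last one possibly shorter; each step loses at
most `g`. -/
theorem le_add_of_steps {P : ℕ → ℝ} {g : ℝ} {m j : ℕ} (hg : 0 ≤ g)
    (h : ∀ w i, m ≤ w → i ≤ j → P w ≤ P (w + i) + g) (J w : ℕ) (hw : m ≤ w)
    (hw' : w ≤ m + J * j) : P m ≤ P w + J * g := by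
  induction J generalizing w with
  | zero =>
    obtain rfl : w = m := by omega
    simp
  | succ J ih =>
    push_cast
    rcases le_or_gt w (m + J * j) with h1 | h1
    · have := ih w hw h1
      linarith
    · have h2 := ih (m + J * j) (by omega) le_rfl
      rw [add_mul, one_mul] at hw'
      have h3 := h (m + J * j) (w - (m + J * j)) (by omega) (by omega)
      rw [show m + J * j + (w - (m + J * j)) = w by omega] at h3
      linarith

end Extension
end PlaneGraph

/-! ### Long open paths at small edge parameters -/

section PathCounting
variable {W : Type*} {H : SimpleGraph W}

theorem nodup_listEdges {l : List W} (h : l.Nodup) : (listEdges l).Nodup := by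
  induction l with
  | nil => simp [listEdges]
  | cons a l ih =>
    cases l with
    | nil => simp [listEdges]
    | cons b l =>
      rw [listEdges, List.nodup_cons]
      refine ⟨fun hm => ?_, ih h.of_cons⟩
      exact (List.nodup_cons.1 h).1 (mem_of_mem_listEdges hm (Sym2.mem_mk_left a b))

theorem length_listEdges (a : W) (l : List W) : (listEdges (a :: l)).length = l.length := by
  induction l generalizing a with
  | nil => simp [listEdges]
  | cons b l ih => rw [listEdges, List.length_cons, ih, List.length_cons]

/-- The walks with `k` steps that start at `v`. -/
def walksFrom (H : SimpleGraph W) (v : W) (k : ℕ) : Set (List W) :=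
  {l | l.IsChain H.Adj ∧ l.head? = some v ∧ l.length = k + 1}

theorem encard_walksFrom_le {L : ℕ} (hdeg : ∀ u, {v | H.Adj u v}.encard ≤ L) (v : W) (k : ℕ) :
    (walksFrom H v k).encard ≤ (L ^ k : ℕ) := by
  induction k generalizing v with
  | zero =>
    have : walksFrom H v 0 ⊆ {[v]} := by
      rintro l ⟨-, h2, h3⟩
      obtain ⟨a, rfl⟩ := List.length_eq_one_iff.1 h3
      simpa using h2
    exact (Set.encard_le_encard this).trans (by simp)
  | succ k ih =>
    have hfin : {w | H.Adj v w}.Finite := Set.finite_of_encard_le_coe (hdeg v)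
    have : walksFrom H v (k + 1) ⊆ ⋃ w ∈ {w | H.Adj v w}, (fun l => v :: l) '' walksFrom H w k := by
      rintro l ⟨h1, h2, h3⟩
      match l, h1, h2, h3 with
      | a :: b :: t, h1, h2, h3 =>
        obtain rfl : a = v := by simpa using h2
        rw [List.isChain_cons_cons] at h1
        exact Set.mem_biUnion h1.1 ⟨b :: t, ⟨h1.2, rfl, by simpa using h3⟩, rfl⟩
    refine (Set.encard_le_encard this).trans ?_
    rw [← hfin.coe_toFinset]
    refine (Finset.set_encard_biUnion_le _ _).trans ?_
    refine (Finset.sum_le_sum fun w _ => (Set.encard_image_le _ _).trans (ih w)).trans ?_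
    rw [Finset.sum_const, nsmul_eq_mul, ← Set.encard_coe_eq_coe_finsetCard, hfin.coe_toFinset,
      pow_succ']
    push_cast
    exact mul_le_mul_left (hdeg v) _

/-- The probability of an open self-avoiding path with `k` steps that starts in `X`. -/
theorem edgeLaw_openPath_le {p : unitInterval} {L m : ℕ} (hdeg : ∀ u, {v | H.Adj u v}.encard ≤ L)
    {X : Set W} (hX : X.encard ≤ m) (k : ℕ) {A : Set (Config H)}
    (hA : ∀ ω ∈ A, ∃ v ∈ X, ∃ l ∈ walksFrom H v k, l.Nodup ∧ l.IsChain (openGraph ω).Adj) :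
    (edgeLaw H.edgeSet p).real A ≤ m * (L * p : ℝ) ^ k := by
  classical
  have hXfin : X.Finite := Set.finite_of_encard_le_coe hX
  have hwfin : ∀ v, (walksFrom H v k).Finite :=
    fun v => Set.finite_of_encard_le_coe (encard_walksFrom_le hdeg v k)
  let ℓ : W → Finset (List W) := fun v => (hwfin v).toFinset.filter List.Nodup
  have hcard : ∀ v, (ℓ v).card ≤ L ^ k := fun v => by
    refine (Finset.card_filter_le _ _).trans ?_
    have h := encard_walksFrom_le hdeg v k
    rw [← (hwfin v).coe_toFinset, Set.encard_coe_eq_coe_finsetCard] at h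
    exact_mod_cast h
  have hXcard : hXfin.toFinset.card ≤ m := by
    rw [← hXfin.coe_toFinset, Set.encard_coe_eq_coe_finsetCard] at hX
    exact_mod_cast hX
  let E : List W → Finset H.edgeSet := fun l =>
    (listEdges l).toFinset.subtype (· ∈ H.edgeSet)
  have hE : ∀ v, ∀ l ∈ ℓ v, (edgeLaw H.edgeSet p).real {ω | ∀ e ∈ E l, ω e = true} = (p : ℝ) ^ k := by
    intro v l hl
    obtain ⟨hl, hnd⟩ := Finset.mem_filter.1 hl
    obtain ⟨hc, -, hlen⟩ := (hwfin v).mem_toFinset.1 hl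
    rw [edgeLaw_all_open]
    congr 1
    have h1 : (E l).card = (listEdges l).toFinset.card := by
      simp only [E, Finset.card_subtype]
      rw [Finset.filter_true_of_mem]
      intro e he
      exact isChain_iff_listEdges.1 hc e (List.mem_toFinset.1 he)
    rw [h1, List.toFinset_card_of_nodup (nodup_listEdges hnd)]
    cases l with
    | nil => simp at hlen
    | cons a l => rw [length_listEdges]; simpa using hlen
  have hsub : A ⊆ ⋃ v ∈ hXfin.toFinset, ⋃ l ∈ ℓ v, {ω | ∀ e ∈ E l, ω e = true} := by
    intro ω hω
    obtain ⟨v, hv, l, hl, hnd, hc⟩ := hA ω hω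
    simp only [Set.mem_iUnion]
    refine ⟨v, hXfin.mem_toFinset.2 hv, l,
      Finset.mem_filter.2 ⟨(hwfin v).mem_toFinset.2 hl, hnd⟩, fun e he => ?_⟩
    have h2 := isChain_iff_listEdges.1 hc e.1 (by simpa [E] using he)
    exact (mem_edgeSet_openGraph.1 h2).2
  calc (edgeLaw H.edgeSet p).real A ≤ ∑ v ∈ hXfin.toFinset, ∑ l ∈ ℓ v,
        (edgeLaw H.edgeSet p).real {ω | ∀ e ∈ E l, ω e = true} :=
      (measureReal_mono hsub (measure_ne_top _ _)).trans ((measureReal_biUnion_finset_le _ _).trans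
        (Finset.sum_le_sum fun v _ => measureReal_biUnion_finset_le _ _))
    _ = ∑ v ∈ hXfin.toFinset, ((ℓ v).card : ℝ) * (p : ℝ) ^ k := by
      refine Finset.sum_congr rfl fun v _ => ?_
      rw [Finset.sum_congr rfl (hE v), Finset.sum_const, nsmul_eq_mul]
    _ ≤ ∑ v ∈ hXfin.toFinset, (L : ℝ) ^ k * (p : ℝ) ^ k := by
      refine Finset.sum_le_sum fun v _ => mul_le_mul_of_nonneg_right ?_ (pow_nonneg p.2.1 _)
      exact_mod_cast hcard v
    _ ≤ m * (L * p : ℝ) ^ k := by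
      rw [Finset.sum_const, nsmul_eq_mul, mul_pow]
      refine mul_le_mul_of_nonneg_right (by exact_mod_cast hXcard) ?_
      exact mul_nonneg (by positivity) (pow_nonneg p.2.1 _)

theorem abs_sub_le_of_isChain {f : W → ℝ} {r : ℝ} (hf : ∀ u v, H.Adj u v → |f u - f v| ≤ r)
    {l : List W} {x y : W} (hc : (x :: l).IsChain H.Adj) (hy : (x :: l).getLast? = some y) :
    |f x - f y| ≤ r * l.length := by
  induction l generalizing x with
  | nil =>
    obtain rfl : x = y := by simpa using hy
    simp
  | cons b l ih =>
    rw [List.isChain_cons_cons] at hc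
    have h1 := ih hc.2 (by simpa using hy)
    have h2 := hf _ _ hc.1
    have h3 := abs_sub_le (f x) (f b) (f y)
    rw [List.length_cons]
    push_cast
    linarith

end PathCounting

namespace PlaneGraph
variable {G : PlaneGraph} {VS : Type*} {S : SimpleGraph VS}

/-- At small edge parameters the crossing probabilities are small. -/
theorem exists_crossX_le_half [Finite VS] [Nonempty VS] (S : SimpleGraph VS) (hG : G.IsSymmetric)
    (hlf : G.IsLocallyFinite) {q : ℝ} (hq : 1 ≤ q) :
    ∃ p₀ : ℝ, 0 < p₀ ∧ p₀ < 1 ∧ ∀ p, 0 ≤ p → p ≤ p₀ → ∀ φ : Measure (Config (G.slab S)),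
      IsUniqueInfiniteVolume (G.slab S) p q φ → ∀ n : ℕ, 1 ≤ n →
        φ.real (G.crossX S 0 (2 * n : ℕ) 0 n) ≤ 1 / 2 := by
  obtain ⟨L, hL, hdeg⟩ := exists_slab_degree_le S hG hlf
  obtain ⟨r, hr1, hr⟩ := exists_displacement_le hG hlf
  obtain ⟨c, hc1, hc⟩ := exists_encard_rectVerts_le hG hlf
  set c' := c * Nat.card VS with hc'
  have hc'1 : (1 : ℝ) ≤ c' := by
    exact_mod_cast Nat.mul_pos hc1 Nat.card_pos
  have hL1 : (1 : ℝ) ≤ L := by exact_mod_cast hL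
  -- With c'(n + 1) ≤ c' 2^n possible starting vertices and L p ≤ s^r, the expected number of long
  -- open paths is at most c' (1/(2c'))^n ≤ 1/2.
  set s : ℝ := 1 / (4 * c') with hs
  have hs0 : 0 < s := by positivity
  have hs1 : s ≤ 1 / 4 := by
    rw [hs]
    exact one_div_le_one_div_of_le (by norm_num) (by linarith)
  have hsr : s ^ r ≤ 1 / 4 := (pow_le_of_le_one hs0.le (by linarith) (by omega)).trans hs1
  refine ⟨s ^ r / L, by positivity, ?_, fun p hp0 hp φ hφ n hn => ?_⟩
  · rw [div_lt_one (by linarith)]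
    linarith
  have hLp : L * p ≤ s ^ r := by
    rw [le_div_iff₀ (by linarith)] at hp
    linarith
  have hp1 : p ≤ 1 := by nlinarith
  obtain ⟨-, Λ, ξ, hΛ, hlim⟩ := (isInfiniteVolume_iff hp0 hp1 (by linarith)).1 hφ.1
  have hloc : IsLocal (G.crossX S 0 (2 * n : ℕ) 0 n) :=
    isLocal_slabEvent (rectVerts_finite hlf _ _ _ _)
  refine (hlim.le_edgeLaw hΛ ⟨hp0, hp1⟩ hq hloc isUpperSet_connEvent).trans ?_
  -- The ceiling of 2n/r: the least number of steps that can cover the horizontal distance 2n.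
  set k := (2 * n + r - 1) / r with hk
  have hk1 : 2 * n ≤ r * k := by
    have := Nat.div_add_mod (2 * n + r - 1) r
    have := Nat.mod_lt (2 * n + r - 1) (show r > 0 by omega)
    rw [← hk] at *
    omega
  have hk2 : ∀ m, 2 * n ≤ r * m → k ≤ m := by
    intro m hm
    rw [hk, Nat.div_le_iff_le_mul_add_pred (by omega)]
    omega
  have hX : (Prod.fst ⁻¹' G.rectVerts 0 (0 : ℕ) 0 n : Set (G.verts × VS)).encard ≤
      (c' * (n + 1) : ℕ) := by
    rw [encard_column]
    refine (mul_le_mul_left (hc 0 n) _).trans ?_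
    rw [hc']
    norm_cast
    apply le_of_eq
    ring
  have hdisp : ∀ u v : G.verts × VS, (G.slab S).Adj u v → |u.1.1.1 - v.1.1.1| ≤ r := by
    intro u v huv
    rcases SimpleGraph.boxProd_adj.1 huv with ⟨h, -⟩ | ⟨-, h⟩
    · exact (hr _ _ h).1
    · rw [h]
      simp
  have key := edgeLaw_openPath_le (p := ⟨p, hp0, hp1⟩) hdeg hX k
    (A := G.crossX S 0 (2 * n : ℕ) 0 n) ?_
  · refine key.trans ?_
    have h1 : (L * p) ^ k ≤ s ^ n := by
      calc (L * p) ^ k ≤ (s ^ r) ^ k := pow_le_pow_left₀ (by positivity) hLp k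
        _ = s ^ (r * k) := (pow_mul s r k).symm
        _ ≤ s ^ n := pow_le_pow_of_le_one hs0.le (by linarith) (by omega)
    have h2 : ((n + 1 : ℕ) : ℝ) ≤ 2 ^ n := by exact_mod_cast Nat.lt_two_pow_self
    calc ((c' * (n + 1) : ℕ) : ℝ) * (L * p) ^ k ≤ (c' * 2 ^ n) * s ^ n := by
          rw [Nat.cast_mul]
          exact mul_le_mul (mul_le_mul_of_nonneg_left h2 (by linarith)) h1 (by positivity)
            (by positivity)
      _ = c' * (1 / (2 * c')) ^ n := by
          rw [mul_assoc, ← mul_pow, hs]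
          congr 2
          field_simp
          norm_num
      _ ≤ c' * (1 / (2 * c')) := by
          refine mul_le_mul_of_nonneg_left (pow_le_of_le_one (by positivity) ?_ (by omega))
            (by linarith)
          rw [div_le_one (by linarith)]
          linarith
      _ = 1 / 2 := by field_simp
  · rintro ω ⟨x, hx, y, hy, hxy⟩
    obtain ⟨l, hnd, hch, hD, hhd, hlast⟩ := hxy.exists_list
    have hx0 : x.1.1.1 = 0 := hx
    have hy0 : y.1.1.1 = (2 * n : ℕ) := hy
    match l, hnd, hch, hD, hhd, hlast with
    | a :: l, hnd, hch, hD, hhd, hlast =>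
    obtain rfl : a = x := by simpa using hhd
    have h1 := abs_sub_le_of_isChain (f := fun v => v.1.1.1)
      (fun u v huv => hdisp u v (openGraph_le ω huv)) hch hlast
    simp only [hx0, hy0, zero_sub, abs_neg, Nat.abs_cast] at h1
    have h2 := hk2 l.length (by exact_mod_cast h1)
    have hch' := hch.take (k + 1)
    refine ⟨a, ⟨⟨hx0.ge, by rw [hx0]; simp⟩, hxy.left_mem.2⟩, (a :: l).take (k + 1),
      ⟨hch'.imp fun _ _ h => openGraph_le ω h, by simp, ?_⟩,
      hnd.sublist (List.take_sublist _ _), hch'⟩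
    simp only [List.length_take, List.length_cons]
    omega

end PlaneGraph

/-! ### Independent edges in a planar layer -/

section FullConfig
variable {ι : Type*}

/-- If all edges of `F` are open, the event occurs; otherwise one of them is closed, and the union
bound applies. -/
theorem one_sub_edgeLaw_le {p : unitInterval} {F : Finset ι} {A : Set (ι → Bool)}
    (hA : DeterminedBy (F : Set ι) A) (hfull : (fun _ => true) ∈ A) :
    1 - (edgeLaw ι p).real A ≤ F.card * (1 - p : ℝ) := by
  rw [← probReal_compl_eq_one_sub hA.measurableSet]
  refine (measureReal_mono fun ω hω => ?_).trans (edgeLaw_exists_closed_le F)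
  by_contra hcon
  refine hω (hA _ _ (fun e he => ?_) hfull)
  by_contra hne
  exact hcon ⟨e, he, by simpa using Ne.symm hne⟩

theorem full_mem_of_nonempty {A : Set (ι → Bool)} (hA : IsUpperSet A) (h : A.Nonempty) :
    (fun _ => true) ∈ A := by
  obtain ⟨ω, hω⟩ := h
  exact hA (fun _ => Bool.le_true _) hω

end FullConfig

namespace PlaneGraph
section Planar
variable {G : PlaneGraph} {VS : Type*} {S : SimpleGraph VS}

theorem isUpperSet_crossX {a b c d : ℝ} : IsUpperSet (G.crossX S a b c d) := isUpperSet_connEvent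

theorem isLocal_crossX [Finite VS] (hlf : G.IsLocallyFinite) {a b c d : ℝ} :
    IsLocal (G.crossX S a b c d) :=
  isLocal_slabEvent (rectVerts_finite hlf _ _ _ _)

theorem crossX_mono_height {a b c d c' d' : ℝ} (hc : c' ≤ c) (hd : d ≤ d') :
    G.crossX S a b c d ⊆ G.crossX S a b c' d' :=
  slabEvent_mono (fun _ hv => ⟨hv.1, hc.trans hv.2.1, hv.2.2.trans hd⟩)
    Set.inter_subset_left Set.inter_subset_left

/-- In a single layer, long rectangles are crossed with good probability. -/
theorem one_sub_crossX_le [Finite VS] [Subsingleton VS] (hG : G.IsSymmetric)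
    (hlf : G.IsLocallyFinite) {μ : Measure (Config (G.slab S))} [IsProbabilityMeasure μ]
    (h : IsSlabInvariant μ) {n : ℕ} (hn : 1 ≤ n) (J w : ℕ) (hw : 2 * n ≤ w)
    (hw' : w ≤ 2 * n + J * n) :
    1 - μ.real (G.crossX S 0 w 0 n) ≤
      (1 + 2 * J) * (1 - μ.real (G.crossX S 0 (2 * n : ℕ) 0 n)) := by
  set u := 1 - μ.real (G.crossX S 0 (2 * n : ℕ) 0 n) with hu
  have hu0 : 0 ≤ u := by
    have : μ.real (G.crossX S 0 (2 * n : ℕ) 0 n) ≤ 1 := measureReal_le_one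
    linarith
  have key := le_add_of_steps (P := fun w => μ.real (G.crossX S 0 w 0 n)) (g := 2 * u) (m := 2 * n)
    (j := n) (by linarith) (fun w j hw hj => ?_) J w hw hw'
  · linarith
  · have h1 := measureReal_le_add_diff (μ := μ) (G.crossX S 0 w 0 n) (G.crossX S 0 (w + j : ℕ) 0 n)
    set Y := G.crossY S (w - n : ℕ) ((w - n : ℕ) + n : ℕ) n
    set X := G.crossX S (w + j - 2 * n : ℕ) ((w + j - 2 * n : ℕ) + 2 * n : ℕ) 0 n with hX
    have h2 : G.crossX S 0 w 0 n \ G.crossX S 0 (w + j : ℕ) 0 n ⊆ Yᶜ ∪ Xᶜ := by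
      rintro ω ⟨h3, h4⟩
      by_contra hcon
      rw [Set.mem_union, not_or, Set.notMem_compl_iff, Set.notMem_compl_iff] at hcon
      exact h4 (crossX_inter_subset hG hw hj ⟨h3, hcon⟩)
    have h3 := (measureReal_mono (μ := μ) h2).trans (measureReal_union_le _ _)
    have hYloc : IsLocal Y := isLocal_slabEvent (rectVerts_finite hlf _ _ _ _)
    have hXloc : IsLocal X := isLocal_crossX hlf
    rw [probReal_compl_eq_one_sub hYloc.measurableSet,
      probReal_compl_eq_one_sub hXloc.measurableSet, hX, h.crossX_translate hG hlf] at h3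
    have h4 := h.crossX_le_crossY hG hlf (w - n) n hn
    linarith

/-- The heights [0, n] and [n + 1, 2n + 1] fit into [0, n'] and depend on disjoint edges, so both
strips fail independently. As 2n' ≤ 4n + 4 ≤ 8n, six extensions by n reach the width 2n', whence the
constant 13 = 1 + 2·6. -/
theorem crossX_recursion [Finite VS] [Subsingleton VS] (hG : G.IsSymmetric)
    (hlf : G.IsLocallyFinite) (p : unitInterval) {n n' : ℕ} (hn : 1 ≤ n) (h1 : 2 * n + 1 ≤ n')
    (h2 : n' ≤ 2 * n + 2) :
    1 - (edgeLaw (G.slab S).edgeSet p).real (G.crossX S 0 (2 * n' : ℕ) 0 n') ≤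
      (13 * (1 - (edgeLaw (G.slab S).edgeSet p).real (G.crossX S 0 (2 * n : ℕ) 0 n))) ^ 2 := by
  set μ := edgeLaw (G.slab S).edgeSet p
  have hinv : IsSlabInvariant μ := isSlabInvariant_edgeLaw p
  have h3 := one_sub_crossX_le hG hlf hinv hn 6 (2 * n') (by omega) (by omega)
  set S₀ := G.crossX S 0 (2 * n' : ℕ) 0 n
  set S₁ := G.crossX S 0 (2 * n' : ℕ) (n + 1 : ℕ) ((n + 1 : ℕ) + n) with hS₁
  have hS₁0 : μ.real S₁ = μ.real S₀ := hinv.crossX_translate_up hG hlf _ _ _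
  have hloc : ∀ {a b c d : ℝ}, IsLocal (G.crossX S a b c d) := isLocal_crossX hlf
  have hsub : (G.crossX S 0 (2 * n' : ℕ) 0 n')ᶜ ⊆ S₀ᶜ ∩ S₁ᶜ := by
    rw [← Set.compl_union, Set.compl_subset_compl]
    refine Set.union_subset (crossX_mono_height le_rfl ?_) (crossX_mono_height ?_ ?_)
    · exact_mod_cast (by omega : n ≤ n')
    · exact Nat.cast_nonneg _
    · exact_mod_cast (by omega : n + 1 + n ≤ n')
  have hfin : ∀ a b c d, (edgesIn (G.slab S) (Prod.fst ⁻¹' G.rectVerts a b c d)).Finite :=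
    fun a b c d => edgesIn_finite (finite_preimage_fst (rectVerts_finite hlf _ _ _ _))
  have hdisj : Disjoint (Prod.fst ⁻¹' G.rectVerts 0 (2 * n' : ℕ) 0 n : Set (G.verts × VS))
      (Prod.fst ⁻¹' G.rectVerts 0 (2 * n' : ℕ) (n + 1 : ℕ) ((n + 1 : ℕ) + n)) := by
    rw [Set.disjoint_left]
    rintro v ⟨-, -, h4⟩ ⟨-, h5, -⟩
    push_cast at h5
    linarith
  have hmul := edgeLaw_inter (p := p) (hfin _ _ _ _) (hfin _ _ _ _) (edgesIn_disjoint hdisj)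
    (determinedBy_connEvent (H := G.slab S) (A := Prod.fst ⁻¹' G.vLine 0)
      (B := Prod.fst ⁻¹' G.vLine (2 * n' : ℕ))).compl
    (determinedBy_connEvent (H := G.slab S) (A := Prod.fst ⁻¹' G.vLine 0)
      (B := Prod.fst ⁻¹' G.vLine (2 * n' : ℕ))).compl
  change μ.real (S₀ᶜ ∩ S₁ᶜ) = μ.real S₀ᶜ * μ.real S₁ᶜ at hmul
  have h4 : μ.real (G.crossX S 0 (2 * n' : ℕ) 0 n')ᶜ ≤ μ.real (S₀ᶜ ∩ S₁ᶜ) := measureReal_mono hsub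
  rw [hmul, probReal_compl_eq_one_sub hloc.measurableSet,
    probReal_compl_eq_one_sub (hloc : IsLocal S₀).measurableSet,
    probReal_compl_eq_one_sub (hloc : IsLocal S₁).measurableSet, hS₁0] at h4
  refine h4.trans ?_
  rw [sq]
  have h5 : 0 ≤ 1 - μ.real S₀ := by
    have : μ.real S₀ ≤ 1 := measureReal_le_one
    linarith
  rw [show (1 + 2 * ((6 : ℕ) : ℝ)) = 13 by norm_num] at h3
  exact mul_le_mul h3 h3 h5 (h5.trans h3)

/-- From n' ≤ 2n + 2 one gets n' + 2 ≤ 2(n + 2), so squaring at least doubles the available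
exponent. The normalisation 4m + 2 makes the exponent at most 1 on the base range [m, 4m]. -/
theorem rpow_decay_of_recursion {u : ℕ → ℝ} {θ : ℝ} {m : ℕ} (hm : 1 ≤ m) (hθ0 : 0 < θ) (hθ1 : θ ≤ 1)
    (hu : ∀ n, 0 ≤ u n) (hbase : ∀ n, m ≤ n → n ≤ 4 * m → u n ≤ θ)
    (hrec : ∀ n n', 1 ≤ n → 2 * n + 1 ≤ n' → n' ≤ 2 * n + 2 → u n' ≤ u n ^ 2) (n : ℕ)
    (hn : m ≤ n) : u n ≤ θ ^ (((n : ℝ) + 2) / (4 * m + 2)) := by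
  induction n using Nat.strong_induction_on with
  | _ n ih =>
    have hm' : (0 : ℝ) < 4 * m + 2 := by positivity
    rcases le_or_gt n (4 * m) with h | h
    · refine (hbase n hn h).trans ?_
      nth_rewrite 1 [← Real.rpow_one θ]
      refine Real.rpow_le_rpow_of_exponent_ge hθ0 hθ1 ?_
      rw [div_le_one hm']
      have : (n : ℝ) ≤ 4 * m := by exact_mod_cast h
      linarith
    · have h1 := ih ((n - 1) / 2) (by omega) (by omega)
      refine (hrec ((n - 1) / 2) n (by omega) (by omega) (by omega)).trans ?_
      refine (pow_le_pow_left₀ (hu _) h1 2).trans ?_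
      rw [← Real.rpow_natCast, ← Real.rpow_mul hθ0.le]
      refine Real.rpow_le_rpow_of_exponent_ge hθ0 hθ1 ?_
      rw [div_mul_eq_mul_div]
      refine div_le_div_of_nonneg_right ?_ hm'.le
      have : (n : ℝ) ≤ 2 * ((n - 1) / 2 : ℕ) + 2 := by exact_mod_cast (by omega)
      push_cast
      linarith

theorem full_mem_slabEvent {D A B : Set G.verts} (h : ConnSets G.graph D A B) :
    (fun _ => true) ∈ G.slabEvent (⊥ : SimpleGraph Unit) D A B := by
  obtain ⟨a, ha, b, hb, haD, h⟩ := h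
  refine ⟨(a, ()), ha, (b, ()), hb, haD, ?_⟩
  refine Relation.ReflTransGen.lift (fun u => (u, ())) (fun u v huv => ⟨⟨?_, rfl⟩, huv.2⟩) _ _ h
  exact SimpleGraph.boxProd_adj.2 (.inl ⟨huv.1, rfl⟩)

/-- A crossing of the slab projects to a path of the plane graph, hence to a crossing of one fully
open layer. Contrapositively, if a layer can never be crossed, neither can the slab. -/
theorem full_mem_crossX_of_nonempty {a b c d : ℝ} (h : (G.crossX S a b c d).Nonempty) :
    (fun _ => true) ∈ G.crossX (⊥ : SimpleGraph Unit) a b c d := by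
  obtain ⟨ω, hω⟩ := h
  exact full_mem_slabEvent ((connSets_fst (openGraph_le ω) hω).mono (fun _ _ _ _ h => h)
    (Set.image_preimage_subset _ _) Set.inter_subset_left Set.inter_subset_left)

/-- The edges of the slab in the layer of height `s`. -/
def layerEdge (S : SimpleGraph VS) (s : VS) (e : (G.slab (⊥ : SimpleGraph Unit)).edgeSet) :
    (G.slab S).edgeSet :=
  ⟨e.1.map fun v => (v.1, s), by
    obtain ⟨e, he⟩ := e
    induction e with
    | _ x y =>
      rcases SimpleGraph.boxProd_adj.1 he with ⟨h, -⟩ | ⟨h, -⟩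
      · exact SimpleGraph.boxProd_adj.2 (.inl ⟨h, rfl⟩)
      · exact h.elim⟩

theorem layerEdge_injective (s : VS) : Function.Injective (layerEdge (G := G) S s) := by
  intro e f h
  refine Subtype.ext (Sym2.map.injective (fun u v huv => ?_) (Subtype.ext_iff.1 h))
  exact Prod.ext (Prod.ext_iff.1 huv).1 rfl

theorem layer_slabEvent_subset (s : VS) (D A B : Set G.verts) :
    (fun ω e => ω (layerEdge S s e)) ⁻¹' G.slabEvent (⊥ : SimpleGraph Unit) D A B ⊆
      G.slabEvent S D A B := by
  rintro ω ⟨a, ha, b, hb, haD, h⟩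
  refine ⟨(a.1, s), ha, (b.1, s), hb, haD, ?_⟩
  refine Relation.ReflTransGen.lift (fun v : G.verts × Unit => (v.1, s))
    (fun u v huv => ⟨?_, huv.2⟩) _ _ h
  obtain ⟨⟨h1, h2⟩, -⟩ := huv
  exact ⟨(layerEdge S s ⟨s(u, v), h1⟩).2, h2⟩

/-- If a crossing is possible at all, then its failure in a layer of independent edges decays
exponentially in the size of the rectangle, at large edge parameters. -/
theorem exists_layer_decay (hG : G.IsSymmetric) (hlf : G.IsLocallyFinite) {m : ℕ} (hm : 1 ≤ m)
    (hfull : (fun _ => true) ∈ G.crossX (⊥ : SimpleGraph Unit) 0 (2 * m : ℕ) 0 m) :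
    ∃ c : ℝ, 1 ≤ c ∧ ∀ (p : unitInterval) (θ : ℝ), 0 < θ → θ ≤ 1 → c * (1 - p) ≤ θ →
      ∀ n, m ≤ n →
        1 - (edgeLaw (G.slab (⊥ : SimpleGraph Unit)).edgeSet p).real
          (G.crossX (⊥ : SimpleGraph Unit) 0 (2 * n : ℕ) 0 n) ≤
          θ ^ (((n : ℝ) + 2) / (4 * m + 2)) / 169 := by
  have hloc : ∀ {a b c d : ℝ}, IsLocal (G.crossX (⊥ : SimpleGraph Unit) a b c d) :=
    isLocal_crossX hlf
  have hfull' : ∀ n, m ≤ n →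
      (fun _ => true) ∈ G.crossX (⊥ : SimpleGraph Unit) 0 (2 * n : ℕ) 0 n := by
    intro n hn
    refine full_mem_of_nonempty isUpperSet_crossX ?_
    -- At edge parameter 1 the 2m × m rectangle is crossed almost surely, hence so are longer
    -- rectangles of height m. Thus the crossing of the 2n × n rectangle is possible for all n ≥ m.
    have h1 := one_sub_crossX_le hG hlf
      (isSlabInvariant_edgeLaw (G := G) (S := (⊥ : SimpleGraph Unit)) 1) hm (2 * n) (2 * n)
      (by omega) (by nlinarith)
    have h2 := one_sub_edgeLaw_le (p := 1) (hloc (a := 0) (b := (2 * m : ℕ)) (c := 0)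
      (d := m)).choose_spec hfull
    rw [show ((1 : unitInterval) : ℝ) = 1 from rfl, sub_self, mul_zero] at h2
    have h3 : 0 < (edgeLaw (G.slab (⊥ : SimpleGraph Unit)).edgeSet 1).real
        (G.crossX (⊥ : SimpleGraph Unit) 0 (2 * n : ℕ) 0 m) := by
      have : (1 + 2 * ((2 * n : ℕ) : ℝ)) *
          (1 - (edgeLaw (G.slab (⊥ : SimpleGraph Unit)).edgeSet 1).real
            (G.crossX (⊥ : SimpleGraph Unit) 0 (2 * m : ℕ) 0 m)) ≤ 0 :=
        mul_nonpos_of_nonneg_of_nonpos (by positivity) h2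
      linarith
    have h4 := nonempty_of_measureReal_ne_zero h3.ne'
    exact h4.mono (crossX_mono_height le_rfl (by exact_mod_cast hn))
  let F : ℕ → ℕ := fun n =>
    (hloc (a := 0) (b := (2 * n : ℕ)) (c := 0) (d := n)).choose.card
  -- Multiplying by 169 = 13² turns the recursion into pure squaring. The sum bounds the number of
  -- relevant edges simultaneously at all base scales.
  set c := 169 * ∑ n ∈ Finset.Icc m (4 * m), F n + 1 with hc
  refine ⟨c, by exact_mod_cast (by omega : 1 ≤ c), fun p θ hθ0 hθ1 hθ n hn => ?_⟩
  have hp : 0 ≤ 1 - (p : ℝ) := by linarith [p.2.2]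
  rw [le_div_iff₀ (by norm_num), mul_comm]
  refine rpow_decay_of_recursion (u := fun n => 169 *
    (1 - (edgeLaw (G.slab (⊥ : SimpleGraph Unit)).edgeSet p).real
      (G.crossX (⊥ : SimpleGraph Unit) 0 (2 * n : ℕ) 0 n))) hm hθ0 hθ1 (fun n => ?_)
    (fun n h1 h2 => ?_) (fun n n' h1 h2 h3 => ?_) n hn
  · have : (edgeLaw (G.slab (⊥ : SimpleGraph Unit)).edgeSet p).real
      (G.crossX (⊥ : SimpleGraph Unit) 0 (2 * n : ℕ) 0 n) ≤ 1 := measureReal_le_one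
    linarith
  · refine le_trans ?_ hθ
    have h3 := one_sub_edgeLaw_le (p := p) (hloc (a := 0) (b := (2 * n : ℕ)) (c := 0)
      (d := n)).choose_spec (hfull' n h1)
    have h4 : F n ≤ ∑ n ∈ Finset.Icc m (4 * m), F n :=
      Finset.single_le_sum (f := F) (fun _ _ => Nat.zero_le _) (Finset.mem_Icc.2 ⟨h1, h2⟩)
    have h5 : (169 * F n : ℝ) ≤ c := by exact_mod_cast (by omega : 169 * F n ≤ c)
    calc _ ≤ 169 * (F n * (1 - p : ℝ)) := by linarith
      _ = 169 * F n * (1 - p) := by ring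
      _ ≤ _ := mul_le_mul_of_nonneg_right h5 hp
  · have h4 := crossX_recursion hG hlf p h1 h2 h3 (S := (⊥ : SimpleGraph Unit))
    nlinarith

/-- A crossing fails with a probability that is at least exponentially small. -/
theorem exists_pow_le_one_sub [Finite VS] [Nonempty VS] (S : SimpleGraph VS) (hG : G.IsSymmetric)
    (hlf : G.IsLocallyFinite) {q : ℝ} (hq : 1 ≤ q) :
    ∃ c : ℕ, 1 ≤ c ∧ ∀ p, 0 ≤ p → p ≤ 1 → ∀ φ : Measure (Config (G.slab S)),
      IsUniqueInfiniteVolume (G.slab S) p q φ → ∀ n : ℕ, 1 ≤ n →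
        (1 - p) ^ (c * n) ≤ 1 - φ.real (G.crossX S 0 (2 * n : ℕ) 0 n) := by
  obtain ⟨L, hL, hdeg⟩ := exists_slab_degree_le S hG hlf
  obtain ⟨c, hc1, hc⟩ := exists_encard_rectVerts_le hG hlf
  refine ⟨c * Nat.card VS * L * 2, ?_, fun p hp0 hp1 φ hφ n hn => ?_⟩
  · have := Nat.mul_pos (Nat.mul_pos hc1 (Nat.card_pos (α := VS))) hL
    omega
  obtain ⟨-, Λ, ξ, hΛ, hlim⟩ := (isInfiniteVolume_iff hp0 hp1 (by linarith)).1 hφ.1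
  have hX : (Prod.fst ⁻¹' G.rectVerts 0 (0 : ℕ) 0 n : Set (G.verts × VS)).encard ≤
      (c * Nat.card VS * (n + 1) : ℕ) := by
    rw [encard_column]
    refine (mul_le_mul_left (hc 0 n) _).trans ?_
    norm_cast
    apply le_of_eq
    ring
  have hE := encard_incident_le hdeg hX
  have hEfin := Set.finite_of_encard_le_coe hE
  set F := hEfin.toFinset with hFdef
  have hF : F.card ≤ c * Nat.card VS * L * 2 * n := by
    rw [← hEfin.coe_toFinset, Set.encard_coe_eq_coe_finsetCard, ← hFdef] at hE
    have h1 : F.card ≤ c * Nat.card VS * (n + 1) * L := by exact_mod_cast hE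
    refine h1.trans ?_
    calc c * Nat.card VS * (n + 1) * L ≤ c * Nat.card VS * (2 * n) * L := by gcongr; omega
      _ = _ := by ring
  have hloc : IsLocal (G.crossX S 0 (2 * n : ℕ) 0 n) := isLocal_crossX hlf
  have h1 := hlim.le_edgeLaw hΛ ⟨hp0, hp1⟩ hq hloc isUpperSet_crossX
  set μ := edgeLaw (G.slab S).edgeSet ⟨p, hp0, hp1⟩
  -- Closing all edges at the left side of the rectangle, of which there are O(n), prevents a
  -- crossing.
  have h2 : {ω : Config (G.slab S) | ∀ e ∈ F, ω e = false} ⊆ (G.crossX S 0 (2 * n : ℕ) 0 n)ᶜ := by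
    rintro ω hω ⟨x, hx, y, hy, hxD, hxy⟩
    have hx0 : x.1.1.1 = 0 := hx
    have hy0 : y.1.1.1 = (2 * n : ℕ) := hy
    rcases Relation.ReflTransGen.cases_head hxy with rfl | ⟨z, ⟨⟨hxz, hopen⟩, -⟩, -⟩
    · rw [hx0] at hy0
      have : 0 = 2 * n := by exact_mod_cast hy0
      omega
    · have := hω ⟨s(x, z), hxz⟩ (hEfin.mem_toFinset.2 ⟨x, by simp, ?_⟩)
      · rw [hopen] at this
        exact absurd this (by simp)
      · exact ⟨⟨hx0.ge, by rw [hx0]; simp⟩, hxD.2⟩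
  have h3 : μ.real {ω : Config (G.slab S) | ∀ e ∈ F, ω e = false} ≤ _ := measureReal_mono h2
  rw [edgeLaw_all_closed, probReal_compl_eq_one_sub hloc.measurableSet] at h3
  have h4 := pow_le_pow_of_le_one (by linarith : (0 : ℝ) ≤ 1 - p) (by linarith) hF
  simp only at h3
  linarith

end Planar
end PlaneGraph

/-! ### Crossing long strips in the three parameter regimes. -/

namespace PlaneGraph
section Strips
variable {G : PlaneGraph} {VS : Type*} {S : SimpleGraph VS}

theorem two_le_ceil_div {n N : ℕ} (hn : 1 ≤ n) (hN : n < N) : 2 ≤ ⌈(N : ℝ) / n⌉₊ := by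
  refine Nat.lt_ceil.2 ?_
  rw [Nat.cast_one, lt_div_iff₀ (by exact_mod_cast hn), one_mul]
  exact_mod_cast hN

theorem le_ceil_div_mul {n : ℕ} (hn : 1 ≤ n) (N : ℕ) : N ≤ ⌈(N : ℝ) / n⌉₊ * n := by
  have h := Nat.le_ceil ((N : ℝ) / n)
  rw [div_le_iff₀ (by exact_mod_cast hn)] at h
  exact_mod_cast h

theorem one_sub_crossX_nonneg {φ : Measure (Config (G.slab S))} [IsProbabilityMeasure φ]
    {a b c d : ℝ} : 0 ≤ 1 - φ.real (G.crossX S a b c d) := by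
  linarith [measureReal_le_one (μ := φ) (s := G.crossX S a b c d)]

/-- Long strips at large edge parameters. -/
theorem exists_strip_bound_large [Finite VS] [Nonempty VS] (S : SimpleGraph VS) (hG : G.IsSymmetric)
    (hlf : G.IsLocallyFinite) {q : ℝ} (hq : 1 ≤ q) :
    ∃ p₁ b : ℝ, p₁ < 1 ∧ 0 < b ∧ ∀ p, 0 ≤ p → p₁ ≤ p → p < 1 →
      ∀ φ : Measure (Config (G.slab S)), IsUniqueInfiniteVolume (G.slab S) p q φ →
      ∀ n N : ℕ, 1 ≤ n → n < N →
        1 - φ.real (G.crossX S 0 (2 * N : ℕ) 0 n) ≤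
          2 * (⌈(N : ℝ) / n⌉₊ : ℝ) * (1 - φ.real (G.crossX S 0 (2 * n : ℕ) 0 n)) ^ b := by
  classical
  -- If even a fully open layer has no crossing, the slab has none either; then ε = 1 and the right
  -- side is at least 4.
  have hempty : ∀ n : ℕ, (fun _ => true) ∉ G.crossX (⊥ : SimpleGraph Unit) 0 (2 * n : ℕ) 0 n →
      ∀ (φ : Measure (Config (G.slab S))) (b : ℝ), IsProbabilityMeasure φ → ∀ N : ℕ, 1 ≤ n →
      n < N → 1 - φ.real (G.crossX S 0 (2 * N : ℕ) 0 n) ≤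
          2 * (⌈(N : ℝ) / n⌉₊ : ℝ) * (1 - φ.real (G.crossX S 0 (2 * n : ℕ) 0 n)) ^ b := by
    intro n hn φ b hφ N hn1 hN
    have h1 : G.crossX S 0 (2 * n : ℕ) 0 n = ∅ := by
      by_contra hne
      exact hn (full_mem_crossX_of_nonempty (Set.nonempty_iff_ne_empty.2 hne))
    have h2 : (2 : ℝ) ≤ ⌈(N : ℝ) / n⌉₊ := by exact_mod_cast two_le_ceil_div hn1 hN
    rw [h1, measureReal_empty, sub_zero, Real.one_rpow, mul_one]
    have : 0 ≤ φ.real (G.crossX S 0 (2 * N : ℕ) 0 n) := measureReal_nonneg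
    linarith
  by_cases hex : ∃ m : ℕ, 1 ≤ m ∧
      (fun _ => true) ∈ G.crossX (⊥ : SimpleGraph Unit) 0 (2 * m : ℕ) 0 m
  swap
  · push Not at hex
    exact ⟨0, 1, one_pos, one_pos, fun p _ _ _ φ hφ n N hn hN =>
      hempty n (hex n hn) φ 1 hφ.1.1 N hn hN⟩
  set m := Nat.find hex with hm
  obtain ⟨hm1, hmfull⟩ := Nat.find_spec hex
  rw [← hm] at hm1 hmfull
  obtain ⟨c₁, hc₁, hdecay⟩ := exists_layer_decay hG hlf hm1 hmfull
  obtain ⟨c, hc1, hlow⟩ := exists_pow_le_one_sub S hG hlf hq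
  set K := c₁ * q with hK
  have hK1 : 1 ≤ K := by nlinarith
  have hcm : (0 : ℝ) < c * (8 * m + 4) := by
    have : (1 : ℝ) ≤ c := by exact_mod_cast hc1
    positivity
  -- This choice gives K(1 − p) ≤ (1 − p)^(1/2), so the decay holds with base θ = (1 − p)^(1/2). The
  -- exponent b turns the lower bound (1 − p)^(cn) for ε into an upper bound for the layer's
  -- failure.
  refine ⟨1 - 1 / K ^ 2, 1 / (c * (8 * m + 4)), ?_, by positivity,
    fun p hp0 hp hp1 φ hφ n N hn hN => ?_⟩
  · have : 0 < 1 / K ^ 2 := by positivity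
    linarith
  obtain ⟨hprob, Λ, ξ, hΛ, hlim⟩ := (isInfiniteVolume_iff hp0 hp1.le (by linarith)).1 hφ.1
  rcases lt_or_ge n m with hnm | hnm
  · refine hempty n (fun h => ?_) φ _ hprob N hn hN
    exact Nat.find_min hex hnm ⟨hn, h⟩
  set M := ⌈(N : ℝ) / n⌉₊ with hM
  have hM2 : (2 : ℝ) ≤ M := by exact_mod_cast two_le_ceil_div hn hN
  have hNM : N ≤ M * n := le_ceil_div_mul hn N
  -- The parameter p/(p + q(1 − p)) of the independent percolation dominated by φ; its defect is at
  -- most q(1 − p).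
  set pt : unitInterval := ⟨_, div_mem_unitInterval ⟨hp0, hp1.le⟩ (zero_le_one.trans hq)⟩ with hpt
  have hpp : (1 : ℝ) - pt ≤ q * (1 - p) := by
    have h1 : 1 ≤ p + q * (1 - p) := by nlinarith
    have h2 : (1 : ℝ) - pt = q * (1 - p) / (p + q * (1 - p)) := by
      rw [hpt]
      simp only
      field_simp
      ring
    rw [h2]
    exact div_le_self (mul_nonneg (by linarith) (by linarith)) h1
  set t := 1 - p with ht
  have ht0 : 0 < t := by linarith
  have ht1 : t ≤ 1 := by linarith
  have hsq : K * t ≤ t ^ (1 / 2 : ℝ) := by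
    rw [← Real.sqrt_eq_rpow]
    refine Real.le_sqrt_of_sq_le ?_
    have h1 : t * K ^ 2 ≤ 1 := by
      rw [← le_div_iff₀ (by positivity)]
      linarith
    nlinarith
  have hθ1 : t ^ (1 / 2 : ℝ) ≤ 1 := Real.rpow_le_one ht0.le ht1 (by norm_num)
  have hu := hdecay pt (t ^ (1 / 2 : ℝ)) (by positivity) hθ1 (by nlinarith) n hnm
  set μ := edgeLaw (G.slab (⊥ : SimpleGraph Unit)).edgeSet pt
  set u := 1 - μ.real (G.crossX (⊥ : SimpleGraph Unit) 0 (2 * n : ℕ) 0 n)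
  have hlong := one_sub_crossX_le hG hlf (isSlabInvariant_edgeLaw (G := G)
    (S := (⊥ : SimpleGraph Unit)) pt) hn (2 * M) (2 * N) (by omega) (by nlinarith)
  have hlayer : μ.real (G.crossX (⊥ : SimpleGraph Unit) 0 (2 * N : ℕ) 0 n) ≤
      φ.real (G.crossX S 0 (2 * N : ℕ) 0 n) := by
    obtain ⟨s⟩ := ‹Nonempty VS›
    refine le_trans ?_ (hlim.edgeLaw_le hΛ ⟨hp0, hp1.le⟩ hq (isLocal_crossX hlf) isUpperSet_crossX)
    rw [← edgeLaw_preimage (layerEdge_injective (S := S) s) (isLocal_crossX hlf).measurableSet]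
    exact measureReal_mono (layer_slabEvent_subset s _ _ _)
  set ε := 1 - φ.real (G.crossX S 0 (2 * n : ℕ) 0 n)
  have hε := hlow p hp0 hp1.le φ hφ n hn
  have hε2 : (t ^ (1 / 2 : ℝ)) ^ (((n : ℝ) + 2) / (4 * m + 2)) ≤
      ε ^ (1 / (c * (8 * m + 4)) : ℝ) := by
    calc (t ^ (1 / 2 : ℝ)) ^ (((n : ℝ) + 2) / (4 * m + 2)) =
        t ^ (((n : ℝ) + 2) / (8 * m + 4)) := by
          rw [← Real.rpow_mul ht0.le]
          congr 1
          field_simp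
          ring
      _ ≤ t ^ ((n : ℝ) / (8 * m + 4)) := by
          refine Real.rpow_le_rpow_of_exponent_ge ht0 ht1 ?_
          gcongr
          linarith
      _ = (t ^ (c * n)) ^ (1 / (c * (8 * m + 4)) : ℝ) := by
          rw [← Real.rpow_natCast, ← Real.rpow_mul ht0.le]
          congr 1
          push_cast
          have : (c : ℝ) ≠ 0 := by
            have : (1 : ℝ) ≤ c := by exact_mod_cast hc1
            positivity
          field_simp
      _ ≤ _ := Real.rpow_le_rpow (by positivity) hε (by positivity)
  have hu0 : 0 ≤ u := one_sub_crossX_nonneg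
  rw [Nat.cast_mul 2 M, Nat.cast_ofNat] at hlong
  calc 1 - φ.real (G.crossX S 0 (2 * N : ℕ) 0 n) ≤ (1 + 2 * (2 * (M : ℝ))) * u := by
        linarith
    _ ≤ 5 * M * u := by nlinarith
    _ ≤ 5 * M * (ε ^ (1 / (c * (8 * m + 4)) : ℝ) / 169) := by
        refine mul_le_mul_of_nonneg_left (hu.trans ?_) (by linarith)
        linarith
    _ ≤ 2 * M * ε ^ (1 / (c * (8 * m + 4)) : ℝ) := by
        have : 0 ≤ (M : ℝ) * ε ^ (1 / (c * (8 * m + 4)) : ℝ) :=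
          mul_nonneg (by linarith) (Real.rpow_nonneg one_sub_crossX_nonneg _)
        linarith

/-- If ε stays away from zero, a small exponent makes the error term 2⌈N/n⌉ε^b at least 1, since
⌈N/n⌉ ≥ 2; then the strip bound is trivial. -/
theorem exists_rpow_ge {e : ℝ} (he : 0 < e) :
    ∃ b₀ : ℝ, 0 < b₀ ∧ ∀ ε b : ℝ, e ≤ ε → 0 ≤ b → b ≤ b₀ → 1 / 4 ≤ ε ^ b := by
  set e' := min e (1 / 4) with he'
  have h0 : 0 < e' := lt_min he (by norm_num)
  have h1 : e' < 1 := (min_le_right _ _).trans_lt (by norm_num)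
  have hl : Real.log e' < 0 := Real.log_neg h0 h1
  have hl4 : Real.log (1 / 4) < 0 := Real.log_neg (by norm_num) (by norm_num)
  refine ⟨Real.log (1 / 4) / Real.log e', div_pos_of_neg_of_neg hl4 hl, fun ε b hε hb hb' => ?_⟩
  calc (1 / 4 : ℝ) = e' ^ (Real.log (1 / 4) / Real.log e') := by
        rw [Real.rpow_def_of_pos h0, mul_div_cancel₀ _ hl.ne, Real.exp_log (by norm_num)]
    _ ≤ e' ^ b := Real.rpow_le_rpow_of_exponent_ge h0 h1.le hb'
    _ ≤ ε ^ b := Real.rpow_le_rpow h0.le ((min_le_left _ _).trans hε) hb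

/-- Long strips at intermediate edge parameters. -/
theorem exists_strip_bound_mid [Finite VS] (hG : G.IsSymmetric) (hlf : G.IsLocallyFinite)
    (hS : S.Connected) {p₀ p₁ q : ℝ} (h0 : 0 < p₀) (h1 : p₁ < 1) (hq : 1 ≤ q) :
    ∃ e b : ℝ, 0 < e ∧ 0 < b ∧ ∀ p, p₀ ≤ p → p ≤ p₁ →
      ∀ φ : Measure (Config (G.slab S)), IsUniqueInfiniteVolume (G.slab S) p q φ →
      ∀ n N : ℕ, 1 ≤ n → n < N → 1 - φ.real (G.crossX S 0 (2 * n : ℕ) 0 n) ≤ e →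
        φ.real (G.crossX S 0 (2 * n : ℕ) 0 n) ≤ φ.real (G.crossX S 0 (2 * N : ℕ) 0 n) +
          2 * (⌈(N : ℝ) / n⌉₊ : ℝ) * (1 - φ.real (G.crossX S 0 (2 * n : ℕ) 0 n)) ^ b := by
  have : Nonempty VS := hS.nonempty
  obtain ⟨C, b, n₀, hC, hb, hn₀, hext⟩ := exists_extension_bound (G := G) (S := S) hG hlf hS h0 h1 hq
  obtain ⟨c, hc1, hlow⟩ := exists_pow_le_one_sub S hG hlf hq
  rcases le_or_gt p₀ p₁ with hpp | hpp
  swap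
  · exact ⟨1, 1, one_pos, one_pos, fun p h h' => absurd (h.trans h') hpp.not_ge⟩
  -- For ε ≤ e₀ one has 3C ε^(b/2) ≤ 1: half of the exponent absorbs the constant of the iteration.
  set e₀ := (1 / (3 * C)) ^ (2 / b) with he₀
  have hC0 : 0 < 1 / (3 * C) := by positivity
  have he₀0 : 0 < e₀ := by positivity
  have hp₁ : 0 < 1 - p₁ := by linarith
  refine ⟨min e₀ ((1 - p₁) ^ (c * n₀) / 2), b / 2, lt_min he₀0 (by positivity), by positivity,
    fun p hp hp' φ hφ n N hn hN he => ?_⟩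
  have hp0 : 0 ≤ p := h0.le.trans hp
  have hp1 : p ≤ 1 := hp'.trans h1.le
  have hprob := hφ.1.1
  set ε := 1 - φ.real (G.crossX S 0 (2 * n : ℕ) 0 n) with hε
  have hε1 := hlow p hp0 hp1 φ hφ n hn
  have hε0 : 0 < ε := lt_of_lt_of_le (pow_pos (by linarith) _) hε1
  -- For n < n₀ finite energy gives ε ≥ (1 − p₁)^(c n₀), which the second bound in the minimum
  -- excludes.
  have hnn : n₀ ≤ n := by
    by_contra! hlt
    have h2 : (1 - p₁) ^ (c * n₀) ≤ (1 - p) ^ (c * n) :=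
      (pow_le_pow_left₀ hp₁.le (by linarith) _).trans
        (pow_le_pow_of_le_one (by linarith) (by linarith) (Nat.mul_le_mul_left _ hlt.le))
    have h3 : 0 < (1 - p₁) ^ (c * n₀) := by positivity
    have h4 := he.trans (min_le_right _ _)
    linarith
  set M := ⌈(N : ℝ) / n⌉₊ with hM
  have hM2 : 2 ≤ M := two_le_ceil_div hn hN
  have hNM : N ≤ M * n := le_ceil_div_mul hn N
  have hCε : 0 ≤ C * ε ^ b := by positivity
  -- Since n ≥ 2, the step n/2 (rounded down) is at least n/3, so 6⌈N/n⌉ steps suffice to reach the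
  -- width 2N.
  have key := le_add_of_steps (P := fun w => φ.real (G.crossX S 0 w 0 n)) (g := C * ε ^ b)
    (m := 2 * n) (j := n / 2) hCε
    (fun w j hw hj => hext p hp hp' φ hφ n w j hnn hw (by omega) (by linarith)) (6 * M) (2 * N)
    (by omega) (by
      have h2 : n ≤ 3 * (n / 2) := by omega
      calc 2 * N ≤ 2 * (M * n) := by omega
        _ ≤ 2 * (M * (3 * (n / 2))) := by gcongr
        _ = 6 * M * (n / 2) := by ring
        _ ≤ _ := Nat.le_add_left _ _)
  refine key.trans (add_le_add le_rfl ?_)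
  have h3 : ε ^ (b / 2) ≤ 1 / (3 * C) := by
    calc ε ^ (b / 2) ≤ e₀ ^ (b / 2) :=
          Real.rpow_le_rpow hε0.le (he.trans (min_le_left _ _)) (by positivity)
      _ = 1 / (3 * C) := by
          rw [he₀, ← Real.rpow_mul hC0.le, show 2 / b * (b / 2) = 1 by field_simp, Real.rpow_one]
  have h4 : ε ^ b = ε ^ (b / 2) * ε ^ (b / 2) := by
    rw [← Real.rpow_add hε0]
    congr 1
    ring
  have h5 : 3 * C * ε ^ (b / 2) ≤ 1 := by
    rw [le_div_iff₀ (by positivity)] at h3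
    linarith
  have h6 : 0 ≤ ε ^ (b / 2) := by positivity
  have hM0 : (0 : ℝ) ≤ M := Nat.cast_nonneg _
  rw [h4]
  push_cast
  calc 6 * (M : ℝ) * (C * (ε ^ (b / 2) * ε ^ (b / 2))) =
      2 * M * ((3 * C * ε ^ (b / 2)) * ε ^ (b / 2)) := by ring
    _ ≤ 2 * M * (1 * ε ^ (b / 2)) := by gcongr
    _ = _ := by ring

/-- A lower bound for the crossing probabilities of long strips. -/
theorem exists_strip_bound [Finite VS] (hG : G.IsSymmetric) (hlf : G.IsLocallyFinite)
    (hS : S.Connected) {q : ℝ} (hq : 1 ≤ q) :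
    ∃ b : ℝ, 0 < b ∧ ∀ p, 0 ≤ p → p < 1 →
      ∀ φ : Measure (Config (G.slab S)), IsUniqueInfiniteVolume (G.slab S) p q φ →
      ∀ n N : ℕ, 1 ≤ n → n < N →
        φ.real (G.crossX S 0 (2 * n : ℕ) 0 n) ^ (2 * (N : ℝ) / n) -
          2 * (⌈(N : ℝ) / n⌉₊ : ℝ) * (1 - φ.real (G.crossX S 0 (2 * n : ℕ) 0 n)) ^ b ≤
          φ.real (G.crossX S 0 (2 * N : ℕ) 0 n) := by
  have : Nonempty VS := hS.nonempty
  obtain ⟨p₀, hp₀, hp₀1, hsmall⟩ := exists_crossX_le_half S hG hlf hq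
  obtain ⟨p₁, b₁, hp₁, hb₁, hlarge⟩ := exists_strip_bound_large S hG hlf hq
  obtain ⟨e, b₂, he, hb₂, hmid⟩ := exists_strip_bound_mid (G := G) (S := S) hG hlf hS hp₀ hp₁ hq
  obtain ⟨c, hc1, hlow⟩ := exists_pow_le_one_sub S hG hlf hq
  obtain ⟨b₀, hb₀, hge⟩ := exists_rpow_ge (lt_min he (by norm_num : (0 : ℝ) < 1 / 2))
  set b := min b₀ (min b₁ b₂) with hb
  have hb0 : 0 < b := lt_min hb₀ (lt_min hb₁ hb₂)
  refine ⟨b, hb0, fun p hp0 hp1 φ hφ n N hn hN => ?_⟩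
  have hprob := hφ.1.1
  set x := φ.real (G.crossX S 0 (2 * n : ℕ) 0 n) with hx
  set y := φ.real (G.crossX S 0 (2 * N : ℕ) 0 n) with hy
  set M := ⌈(N : ℝ) / n⌉₊ with hM
  have hM2 : (2 : ℝ) ≤ M := by exact_mod_cast two_le_ceil_div hn hN
  have hx0 : 0 ≤ x := measureReal_nonneg
  have hx1 : x ≤ 1 := measureReal_le_one
  have hy0 : 0 ≤ y := measureReal_nonneg
  have hε0 : 0 < 1 - x := lt_of_lt_of_le (pow_pos (by linarith) _) (hlow p hp0 hp1.le φ hφ n hn)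
  have hn0 : (0 : ℝ) < n := by exact_mod_cast hn
  have hexp : 1 ≤ 2 * (N : ℝ) / n := by
    rw [le_div_iff₀ hn0]
    have : (n : ℝ) ≤ N := by exact_mod_cast hN.le
    linarith
  have hxp1 : x ^ (2 * (N : ℝ) / n) ≤ 1 := Real.rpow_le_one hx0 hx1 (by linarith)
  -- If ε is bounded below, the subtracted term is at least 2·2·(1/4) = 1, so the left side is
  -- nonpositive.
  have htriv : min e (1 / 2) ≤ 1 - x →
      x ^ (2 * (N : ℝ) / n) - 2 * (M : ℝ) * (1 - x) ^ b ≤ y := by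
    intro h
    have h2 := hge _ b h hb0.le (min_le_left _ _)
    nlinarith
  have hmono : ∀ b', b ≤ b' → (1 - x) ^ b' ≤ (1 - x) ^ b := fun b' h =>
    Real.rpow_le_rpow_of_exponent_ge hε0 (by linarith) h
  rcases le_or_gt p p₀ with hp | hp
  · refine htriv ((min_le_right _ _).trans ?_)
    linarith [hsmall p hp0 hp φ hφ n hn]
  rcases le_or_gt p₁ p with hp' | hp'
  · have h2 := hlarge p hp0 hp' hp1 φ hφ n N hn hN
    have h3 := mul_le_mul_of_nonneg_left (hmono b₁ ((min_le_right _ _).trans (min_le_left _ _)))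
      (by linarith : (0 : ℝ) ≤ 2 * M)
    linarith
  · rcases le_or_gt (min e (1 / 2)) (1 - x) with h | h
    · exact htriv h
    · have h2 := hmid p hp.le hp'.le φ hφ n N hn hN (h.le.trans (min_le_left _ _))
      have h3 := mul_le_mul_of_nonneg_left (hmono b₂ ((min_le_right _ _).trans (min_le_right _ _)))
        (by linarith : (0 : ℝ) ≤ 2 * M)
      -- The exponent is at least 1; in this regime the first power of the crossing probability
      -- would already do.
      have h4 : x ^ (2 * (N : ℝ) / n) ≤ x := by
        rcases hx0.eq_or_lt with h5 | h5
        · rw [← h5, Real.zero_rpow (by linarith)]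
        · nth_rewrite 2 [← Real.rpow_one x]
          exact Real.rpow_le_rpow_of_exponent_ge h5 hx1 hexp
      linarith

end Strips
end PlaneGraph

/-! ### Disjoint strips and the conclusion. -/

/-- The rounding loses at most a factor 2 in the number of strips. The constant 4 of
`rcProb_compl_le` thereby becomes the 2 of the final bound. -/
theorem div_two_mul_le_div {n N : ℕ} (hn : 1 ≤ n) (hN : n < N) :
    (N : ℝ) / n ≤ 2 * ((N + 1) / (n + 1) : ℕ) := by
  set k := (N + 1) / (n + 1) with hk
  have h1 := Nat.div_add_mod (N + 1) (n + 1)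
  have h2 := Nat.mod_lt (N + 1) (show n + 1 > 0 by omega)
  have hk1 : 1 ≤ k := (Nat.one_le_div_iff (Nat.succ_pos n)).2 (by omega)
  rw [← hk] at h1
  rw [div_le_iff₀ (by exact_mod_cast hn)]
  have h3 : N + 1 ≤ (n + 1) * k + n := by omega
  have h4 : k + n ≤ k * n + 1 := by
    obtain ⟨a, ha⟩ := Nat.exists_eq_add_of_le hk1
    obtain ⟨b, hb⟩ := Nat.exists_eq_add_of_le hn
    rw [ha, hb]
    nlinarith [Nat.zero_le (a * b)]
  have h5 : N ≤ 2 * k * n := by nlinarith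
  exact_mod_cast h5

namespace PlaneGraph

/-- Comparison of the crossing probabilities at two edge parameters, by means of disjoint strips. -/
theorem one_sub_crossX_le_exp {G : PlaneGraph} {VS : Type*} [Finite VS] {S : SimpleGraph VS}
    (hG : G.IsSymmetric) (hlf : G.IsLocallyFinite) {p p' q : ℝ} (hq : 1 ≤ q) (h0 : 0 ≤ p)
    (hpp : p < p') (h1 : p' ≤ 1) {φ φ' : Measure (Config (G.slab S))}
    (hφ : IsUniqueInfiniteVolume (G.slab S) p q φ)
    (hφ' : IsUniqueInfiniteVolume (G.slab S) p' q φ') {n N : ℕ} (hn : 1 ≤ n) (hN : n < N) :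
    1 - φ'.real (G.crossX S 0 (2 * N : ℕ) 0 N) ≤ (1 - φ.real (G.crossX S 0 (2 * N : ℕ) 0 N)) *
      Real.exp (-(2 * (p' - p) * ((N : ℝ) / n) * φ.real (G.crossX S 0 (2 * N : ℕ) 0 n))) := by
  have hq0 : 0 < q := by linarith
  have hprob := hφ.1.1
  have hprob' := hφ'.1.1
  obtain ⟨Λ, ξ, hΛ, hlim, hlim'⟩ := exists_common_exhaustion h0 (hpp.le.trans h1)
    (h0.trans hpp.le) h1 hq0 hφ hφ'
  have hinv := isSlabInvariant_of_unique h0 (hpp.le.trans h1) hq0 hφ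
  -- Strips of height n start at the multiples of n + 1, so that they share no vertex; the last one
  -- ends at k(n + 1) − 1 ≤ N.
  set k := (N + 1) / (n + 1) with hk
  set B : ℕ → Set (Config (G.slab S)) := fun i =>
    G.crossX S 0 (2 * N : ℕ) (i * (n + 1) : ℕ) ((i * (n + 1) : ℕ) + n) with hB
  have hloc : IsLocal (G.crossX S 0 (2 * N : ℕ) 0 N) := isLocal_crossX hlf
  have key := hlim.compl_le_exp hlim' h0 hpp h1 hq hloc isUpperSet_crossX (Finset.range k) B
    (fun i => edgesIn (G.slab S) (Prod.fst ⁻¹'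
      G.rectVerts 0 (2 * N : ℕ) (i * (n + 1) : ℕ) ((i * (n + 1) : ℕ) + n)))
    (fun i _ j _ hij => edgesIn_disjoint ?_)
    (fun i _ => edgesIn_finite (finite_preimage_fst (rectVerts_finite hlf _ _ _ _)))
    (fun i _ => determinedBy_connEvent) (fun i _ => isUpperSet_connEvent) (fun i hi => ?_)
  · have hBi : ∀ i, φ.real (B i) = φ.real (G.crossX S 0 (2 * N : ℕ) 0 n) :=
      fun i => hinv.crossX_translate_up hG hlf _ _ _
    rw [probReal_compl_eq_one_sub hloc.measurableSet, probReal_compl_eq_one_sub hloc.measurableSet,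
      Finset.sum_congr rfl fun i _ => hBi i, Finset.sum_const, Finset.card_range,
      nsmul_eq_mul] at key
    refine key.trans (mul_le_mul_of_nonneg_left (Real.exp_le_exp.2 (neg_le_neg ?_))
      one_sub_crossX_nonneg)
    have h2 := div_two_mul_le_div hn hN
    rw [← hk] at h2
    have h3 : 0 ≤ φ.real (G.crossX S 0 (2 * N : ℕ) 0 n) := measureReal_nonneg
    have h4 : 0 ≤ p' - p := by linarith
    calc 2 * (p' - p) * ((N : ℝ) / n) * φ.real (G.crossX S 0 (2 * N : ℕ) 0 n) ≤
        2 * (p' - p) * (2 * k) * φ.real (G.crossX S 0 (2 * N : ℕ) 0 n) := by gcongr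
      _ = _ := by ring
  · have hlt : ∀ i j : ℕ, i < j → ((i * (n + 1) : ℕ) : ℝ) + n < (j * (n + 1) : ℕ) := by
      intro i j h
      have : (i + 1) * (n + 1) ≤ j * (n + 1) := Nat.mul_le_mul_right _ h
      exact_mod_cast (by linarith : i * (n + 1) + n < j * (n + 1))
    rw [Set.disjoint_left]
    rintro v ⟨-, h2, h3⟩ ⟨-, h4, h5⟩
    rcases lt_or_gt_of_ne hij with h | h
    · linarith [hlt i j h]
    · linarith [hlt j i h]
  · refine crossX_mono_height (Nat.cast_nonneg _) ?_
    have h2 := Nat.div_mul_le_self (N + 1) (n + 1)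
    have h3 : (i + 1) * (n + 1) ≤ k * (n + 1) := Nat.mul_le_mul_right _ (Finset.mem_range.1 hi)
    exact_mod_cast (by rw [← hk] at h2; linarith : i * (n + 1) + n ≤ N)

end PlaneGraph

theorem mainTheorem10 (q : ℝ) (hq : 1 ≤ q) (G : PlaneGraph) (hG : G.graph.Connected)
    (hlf : G.IsLocallyFinite) (hsym : G.IsSymmetric)
    {VS : Type*} [Finite VS] (S : SimpleGraph VS) (hS : S.Connected) :
    ∃ β : ℝ, 0 < β ∧
      ∀ p p' : ℝ, 0 ≤ p → p < p' → p' ≤ 1 →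
      ∀ φ φ' : Measure (Config (G.slab S)),
        IsUniqueInfiniteVolume (G.slab S) p q φ →
        IsUniqueInfiniteVolume (G.slab S) p' q φ' →
      ∀ n N : ℕ, 1 ≤ n → n < N →
        (1 - φ'.real (crossH G S (2 * N) N)) / (1 - φ.real (crossH G S (2 * N) N)) ≤
          Real.exp (-2 * (p' - p) * ((N : ℝ) / n) *
            (φ.real (crossH G S (2 * n) n) ^ (2 * (N : ℝ) / n) -
              2 * (⌈(N : ℝ) / n⌉₊ : ℝ) * (1 - φ.real (crossH G S (2 * n) n)) ^ β)) := by
  obtain ⟨β, hβ, hstrip⟩ := PlaneGraph.exists_strip_bound (S := S) hsym hlf hS hq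
  refine ⟨β, hβ, fun p p' h0 hpp h1 φ φ' hφ hφ' n N hn hN => ?_⟩
  have hcross : ∀ m : ℕ, crossH G S (2 * m) m = G.crossX S 0 (2 * m : ℕ) 0 m := fun m => by
    rw [PlaneGraph.crossH_eq_crossX]
    push_cast
    rfl
  rw [hcross, hcross]
  have hprob := hφ.1.1
  have h2 := hstrip p h0 (hpp.trans_le h1) φ hφ n N hn hN
  have h3 := PlaneGraph.one_sub_crossX_le_exp hsym hlf hq h0 hpp h1 hφ hφ' hn hN
  -- This form of the division also covers a vanishing denominator, where the quotient is zero by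
  -- convention.
  refine (div_le_of_le_mul₀ PlaneGraph.one_sub_crossX_nonneg (Real.exp_pos _).le
    (h3.trans_eq (mul_comm _ _))).trans (Real.exp_le_exp.2 ?_)
  have h4 : 0 ≤ 2 * (p' - p) * ((N : ℝ) / n) :=
    mul_nonneg (by linarith) (div_nonneg (Nat.cast_nonneg _) (Nat.cast_nonneg _))
  have h5 := mul_le_mul_of_nonneg_left h2 h4
  linarith
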